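/- Conventions. Let $N\ge 1$. For $k\in\mathbb N$, $H^k=H^k(\mathbb R^N)$ is the Sobolev space of complex-valued functions with norm $\|f\|_{H^k}=\big(\sum_{|\alpha|\le k}\|\partial^\alpha f\|_{L^2}^2\big)^{1/2}$, and $\|f\|_{\dot H^\ell}=\big(\sum_{|\alpha|=\ell}\|\partial^\alpha f\|_{L^2}^2\big)^{1/2}$, $\|\nabla f\|_{\dot H^\ell}=\big(\sum_{i=1}^N\|\partial_i f\|_{\dot H^\ell}^2\big)^{1/2}$. Moreover $\langle z_1,z_2\rangle_{\mathbb C}=\mathrm{Re}(z_1\bar z_2)$ and $\|f\|_{\mathcal C^0([0,T],X)}=\sup_{t\in[0,T]}\|f(\cdot,t)\|_X$. Consider the equations $$i\partial_t\Psi_\varepsilon+(1-\varepsilon|\Psi_\varepsilon|^2)^{1/2}\Delta\Psi_\varepsilon+\frac{|\Psi_\varepsilon|^2}{1+(1-\varepsilon|\Psi_\varepsilon|^2)^{1/2}}\Psi_\varepsilon+\varepsilon\,\mathrm{div}\Big(\frac{\langle\Psi_\varepsilon,\nabla\Psi_\varepsilon\rangle_{\mathbb C}}{(1-\varepsilon|\Psi_\varepsilon|^2)^{1/2}}\Big)\Psi_\varepsilon=0,\qquad(\mathrm{NLS}_\varepsilon)$$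 $$i\partial_t\Psi+\Delta\Psi+\tfrac12|\Psi|^2\Psi=0,\qquad(\mathrm{CS})$$ in the sense of distributions. **Proposition.** Let $0<\sigma<1$ and $k\in\mathbb N$. There exists a number $C_*>0$, depending only on $\sigma$ and $k$ (and not on $\varepsilon$), with the following property. Let $N\ge1$ be such that $k>N/2+2$, and let $0<\varepsilon<1$ and $T>0$. Let $\Psi_\varepsilon^0\in H^{k+3}(\mathbb R^N)$, and assume that the solution $\Psi_\varepsilon\in\mathcal C^0([0,T],H^{k+2}(\mathbb R^N))$ of $(\mathrm{NLS}_\varepsilon)$ with initial datum $\Psi_\varepsilon^0$ is well-defined on $[0,T]$ and satisfies $$\varepsilon^{1/2}\|\Psi_\varepsilon(\cdot,t)\|_{L^\infty}\le\sigma\qquad\text{for all }t\in[0,T].$$ Let $\Psi^0\in H^k(\mathbb R^N)$, and assume that the solution $\Psi\in\mathcal C^0([0,T],H^k(\mathbb R^N))$ of $(\mathrm{CS})$ with initial datum $\Psi^0$ is well-defined on $[0,T]$. Set $u_\varepsilon=\Psi_\varepsilon-\Psi$ and $$\mathcal K_\varepsilon(T)=\|\Psi\|_{\mathcal C^0([0,T],H^k)}+\|\Psi_\varepsilon\|_{\mathcal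 C^0([0,T],H^k)}+\varepsilon^{1/2}\|\nabla\Psi_\varepsilon\|_{\mathcal C^0([0,T],\dot H^k)}+\varepsilon\|\Delta\Psi_\varepsilon\|_{\mathcal C^0([0,T],\dot H^k)}.$$ Then, for all $t\in[0,T]$, $$\|u_\varepsilon(\cdot,t)\|_{H^{k-2}}\le\Big(\|u_\varepsilon(\cdot,0)\|_{H^{k-2}}+\varepsilon\,\mathcal K_\varepsilon(T)\big(1+\mathcal K_\varepsilon(T)^3\big)\Big)\,e^{C_*\mathcal K_\varepsilon(T)^2t}.$$ -/

import Mathlib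

open MeasureTheory Set Filter Topology
open scoped ContDiff ENNReal

noncomputable section

namespace CubicRegime

/-- The space `ℝ^N` with its Euclidean norm. -/
abbrev Space (N : ℕ) := EuclideanSpace ℝ (Fin N)

/-! ### Weak derivatives -/

/-- Test functions: real-valued smooth functions with compact support on `ℝ^N`. -/
def IsTest {N : ℕ} (φ : Space N → ℝ) : Prop :=
  ContDiff ℝ ∞ φ ∧ HasCompactSupport φ

/-- The classical partial derivative `∂_i φ`. -/
def partialD {N : ℕ} (i : Fin N) (φ : Space N → ℝ) : Space N → ℝ :=
  fun x => fderiv ℝ φ x (EuclideanSpace.single i 1)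

/-- The classical derivative `∂^α φ = ∂_1^{α_1} ⋯ ∂_N^{α_N} φ`, for a multi-index `α ∈ ℕ^N`. -/
def multiD {N : ℕ} (α : Fin N → ℕ) (φ : Space N → ℝ) : Space N → ℝ :=
  (List.finRange N).foldr (fun i g => (partialD i)^[α i] g) φ

/-- `g` is the weak derivative `∂^α f` (both functions being locally integrable). -/
def HasWeakDeriv {N : ℕ} (α : Fin N → ℕ) (f g : Space N → ℂ) : Prop :=
  LocallyIntegrable f ∧ LocallyIntegrable g ∧
    ∀ φ : Space N → ℝ, IsTest φ →
      ∫ x, multiD α φ x • f x = (-1 : ℂ) ^ (∑ i, α i) * ∫ x, φ x • g x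

/-- Weak derivatives are unique up to a null set. -/
theorem HasWeakDeriv.ae_unique {N : ℕ} {α : Fin N → ℕ} {f g g' : Space N → ℂ}
    (h : HasWeakDeriv α f g) (h' : HasWeakDeriv α f g') : g =ᵐ[volume] g' := by
  refine ae_eq_of_integral_contDiff_smul_eq h.2.1 h'.2.1 fun φ hφ hc => ?_
  have h1 := h.2.2 φ ⟨hφ, hc⟩
  rw [h'.2.2 φ ⟨hφ, hc⟩] at h1
  exact (mul_left_cancel₀ (pow_ne_zero _ (by norm_num)) h1).symm

open Classical in
/-- The weak derivative `∂^α f`, as a function defined up to a null set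
(with the value `0` when `f` has no weak derivative `∂^α f`). -/
def weakDeriv {N : ℕ} (α : Fin N → ℕ) (f : Space N → ℂ) : Space N → ℂ :=
  if h : ∃ g, HasWeakDeriv α f g then h.choose else 0

theorem HasWeakDeriv.weakDeriv_ae_eq {N : ℕ} {α : Fin N → ℕ} {f g : Space N → ℂ}
    (h : HasWeakDeriv α f g) : weakDeriv α f =ᵐ[volume] g := by
  have hex : ∃ g, HasWeakDeriv α f g := ⟨g, h⟩
  rw [weakDeriv, dif_pos hex]
  exact hex.choose_spec.ae_unique h

/-- The weak partial derivative `∂_i f`. -/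
def weakPartial {N : ℕ} (i : Fin N) (f : Space N → ℂ) : Space N → ℂ :=
  weakDeriv (Pi.single i 1) f

/-- The Laplacian `Δ f = ∑_i ∂_i² f`, in the weak sense. -/
def weakLaplacian {N : ℕ} (f : Space N → ℂ) : Space N → ℂ :=
  fun x => ∑ i : Fin N, weakDeriv (Pi.single i 2) f x

/-- The divergence `div V = ∑_i ∂_i V_i`, in the weak sense. -/
def weakDiv {N : ℕ} (V : Fin N → Space N → ℂ) : Space N → ℂ :=
  fun x => ∑ i : Fin N, weakPartial i (V i) x

/-! ### Sobolev spaces of integer order -/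

/-- `f ∈ H^k(ℝ^N)`: all weak derivatives `∂^α f` with `|α| ≤ k` exist and lie in `L²(ℝ^N)`. -/
def MemH {N : ℕ} (k : ℕ) (f : Space N → ℂ) : Prop :=
  ∀ α : Fin N → ℕ, ∑ i, α i ≤ k → ∃ g, HasWeakDeriv α f g ∧ MemLp g 2 volume

/-- `‖f‖_{Ḣ^ℓ}² = ∑_{|α| = ℓ} ‖∂^α f‖_{L²}²`. -/
def hDotSq {N : ℕ} (l : ℕ) (f : Space N → ℂ) : ℝ :=
  ∑ α ∈ Finset.piAntidiag (Finset.univ : Finset (Fin N)) l,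
    (eLpNorm (weakDeriv α f) 2 volume).toReal ^ 2

/-- The homogeneous Sobolev (semi-)norm `‖f‖_{Ḣ^ℓ}`. -/
def hDotNorm {N : ℕ} (l : ℕ) (f : Space N → ℂ) : ℝ :=
  Real.sqrt (hDotSq l f)

/-- The Sobolev norm `‖f‖_{H^k} = (∑_{|α| ≤ k} ‖∂^α f‖_{L²}²)^{1/2}`. -/
def hNorm {N : ℕ} (k : ℕ) (f : Space N → ℂ) : ℝ :=
  Real.sqrt (∑ l ∈ Finset.range (k + 1), hDotSq l f)

/-- `‖∇ f‖_{Ḣ^ℓ} = (∑_i ‖∂_i f‖_{Ḣ^ℓ}²)^{1/2}`. -/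
def gradHDotNorm {N : ℕ} (l : ℕ) (f : Space N → ℂ) : ℝ :=
  Real.sqrt (∑ i : Fin N, hDotSq l (weakPartial i f))

/-- `‖Δ f‖_{Ḣ^ℓ}`. -/
def laplacianHDotNorm {N : ℕ} (l : ℕ) (f : Space N → ℂ) : ℝ :=
  hDotNorm l (weakLaplacian f)

/-- `Ψ ∈ C⁰([0,T], H^k(ℝ^N))`. -/
def ContinuousInH {N : ℕ} (T : ℝ) (k : ℕ) (Ψ : ℝ → Space N → ℂ) : Prop :=
  (∀ t ∈ Icc 0 T, MemH k (Ψ t)) ∧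
    ∀ t ∈ Icc 0 T, Tendsto (fun s => hNorm k (Ψ s - Ψ t)) (𝓝[Icc 0 T] t) (𝓝 0)

/-- `sup_{t ∈ [0,T]} n(Ψ(t))`; for a norm `n = ‖·‖_X` this is `‖Ψ‖_{C⁰([0,T], X)}`. -/
def supNorm {N : ℕ} (T : ℝ) (n : (Space N → ℂ) → ℝ) (Ψ : ℝ → Space N → ℂ) : ℝ :=
  sSup ((fun t => n (Ψ t)) '' Icc 0 T)

/-! ### The two Schrödinger equations -/

/-- `i ∂_t Ψ + F(Ψ) = 0` on `[0,T]`, tested against the functions of `C_c^∞(ℝ^N)`: for any test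
function `φ`, the map `t ↦ ∫ Ψ(x,t) φ(x) dx` is differentiable on `[0,T]` and
`i (d/dt) ∫ Ψ(x,t) φ(x) dx + ∫ F(Ψ(·,t))(x) φ(x) dx = 0`, the functions `F(Ψ(·,t))` being
locally integrable. -/
def SolvesEvolution {N : ℕ} (T : ℝ) (F : (Space N → ℂ) → Space N → ℂ)
    (Ψ : ℝ → Space N → ℂ) : Prop :=
  ∀ t ∈ Icc 0 T, LocallyIntegrable (F (Ψ t)) ∧
    ∀ φ : Space N → ℝ, IsTest φ →
      ∃ d : ℂ, HasDerivWithinAt (fun s => ∫ x, φ x • Ψ s x) d (Icc 0 T) t ∧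
        Complex.I * d + ∫ x, φ x • F (Ψ t) x = 0

/-- The real scalar product `⟨z₁, z₂⟩_ℂ = Re (z₁ \bar z₂)`. -/
def cdot (z w : ℂ) : ℝ := (z * starRingEnd ℂ w).re

/-- The vector field `⟨f, ∇f⟩_ℂ / (1 - ε |f|²)^{1/2}`. -/
def nlsFlux {N : ℕ} (ε : ℝ) (f : Space N → ℂ) (i : Fin N) : Space N → ℂ :=
  fun x => ((cdot (f x) (weakPartial i f x) / Real.sqrt (1 - ε * ‖f x‖ ^ 2) : ℝ) : ℂ)

/-- `(1 - ε|f|²)^{1/2} Δf + |f|² / (1 + (1 - ε|f|²)^{1/2}) f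
  + ε div (⟨f, ∇f⟩_ℂ / (1 - ε|f|²)^{1/2}) f`. -/
def nlsOperator {N : ℕ} (ε : ℝ) (f : Space N → ℂ) : Space N → ℂ :=
  fun x =>
    (Real.sqrt (1 - ε * ‖f x‖ ^ 2) : ℂ) * weakLaplacian f x
      + ((‖f x‖ ^ 2 / (1 + Real.sqrt (1 - ε * ‖f x‖ ^ 2)) : ℝ) : ℂ) * f x
      + (ε : ℂ) * weakDiv (nlsFlux ε f) x * f x

/-- `Δf + (1/2) |f|² f`. -/
def csOperator {N : ℕ} (f : Space N → ℂ) : Space N → ℂ :=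
  fun x => weakLaplacian f x + ((‖f x‖ ^ 2 / 2 : ℝ) : ℂ) * f x

/-- `Ψ` is a solution on `[0,T]`, in `C⁰([0,T], H^s(ℝ^N))`, of the equation `(NLS_ε)`
`i ∂_t Ψ + (1 - ε|Ψ|²)^{1/2} ΔΨ + |Ψ|² / (1 + (1 - ε|Ψ|²)^{1/2}) Ψ
  + ε div (⟨Ψ, ∇Ψ⟩_ℂ / (1 - ε|Ψ|²)^{1/2}) Ψ = 0`. -/
def IsSolutionNLS {N : ℕ} (ε T : ℝ) (s : ℕ) (Ψ : ℝ → Space N → ℂ) : Prop :=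
  ContinuousInH T s Ψ ∧ SolvesEvolution T (nlsOperator ε) Ψ

/-- `Ψ` is a solution on `[0,T]`, in `C⁰([0,T], H^s(ℝ^N))`, of the cubic Schrödinger equation
`i ∂_t Ψ + ΔΨ + (1/2) |Ψ|² Ψ = 0`. -/
def IsSolutionCS {N : ℕ} (T : ℝ) (s : ℕ) (Ψ : ℝ → Space N → ℂ) : Prop :=
  ContinuousInH T s Ψ ∧ SolvesEvolution T csOperator Ψ

/-- The quantity `K_ε(T) = ‖Ψ‖_{C⁰([0,T],H^k)} + ‖Ψ_ε‖_{C⁰([0,T],H^k)}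
  + ε^{1/2} ‖∇Ψ_ε‖_{C⁰([0,T],Ḣ^k)} + ε ‖ΔΨ_ε‖_{C⁰([0,T],Ḣ^k)}`. -/
def kappa {N : ℕ} (ε T : ℝ) (k : ℕ) (Ψε Ψ : ℝ → Space N → ℂ) : ℝ :=
  supNorm T (hNorm k) Ψ + supNorm T (hNorm k) Ψε
    + Real.sqrt ε * supNorm T (gradHDotNorm k) Ψε
    + ε * supNorm T (laplacianHDotNorm k) Ψε

end CubicRegime

end

namespace CubicRegime

/-! ### Multi-index calculus for smooth functions -/

/-! Put `u = Ψε - Ψ` and `s = k - 2`, so that `s > N/2`. Subtracting the equations gives `i ∂_t u +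
Δu + g = 0`, where `g` is the sum of the remainder `R = nlsOperator ε Ψε - csOperator Ψε` and of the
difference of the cubic terms `½|Ψε|²Ψε - ½|Ψ|²Ψ`. The Laplacian contributes nothing to the `L²`
energy of a derivative `∂^α u`, hence `d/dt ‖u‖² ≤ 2 ‖u‖ ‖g‖` in `H^s`
(`hasDerivWithinAt_hNorm_sq`).

Let `h = √(1 - ε|z|²)`. Since `h - 1 = -ε|z|²/(1+h)` and `1/(1+h) - 1/2 = ε|z|²/(2(1+h)²)`, every
term of `R` carries a factor `ε` (`remainder_identity`), at the price of two derivatives: this is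
the loss from `H^k` to `H^(k-2)`. With `K = kappa` and `δ = εK(1+K³)`, `exists_remainder_bound`
gives `‖R‖ ≤ C K² δ`, and `exists_cubic_difference_bound` bounds the cubic difference by `C K² (‖u‖
+ δ)`. Therefore `‖g‖ ≤ C K² (‖u‖ + δ)`. Because `δ` appears inside the bracket next to `‖u‖`,
`gronwall_sq` yields `(‖u(0)‖ + δ) e^{CK²t}` with prefactor one.

Both bounds are instances of the Moser estimate `moser`: a smooth `G` with `G 0 = 0` maps functions
with values in the unit cube to `H^s`, linearly in their `H^s` bound. It follows from the Faà di
Bruno bound and `gagliardo_nirenberg`. The powers of `K` come from rescaling: by the Sobolev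
embedding `sobolev_test`, dividing the derivatives of order at most two by `B = CK` puts them in the
unit cube. The combination `√ε Ψε` is already bounded by `σ < 1` and is not divided, so that `G`,
built from a smooth extension of the square root, depends on `σ` but not on `ε`.

The inequalities are proved for test functions and carried over by mollification and cutoff
(`regularize`), which preserve the disc `ε|z|² ≤ σ²` by convexity. Limits are taken in the sense of
weak `L²` convergence, which also identifies the weak divergence of the flux
(`weakPartial_nlsFlux_ae_eq`).

In time, the equations hold only after pairing with test functions. An `L²`-bounded weak time
derivative makes the curve Lipschitz, and this suffices to differentiate the square of its norm
(`hasDerivWithinAt_norm_sq_of_weak_deriv`). Constants depend on `N`, but `N < 2k` leaves finitely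
many dimensions. -/

theorem multiIndex_induction {N : ℕ} {P : (Fin N → ℕ) → Prop} (zero : P 0)
    (add_single : ∀ α i, P α → P (α + Pi.single i 1)) (α : Fin N → ℕ) : P α := by
  obtain ⟨n, hn⟩ : ∃ n, ∑ i, α i = n := ⟨_, rfl⟩
  induction n generalizing α with
  | zero =>
    have : α = 0 := by
      funext i
      have := Finset.sum_eq_zero_iff.1 hn i (Finset.mem_univ i)
      simpa using this
    rwa [this]
  | succ n ih =>
    obtain ⟨i, hi⟩ : ∃ i, α i ≠ 0 := by
      by_contra! h
      simp [h] at hn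
    have hα : α = Function.update α i (α i - 1) + Pi.single i 1 := by
      funext j
      rcases eq_or_ne j i with rfl | hj
      · simp; omega
      · simp [hj]
    rw [hα]
    refine add_single _ _ (ih _ ?_)
    have := congrArg (fun β : Fin N → ℕ => ∑ j, β j) hα
    simp only [Pi.add_apply, Finset.sum_add_distrib, Finset.sum_pi_single', Finset.mem_univ,
      if_true] at this
    omega

@[simp] theorem sum_add_single {N : ℕ} (α : Fin N → ℕ) (i : Fin N) (m : ℕ) :
    ∑ j, (α + Pi.single i m : Fin N → ℕ) j = ∑ j, α j + m := by
  simp [Finset.sum_add_distrib]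

theorem contDiff_partialD {N : ℕ} {φ : Space N → ℝ} (h : ContDiff ℝ ∞ φ) (i : Fin N) :
    ContDiff ℝ ∞ (partialD i φ) :=
  (h.fderiv_right (m := ∞) (by simp)).clm_apply contDiff_const

theorem contDiff_iterate_partialD {N : ℕ} {φ : Space N → ℝ} (h : ContDiff ℝ ∞ φ) (i : Fin N)
    (m : ℕ) : ContDiff ℝ ∞ ((partialD i)^[m] φ) := by
  induction m with
  | zero => exact h
  | succ m ih => rw [Function.iterate_succ_apply']; exact contDiff_partialD ih i

theorem partialD_comm {N : ℕ} {φ : Space N → ℝ} (h : ContDiff ℝ ∞ φ) (i j : Fin N) :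
    partialD i (partialD j φ) = partialD j (partialD i φ) := by
  have key : ∀ i j : Fin N, ∀ x, partialD i (partialD j φ) x =
      fderiv ℝ (fderiv ℝ φ) x (EuclideanSpace.single i 1) (EuclideanSpace.single j 1) := by
    intro i j x
    unfold partialD
    rw [fderiv_clm_apply ((h.fderiv_right (m := ∞) (by simp)).differentiable (by simp) x)
      (differentiableAt_const _)]
    simp
  funext x
  rw [key, key]
  exact (h.contDiffAt.isSymmSndFDerivAt (by simpa using WithTop.coe_le_coe.2 (le_top (a := (2 : ℕ∞))))).eq _ _

theorem iterate_partialD_comm {N : ℕ} {φ : Space N → ℝ} (h : ContDiff ℝ ∞ φ) (i j : Fin N)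
    (m : ℕ) : (partialD j)^[m] (partialD i φ) = partialD i ((partialD j)^[m] φ) := by
  induction m with
  | zero => rfl
  | succ m ih =>
    rw [Function.iterate_succ_apply', Function.iterate_succ_apply', ih,
      partialD_comm (contDiff_iterate_partialD h j m)]

theorem contDiff_foldr_partialD {N : ℕ} {φ : Space N → ℝ} (h : ContDiff ℝ ∞ φ) (α : Fin N → ℕ)
    (l : List (Fin N)) : ContDiff ℝ ∞ (l.foldr (fun i g => (partialD i)^[α i] g) φ) := by
  induction l with
  | nil => exact h
  | cons j l ih => exact contDiff_iterate_partialD ih j _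

theorem contDiff_multiD {N : ℕ} {φ : Space N → ℝ} (h : ContDiff ℝ ∞ φ) (α : Fin N → ℕ) :
    ContDiff ℝ ∞ (multiD α φ) :=
  contDiff_foldr_partialD h α _

@[simp] theorem multiD_zero {N : ℕ} (φ : Space N → ℝ) : multiD 0 φ = φ := by
  have : ∀ l : List (Fin N),
      l.foldr (fun i g => (partialD i)^[(0 : Fin N → ℕ) i] g) φ = φ := by
    intro l
    induction l with
    | nil => rfl
    | cons j l ih => simp
  exact this _

/-- `multiD` is an ordered product, so the extra `∂_i` appears at its own place in the list and has
to be commuted to the front. `Nodup` ensures that it is met at most once. -/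
theorem foldr_partialD_add_single {N : ℕ} {φ : Space N → ℝ} (h : ContDiff ℝ ∞ φ)
    (α : Fin N → ℕ) (i : Fin N) (l : List (Fin N)) (hl : l.Nodup) :
    l.foldr (fun j g => (partialD j)^[(α + Pi.single i 1 : Fin N → ℕ) j] g) φ =
      if i ∈ l then partialD i (l.foldr (fun j g => (partialD j)^[α j] g) φ)
      else l.foldr (fun j g => (partialD j)^[α j] g) φ := by
  induction l with
  | nil => simp
  | cons j l ih =>
    rw [List.nodup_cons] at hl
    rw [List.foldr_cons, ih hl.2, List.foldr_cons]
    rcases eq_or_ne i j with rfl | hij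
    · simp [hl.1, Function.iterate_succ_apply']
    · have hc := iterate_partialD_comm (contDiff_foldr_partialD h α l) i j (α j)
      by_cases hi : i ∈ l
      · simp [hi, hij.symm, hc]
      · simp [hi, hij, hij.symm]

theorem multiD_add_single {N : ℕ} {φ : Space N → ℝ} (h : ContDiff ℝ ∞ φ)
    (α : Fin N → ℕ) (i : Fin N) :
    multiD (α + Pi.single i 1) φ = partialD i (multiD α φ) := by
  unfold multiD
  rw [foldr_partialD_add_single h α i _ (List.nodup_finRange N), if_pos (List.mem_finRange i)]

theorem multiD_single {N : ℕ} {φ : Space N → ℝ} (h : ContDiff ℝ ∞ φ) (i : Fin N) :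
    multiD (Pi.single i 1) φ = partialD i φ := by
  have := multiD_add_single h 0 i
  simpa using this

theorem multiD_single_two {N : ℕ} {φ : Space N → ℝ} (h : ContDiff ℝ ∞ φ) (i : Fin N) :
    multiD (Pi.single i 2) φ = partialD i (partialD i φ) := by
  have := multiD_add_single h (Pi.single i 1) i
  rwa [multiD_single h, ← Pi.single_add] at this

theorem multiD_partialD {N : ℕ} {φ : Space N → ℝ} (h : ContDiff ℝ ∞ φ)
    (α : Fin N → ℕ) (i : Fin N) :
    multiD α (partialD i φ) = partialD i (multiD α φ) := by
  induction α using multiIndex_induction with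
  | zero => simp
  | add_single α j ih =>
    rw [multiD_add_single (contDiff_partialD h i), ih, partialD_comm (contDiff_multiD h α),
      multiD_add_single h]

theorem multiD_add {N : ℕ} {φ : Space N → ℝ} (h : ContDiff ℝ ∞ φ) (α β : Fin N → ℕ) :
    multiD (α + β) φ = multiD α (multiD β φ) := by
  induction α using multiIndex_induction with
  | zero => simp
  | add_single α j ih =>
    rw [multiD_add_single (contDiff_multiD h β), ← ih, ← multiD_add_single h]
    congr 1
    abel

/-! ### Comparison with iterated Fréchet derivatives -/

/-- The bridge to Fréchet derivatives, for which Leibniz and Faà di Bruno bounds are available.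
Peeling off the last argument replaces `φ` by one of its partial derivatives, since evaluation at a
fixed vector is linear and commutes with differentiation. -/
theorem iteratedFDeriv_single_eq_multiD {N : ℕ} {φ : Space N → ℝ} (h : ContDiff ℝ ∞ φ) {n : ℕ}
    (w : Fin n → Fin N) (x : Space N) :
    iteratedFDeriv ℝ n φ x (fun j => EuclideanSpace.single (w j) 1) =
      multiD (∑ j, Pi.single (w j) 1) φ x := by
  induction n generalizing φ with
  | zero => simp
  | succ n ih =>
    rw [iteratedFDeriv_succ_apply_right]
    have h1 := ih (contDiff_partialD h (w (Fin.last n))) (Fin.init w)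
    rw [multiD_partialD h, ← multiD_add_single h] at h1
    rw [Fin.sum_univ_castSucc]
    rw [show (∑ i : Fin n, Pi.single (w i.castSucc) 1 : Fin N → ℕ) =
      ∑ i : Fin n, Pi.single (Fin.init w i) 1 from rfl, ← h1]
    have h2 : partialD (w (Fin.last n)) φ =
        (ContinuousLinearMap.apply ℝ ℝ (EuclideanSpace.single (w (Fin.last n)) (1 : ℝ))) ∘
          (fun y => fderiv ℝ φ y) := by
      funext y; rfl
    rw [h2, ContinuousLinearMap.iteratedFDeriv_comp_left _
      ((h.fderiv_right (m := ∞) (by simp)).contDiffAt) (i := n) (by exact_mod_cast le_top)]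
    rfl

theorem exists_word {N : ℕ} (α : Fin N → ℕ) :
    ∃ w : Fin (∑ i, α i) → Fin N, ∑ j, Pi.single (w j) 1 = α := by
  induction α using multiIndex_induction with
  | zero =>
    refine ⟨fun j => absurd j.2 (by simp), ?_⟩
    have : IsEmpty (Fin (∑ i : Fin N, (0 : Fin N → ℕ) i)) := by
      simp only [Pi.zero_apply, Finset.sum_const_zero]; infer_instance
    simp
  | add_single α i ih =>
    obtain ⟨w, hw⟩ := ih
    have hs : ∑ j, (α + Pi.single i 1 : Fin N → ℕ) j = ∑ j, α j + 1 := sum_add_single α i 1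
    refine ⟨(Fin.snoc w i : Fin (∑ j, α j + 1) → Fin N) ∘ Fin.cast hs, ?_⟩
    rw [← (finCongr hs).symm.sum_comp]
    simp [Fin.sum_univ_castSucc, hw]

theorem abs_multiD_le_norm_iteratedFDeriv {N : ℕ} {φ : Space N → ℝ} (h : ContDiff ℝ ∞ φ)
    (α : Fin N → ℕ) (x : Space N) :
    |multiD α φ x| ≤ ‖iteratedFDeriv ℝ (∑ i, α i) φ x‖ := by
  obtain ⟨w, hw⟩ := exists_word α
  have := (iteratedFDeriv ℝ (∑ i, α i) φ x).le_opNorm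
    (fun j => EuclideanSpace.single (w j) 1)
  rw [iteratedFDeriv_single_eq_multiD h w x, hw] at this
  simpa using this

/-- The multi-indices of length `n`. -/
abbrev indices (N n : ℕ) : Finset (Fin N → ℕ) :=
  Finset.piAntidiag (Finset.univ : Finset (Fin N)) n

theorem mem_indices {N n : ℕ} {α : Fin N → ℕ} : α ∈ indices N n ↔ ∑ i, α i = n := by
  simp [Finset.mem_piAntidiag]

/-- Multilinear expansion in the canonical basis: the coordinates of the arguments are bounded by
their norms, and each of the `N ^ n` words of basis vectors produces one partial derivative. -/
theorem norm_iteratedFDeriv_le_sum {N : ℕ} {φ : Space N → ℝ} (h : ContDiff ℝ ∞ φ)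
    (n : ℕ) (x : Space N) :
    ‖iteratedFDeriv ℝ n φ x‖ ≤ (N : ℝ) ^ n * ∑ α ∈ indices N n, |multiD α φ x| := by
  have h1 : ‖iteratedFDeriv ℝ n φ x‖ ≤
      ∑ w : Fin n → Fin N, |multiD (∑ j, Pi.single (w j) 1) φ x| := by
    refine ContinuousMultilinearMap.opNorm_le_bound (by positivity) fun m => ?_
    have hm : m = fun j => ∑ i, m j i • EuclideanSpace.single i (1 : ℝ) := by
      funext j
      ext l
      simp [Finset.sum_apply, Pi.single_apply]
    conv_lhs => rw [hm]
    rw [ContinuousMultilinearMap.map_sum, Finset.sum_mul]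
    refine (norm_sum_le _ _).trans (Finset.sum_le_sum fun w _ => ?_)
    rw [ContinuousMultilinearMap.map_smul_univ, iteratedFDeriv_single_eq_multiD h,
      norm_smul, mul_comm, Real.norm_eq_abs]
    refine mul_le_mul_of_nonneg_left ?_ (abs_nonneg _)
    rw [norm_prod]
    exact Finset.prod_le_prod (fun _ _ => norm_nonneg _) fun j _ => PiLp.norm_apply_le (m j) _
  refine h1.trans ?_
  have h2 : ∀ w : Fin n → Fin N, |multiD (∑ j, Pi.single (w j) 1) φ x| ≤
      ∑ α ∈ indices N n, |multiD α φ x| := fun w => by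
    refine Finset.single_le_sum (f := fun α => |multiD α φ x|) (fun _ _ => abs_nonneg _) ?_
    rw [mem_indices]
    simp only [Finset.sum_apply]
    rw [Finset.sum_comm]
    simp
  refine (Finset.sum_le_sum fun w _ => h2 w).trans ?_
  simp

/-- Locality is inherited from the iterated Fréchet derivative. -/
theorem multiD_congr_of_eventuallyEq {N : ℕ} {φ ψ : Space N → ℝ} (hφ : ContDiff ℝ ∞ φ)
    (hψ : ContDiff ℝ ∞ ψ) {x : Space N} (h : φ =ᶠ[𝓝 x] ψ) (α : Fin N → ℕ) :
    multiD α φ x = multiD α ψ x := by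
  obtain ⟨w, hw⟩ := exists_word α
  have h1 := iteratedFDeriv_single_eq_multiD hφ w x
  have h2 := iteratedFDeriv_single_eq_multiD hψ w x
  rw [hw] at h1 h2
  rw [← h1, ← h2, (h.iteratedFDeriv ℝ _).eq_of_nhds]

/-! ### Test functions -/

theorem IsTest.partialDeriv {N : ℕ} {φ : Space N → ℝ} (h : IsTest φ) (i : Fin N) :
    IsTest (partialD i φ) :=
  ⟨contDiff_partialD h.1 i, h.2.fderiv_apply (𝕜 := ℝ) _⟩

theorem IsTest.multiDeriv {N : ℕ} {φ : Space N → ℝ} (h : IsTest φ) (α : Fin N → ℕ) :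
    IsTest (multiD α φ) := by
  induction α using multiIndex_induction with
  | zero => simpa using h
  | add_single α i ih => rw [multiD_add_single h.1]; exact ih.partialDeriv i

theorem IsTest.memLp {N : ℕ} {φ : Space N → ℝ} (h : IsTest φ) (p : ℝ≥0∞) :
    MemLp φ p volume :=
  h.1.continuous.memLp_of_hasCompactSupport h.2

theorem IsTest.integrable {N : ℕ} {φ : Space N → ℝ} (h : IsTest φ) : Integrable φ :=
  h.1.continuous.integrable_of_hasCompactSupport h.2

/-- `G 0 = 0` confines the support of the composition to the union of the supports of the
components. -/
theorem IsTest.comp {N : ℕ} {ι : Type*} [Fintype ι] {w : ι → Space N → ℝ}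
    (h : ∀ c, IsTest (w c)) {G : (ι → ℝ) → ℝ} (hG : ContDiff ℝ ∞ G) (hG0 : G 0 = 0) :
    IsTest (fun x => G (fun c => w c x)) := by
  refine ⟨hG.comp (contDiff_pi.2 fun c => (h c).1), ?_⟩
  refine HasCompactSupport.intro (K := ⋃ c, tsupport (w c))
    (isCompact_iUnion fun c => (h c).2) fun x hx => ?_
  have : (fun c => w c x) = 0 := by
    funext c
    by_contra hc
    exact hx (mem_iUnion.2 ⟨c, subset_tsupport _ hc⟩)
  rw [this, hG0]

theorem IsTest.const_mul {N : ℕ} {φ : Space N → ℝ} (h : IsTest φ) (c : ℝ) :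
    IsTest (fun x => c * φ x) :=
  ⟨contDiff_const.mul h.1, h.2.mul_left⟩

theorem partialD_const_mul {N : ℕ} {φ : Space N → ℝ} (h : ContDiff ℝ ∞ φ) (c : ℝ) (i : Fin N) :
    partialD i (fun x => c * φ x) = fun x => c * partialD i φ x := by
  funext x
  simp [partialD, fderiv_const_mul (h.differentiable (by simp) x)]

theorem multiD_const_mul {N : ℕ} {φ : Space N → ℝ} (h : ContDiff ℝ ∞ φ) (c : ℝ)
    (α : Fin N → ℕ) : multiD α (fun x => c * φ x) = fun x => c * multiD α φ x := by
  induction α using multiIndex_induction with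
  | zero => simp
  | add_single α i ih =>
    rw [multiD_add_single (contDiff_const.mul h), ih, partialD_const_mul (contDiff_multiD h α),
      multiD_add_single h]

/-! ### Integration by parts and the Gagliardo–Nirenberg inequality for test functions -/

theorem hasDerivAt_mul_abs_rpow {a : ℝ} (ha : 0 < a) (x : ℝ) :
    HasDerivAt (fun y : ℝ => y * |y| ^ a) ((a + 1) * |x| ^ a) x := by
  rcases eq_or_ne x 0 with rfl | hx
  · rw [hasDerivAt_iff_isLittleO]
    simp only [abs_zero, Real.zero_rpow ha.ne', mul_zero, sub_zero, smul_zero]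
    have h1 : Tendsto (fun y : ℝ => |y| ^ a) (𝓝 0) (𝓝 0) := by
      have := (continuous_abs (G := ℝ)).continuousAt (x := 0) |>.rpow_const (p := a) (.inr ha.le)
      simpa [ContinuousAt, Real.zero_rpow ha.ne'] using this
    have h2 := (Asymptotics.isBigO_refl (fun y : ℝ => y) (𝓝 0)).mul_isLittleO
      ((Asymptotics.isLittleO_one_iff ℝ).2 h1)
    simpa using h2
  · have h1 := (hasDerivAt_id x).mul ((hasDerivAt_abs hx).rpow_const (p := a)
      (.inl (abs_ne_zero.2 hx)))
    refine h1.congr_deriv (Eq.symm ?_)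
    have h2 : |x| ^ a = |x| ^ (a - 1) * |x| := by
      rw [← Real.rpow_add_one (abs_ne_zero.2 hx)]; congr 1; ring
    have h3 : x * SignType.sign x = |x| := by simp
    calc (a + 1) * |x| ^ a = |x| ^ a + a * |x| ^ (a - 1) * |x| := by rw [h2]; ring
      _ = 1 * |x| ^ a + x * (SignType.sign x * a * |x| ^ (a - 1)) := by rw [← h3]; ring

theorem IsTest.integral_mul_partialD {N : ℕ} {F g : Space N → ℝ} (hg : IsTest g)
    (hF : ContDiff ℝ 1 F) (i : Fin N) :
    ∫ x, F x * partialD i g x =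
      -∫ x, fderiv ℝ F x (EuclideanSpace.single i 1) * g x := by
  refine integral_mul_fderiv_eq_neg_fderiv_mul_of_integrable ?_ ?_ ?_ ?_ ?_
  · exact (((hF.continuous_fderiv (by simp)).clm_apply continuous_const).mul
      hg.1.continuous).integrable_of_hasCompactSupport hg.2.mul_left
  · exact (hF.continuous.mul (hg.partialDeriv i).1.continuous).integrable_of_hasCompactSupport
      (hg.partialDeriv i).2.mul_left
  · exact (hF.continuous.mul hg.1.continuous).integrable_of_hasCompactSupport hg.2.mul_left
  · exact fun x _ => hF.differentiable (by simp) x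
  · exact fun x _ => hg.1.differentiable (by simp) x

/-- Write `|∂g|^(a+2) = F ∂g` with `F = ∂g |∂g|^a`, which is of class `C¹` for every `a > 0` with
derivative `(a+1) |∂g|^a ∂²g`, and integrate by parts once. -/
theorem IsTest.integral_abs_partialD_rpow_le {N : ℕ} {g : Space N → ℝ} (hg : IsTest g)
    (i : Fin N) {a : ℝ} (ha : 0 < a) :
    ∫ x, |partialD i g x| ^ (a + 2) ≤
      (a + 1) * ∫ x, |partialD i g x| ^ a * |partialD i (partialD i g) x| * |g x| := by
  have hd : ∀ x, HasFDerivAt (fun x => partialD i g x * |partialD i g x| ^ a)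
      (((a + 1) * |partialD i g x| ^ a) • fderiv ℝ (partialD i g) x) x := fun x =>
    (hasDerivAt_mul_abs_rpow ha (partialD i g x)).comp_hasFDerivAt x
      ((hg.partialDeriv i).1.differentiable (by simp) x).hasFDerivAt
  have hca : Continuous fun x => |partialD i g x| ^ a :=
    (hg.partialDeriv i).1.continuous.abs.rpow_const fun _ => .inr ha.le
  have hC : ContDiff ℝ 1 (fun x => partialD i g x * |partialD i g x| ^ a) := by
    rw [contDiff_one_iff_hasFDerivAt]
    exact ⟨_, ((continuous_const.mul hca).smul
      ((hg.partialDeriv i).1.continuous_fderiv (by simp))), hd⟩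
  have h := hg.integral_mul_partialD hC i
  have e1 : ∀ x, |partialD i g x| ^ (a + 2) =
      partialD i g x * |partialD i g x| ^ a * partialD i g x := fun x => by
    rw [Real.rpow_add_of_nonneg (abs_nonneg _) ha.le (by norm_num), Real.rpow_ofNat, sq_abs]
    ring
  simp_rw [e1]
  rw [h, ← integral_neg, ← integral_const_mul]
  refine integral_mono ?_ ?_ fun x => ?_
  · exact (((hC.continuous_fderiv (by simp)).clm_apply continuous_const).mul
      hg.1.continuous).neg.integrable_of_hasCompactSupport hg.2.mul_left.neg
  · exact (continuous_const.mul ((hca.mul ((hg.partialDeriv i).partialDeriv i).1.continuous.abs).mul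
      hg.1.continuous.abs)).integrable_of_hasCompactSupport
      ((hg.2.comp_left (g := fun y : ℝ => |y|) (by simp)).mul_left.mul_left)
  · rw [(hd x).fderiv]
    have : ((((a + 1) * |partialD i g x| ^ a) • fderiv ℝ (partialD i g) x)
        (EuclideanSpace.single i 1)) = (a + 1) * |partialD i g x| ^ a *
          partialD i (partialD i g) x := rfl
    simp only [this]
    refine (neg_le_abs _).trans (le_of_eq ?_)
    rw [abs_mul, abs_mul, abs_mul, abs_of_pos (by linarith : 0 < a + 1),
      abs_of_nonneg (Real.rpow_nonneg (abs_nonneg _) _)]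
    ring

theorem enorm_rpow_eq_ofReal (y : ℝ) {p : ℝ} (hp : 0 ≤ p) :
    ‖y‖ₑ ^ p = ENNReal.ofReal (|y| ^ p) := by
  rw [← Real.norm_eq_abs, ← ENNReal.ofReal_rpow_of_nonneg (norm_nonneg y) hp, ofReal_norm]

theorem IsTest.lintegral_rpow_lt_top {N : ℕ} {g : Space N → ℝ} (hg : IsTest g) {p : ℝ}
    (hp : 0 < p) : ∫⁻ x, ‖g x‖ₑ ^ p < ⊤ := by
  simp_rw [enorm_rpow_eq_ofReal _ hp.le]
  refine Integrable.lintegral_lt_top ?_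
  refine (hg.1.continuous.abs.rpow_const fun _ => .inr hp.le).integrable_of_hasCompactSupport ?_
  exact hg.2.comp_left (g := fun y : ℝ => |y| ^ p) (by simp [Real.zero_rpow hp.ne'])

/-- One rung of the Gagliardo–Nirenberg ladder: the `L^(2n/(m+1))` norm of `∂g` is squared and
compared with the norms of `∂²g` and `g` in the two neighbouring Lebesgue spaces. The integration by
parts is followed by Hölder with weights `(n-m-1)/n`, `(m+2)/(2n)`, `m/(2n)`, which add up to one,
and a power of the left-hand side is absorbed. -/
theorem IsTest.lintegral_partialD_rpow_le {N : ℕ} {g : Space N → ℝ} (hg : IsTest g)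
    (i : Fin N) {n m : ℕ} (hn : m + 1 < n) (hm : m = 0 → ∀ x, |g x| ≤ 1) :
    (∫⁻ x, ‖partialD i g x‖ₑ ^ (2 * n / (m + 1) : ℝ)) ^ ((m + 1) / n : ℝ) ≤
      ENNReal.ofReal (2 * n) *
        ((∫⁻ x, ‖partialD i (partialD i g) x‖ₑ ^ (2 * n / (m + 2) : ℝ)) ^ ((m + 2) / (2 * n) : ℝ) *
        (∫⁻ x, ‖g x‖ₑ ^ (2 * n / m : ℝ)) ^ (m / (2 * n) : ℝ)) := by
  have hn' : (m : ℝ) + 1 < n := by exact_mod_cast hn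
  have hm0 : (0 : ℝ) ≤ m := by positivity
  have hn0 : (0 : ℝ) < n := by linarith
  set a : ℝ := 2 * n / (m + 1) - 2 with ha
  have ha0 : 0 < a := by
    rw [ha, sub_pos, lt_div_iff₀ (by linarith)]; nlinarith
  have ha2 : a + 2 = 2 * n / (m + 1) := by rw [ha]; ring
  have ha1 : a + 1 ≤ 2 * n := by
    have : 2 * (n : ℝ) / (m + 1) ≤ 2 * n := div_le_self (by linarith) (by linarith)
    linarith
  have h1 := hg.integral_abs_partialD_rpow_le i ha0
  have hci := (hg.partialDeriv i).1.continuous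
  have hcii := ((hg.partialDeriv i).partialDeriv i).1.continuous
  -- the inequality in `ℝ≥0∞`
  have h2 : ∫⁻ x, ‖partialD i g x‖ₑ ^ (a + 2) ≤ ENNReal.ofReal (2 * n) *
      ∫⁻ x, ‖partialD i g x‖ₑ ^ a * ‖partialD i (partialD i g) x‖ₑ * ‖g x‖ₑ := by
    have hint : Integrable fun x =>
        |partialD i g x| ^ a * |partialD i (partialD i g) x| * |g x| :=
      (((hci.abs.rpow_const fun _ => .inr ha0.le).mul hcii.abs).mul
        hg.1.continuous.abs).integrable_of_hasCompactSupport
        ((hg.2.comp_left (g := fun y : ℝ => |y|) (by simp)).mul_left)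
    have hint2 : Integrable fun x => |partialD i g x| ^ (a + 2) :=
      (hci.abs.rpow_const fun _ => .inr (by linarith)).integrable_of_hasCompactSupport
        ((hg.partialDeriv i).2.comp_left (g := fun y : ℝ => |y| ^ (a + 2))
          (by simp [Real.zero_rpow (by linarith : a + 2 ≠ 0)]))
    simp_rw [enorm_rpow_eq_ofReal _ (by linarith : 0 ≤ a + 2)]
    rw [← ofReal_integral_eq_lintegral_ofReal hint2 (.of_forall fun x => by positivity)]
    have e : ∀ x, ‖partialD i g x‖ₑ ^ a * ‖partialD i (partialD i g) x‖ₑ * ‖g x‖ₑ =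
        ENNReal.ofReal (|partialD i g x| ^ a * |partialD i (partialD i g) x| * |g x|) := by
      intro x
      rw [enorm_rpow_eq_ofReal _ ha0.le, ENNReal.ofReal_mul (by positivity),
        ENNReal.ofReal_mul (by positivity), ← Real.norm_eq_abs (partialD i (partialD i g) x),
        ← Real.norm_eq_abs (g x), ofReal_norm, ofReal_norm]
    simp_rw [e]
    rw [← ofReal_integral_eq_lintegral_ofReal hint (.of_forall fun x => by positivity),
      ← ENNReal.ofReal_mul (by positivity)]
    refine ENNReal.ofReal_le_ofReal (h1.trans ?_)
    exact mul_le_mul_of_nonneg_right ha1 (integral_nonneg fun x => by positivity)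
  -- Hölder
  set X := ∫⁻ x, ‖partialD i g x‖ₑ ^ (a + 2)
  set Y := ∫⁻ x, ‖partialD i (partialD i g) x‖ₑ ^ (2 * n / (m + 2) : ℝ)
  set Z := ∫⁻ x, ‖g x‖ₑ ^ (2 * n / m : ℝ)
  have h3 : ∫⁻ x, ‖partialD i g x‖ₑ ^ a * ‖partialD i (partialD i g) x‖ₑ * ‖g x‖ₑ ≤
      X ^ ((n - (m + 1)) / n : ℝ) * Y ^ ((m + 2) / (2 * n) : ℝ) * Z ^ (m / (2 * n) : ℝ) := by
    have H := ENNReal.lintegral_prod_norm_pow_le (μ := (volume : Measure (Space N)))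
      (Finset.univ : Finset (Fin 3))
      (f := ![fun x => ‖partialD i g x‖ₑ ^ (a + 2),
        fun x => ‖partialD i (partialD i g) x‖ₑ ^ (2 * n / (m + 2) : ℝ),
        fun x => ‖g x‖ₑ ^ (2 * n / m : ℝ)])
      (p := ![(n - (m + 1)) / n, (m + 2) / (2 * n), m / (2 * n)])
      (by
        intro j _
        fin_cases j
        · exact hci.measurable.enorm.pow_const _ |>.aemeasurable
        · exact hcii.measurable.enorm.pow_const _ |>.aemeasurable
        · exact hg.1.continuous.measurable.enorm.pow_const _ |>.aemeasurable)
      (by simp [Fin.sum_univ_three]; field_simp; ring)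
      (by
        intro j _
        fin_cases j
        · exact div_nonneg (by linarith) hn0.le
        · show (0 : ℝ) ≤ (m + 2) / (2 * n); positivity
        · show (0 : ℝ) ≤ m / (2 * n); positivity)
    simp only [Fin.prod_univ_three, Matrix.cons_val_zero, Matrix.cons_val_one,
      Matrix.cons_val_two, Matrix.head_cons, Matrix.tail_cons] at H
    refine le_trans (lintegral_mono fun x => ?_) H
    simp only [← ENNReal.rpow_mul]
    refine mul_le_mul' (mul_le_mul' (le_of_eq ?_) (le_of_eq ?_)) ?_
    · congr 1; rw [ha]; field_simp; ring
    · rw [show (2 * n / (m + 2) * ((m + 2) / (2 * n)) : ℝ) = 1 by field_simp, ENNReal.rpow_one]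
    -- For `m = 0` division by zero makes both exponents of the factor in `g` vanish, so this factor
    -- is `1`. It stands for the `L^∞` norm, and `|g| ≤ 1` is what is needed.
    · rcases Nat.eq_zero_or_pos m with rfl | hmp
      · simp only [Nat.cast_zero, div_zero, zero_div, mul_zero, ENNReal.rpow_zero]
        rw [← ofReal_norm, ← ENNReal.ofReal_one]
        exact ENNReal.ofReal_le_ofReal (hm rfl x)
      · have : (0 : ℝ) < m := by exact_mod_cast hmp
        rw [show (2 * n / m * (m / (2 * n)) : ℝ) = 1 by field_simp, ENNReal.rpow_one]
  have hXtop : X ≠ ⊤ := ((hg.partialDeriv i).lintegral_rpow_lt_top (by linarith)).ne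
  rw [← ha2]
  change X ^ _ ≤ _
  rcases eq_or_ne X 0 with hX | hX
  · rw [hX, ENNReal.zero_rpow_of_pos (by positivity)]; exact zero_le
  have h4 := h2.trans (mul_le_mul_right h3 _)
  -- The first factor is the power of `X` produced by Hölder; it can be cancelled as `X` is neither
  -- `0` nor `⊤`.
  have e5 : X = X ^ ((n - (m + 1)) / n : ℝ) * X ^ ((m + 1) / n : ℝ) := by
    rw [← ENNReal.rpow_add _ _ hX hXtop]
    conv_lhs => rw [← ENNReal.rpow_one X]
    congr 1; field_simp; ring
  have h6 : X ^ ((n - (m + 1)) / n : ℝ) * X ^ ((m + 1) / n : ℝ) ≤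
      X ^ ((n - (m + 1)) / n : ℝ) * (ENNReal.ofReal (2 * n) *
        (Y ^ ((m + 2) / (2 * n) : ℝ) * Z ^ (m / (2 * n) : ℝ))) := by
    rw [← e5]; refine h4.trans (le_of_eq ?_); ring
  refine (ENNReal.mul_le_mul_iff_right ?_ ?_).1 h6
  · simp [ENNReal.rpow_eq_zero_iff, hX, hXtop]
  · exact ENNReal.rpow_ne_top_of_nonneg (div_nonneg (by linarith) hn0.le) hXtop

/-- Discrete log-convexity: `log S` is convex up to an additive constant, hence `S j` is controlled
by interpolation between `S 0 ≤ 1` and `S n`. Integer powers replace roots, so that vanishing terms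
do no harm. -/
theorem exists_pow_le_of_sq_le_mul (n : ℕ) (c : ℝ) (hc : 0 ≤ c) :
    ∃ C : ℝ, 0 ≤ C ∧ ∀ S : ℕ → ℝ, (∀ m, 0 ≤ S m) → S 0 ≤ 1 →
      (∀ m, m + 1 < n → S (m + 1) ^ 2 ≤ c * (S (m + 2) * S m)) →
      ∀ j, 1 ≤ j → j ≤ n → S j ^ n ≤ C * S n ^ j := by
  -- Neighbouring terms first: the hypothesis raised to the power `m + 1`, combined with the
  -- previous comparison, leaves a common factor `S (m+1) ^ m` to cancel. Chaining these comparisons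
  -- from `j` up to `m` is the second step.
  have step1 : ∀ m, ∃ C : ℝ, 0 ≤ C ∧ ∀ S : ℕ → ℝ, (∀ m, 0 ≤ S m) → S 0 ≤ 1 →
      (∀ m, m + 1 < n → S (m + 1) ^ 2 ≤ c * (S (m + 2) * S m)) → m < n →
      S m ^ (m + 1) ≤ C * S (m + 1) ^ m := by
    intro m
    induction m with
    | zero => exact ⟨1, zero_le_one, fun S _ h0 _ _ => by simpa using h0⟩
    | succ m ih =>
      obtain ⟨C, hC, ih⟩ := ih
      refine ⟨c ^ (m + 1) * C, by positivity, fun S hS h0 hl hm => ?_⟩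
      have h1 := ih S hS h0 hl (by omega)
      have h2 := hl m hm
      rcases (hS (m + 1)).eq_or_lt with hz | hz
      · rw [← hz, zero_pow (by omega)]
        exact mul_nonneg (by positivity) (pow_nonneg (hS _) _)
      have h3 : S (m + 1) ^ m * S (m + 1) ^ (m + 1 + 1) ≤
          S (m + 1) ^ m * (c ^ (m + 1) * C * S (m + 1 + 1) ^ (m + 1)) := by
        calc S (m + 1) ^ m * S (m + 1) ^ (m + 1 + 1) = (S (m + 1) ^ 2) ^ (m + 1) := by ring
          _ ≤ (c * (S (m + 2) * S m)) ^ (m + 1) := pow_le_pow_left₀ (by positivity) h2 _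
          _ = c ^ (m + 1) * S (m + 2) ^ (m + 1) * S m ^ (m + 1) := by ring
          _ ≤ c ^ (m + 1) * S (m + 2) ^ (m + 1) * (C * S (m + 1) ^ m) :=
              mul_le_mul_of_nonneg_left h1 (mul_nonneg (by positivity) (pow_nonneg (hS _) _))
          _ = _ := by ring
      exact le_of_mul_le_mul_left h3 (by positivity)
  choose D hD0 hD using step1
  have step2 : ∀ j, 1 ≤ j → ∀ m, j ≤ m → ∃ C : ℝ, 0 ≤ C ∧ ∀ S : ℕ → ℝ, (∀ m, 0 ≤ S m) →
      S 0 ≤ 1 → (∀ m, m + 1 < n → S (m + 1) ^ 2 ≤ c * (S (m + 2) * S m)) → m ≤ n →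
      S j ^ m ≤ C * S m ^ j := by
    intro j hj m hm
    induction m, hm using Nat.le_induction with
    | base => exact ⟨1, zero_le_one, fun S _ _ _ _ => by simp⟩
    | succ m hm ih =>
      obtain ⟨C, hC, ih⟩ := ih
      -- The inequality is proved after raising it to the power `m`; a constant at least one is
      -- bounded by its own `m`-th power.
      refine ⟨max 1 (C ^ (m + 1) * D m ^ j), by positivity, fun S hS h0 hl hmn => ?_⟩
      have h1 := ih S hS h0 hl (by omega)
      have h2 := hD m S hS h0 hl (by omega)
      refine le_of_pow_le_pow_left₀ (n := m) (by omega)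
        (mul_nonneg (by positivity) (pow_nonneg (hS _) _)) ?_
      calc (S j ^ (m + 1)) ^ m = (S j ^ m) ^ (m + 1) := by ring
        _ ≤ (C * S m ^ j) ^ (m + 1) := pow_le_pow_left₀ (pow_nonneg (hS _) _) h1 _
        _ = C ^ (m + 1) * (S m ^ (m + 1)) ^ j := by ring
        _ ≤ C ^ (m + 1) * (D m * S (m + 1) ^ m) ^ j := by
            gcongr
            exact pow_nonneg (hS _) _
        _ = C ^ (m + 1) * D m ^ j * S (m + 1) ^ (j * m) := by ring
        _ ≤ max 1 (C ^ (m + 1) * D m ^ j) ^ m * S (m + 1) ^ (j * m) := by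
            refine mul_le_mul_of_nonneg_right ?_ (pow_nonneg (hS _) _)
            exact (le_max_right _ _).trans (le_self_pow₀ (le_max_left _ _) (by omega))
        _ = _ := by ring
  choose! E hE0 hE using step2
  refine ⟨∑ j ∈ Finset.Icc 1 n, E j n, Finset.sum_nonneg fun j hj => ?_,
    fun S hS h0 hl j hj hjn => ?_⟩
  · rw [Finset.mem_Icc] at hj; exact hE0 j hj.1 n hj.2
  · refine (hE j hj n hjn S hS h0 hl le_rfl).trans
      (mul_le_mul_of_nonneg_right ?_ (pow_nonneg (hS _) _))
    exact Finset.single_le_sum (f := fun j => E j n)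
      (fun j hj => by rw [Finset.mem_Icc] at hj; exact hE0 j hj.1 n hj.2)
      (Finset.mem_Icc.2 ⟨hj, hjn⟩)

theorem exists_eq_add_single {N m : ℕ} {β : Fin N → ℕ} (h : ∑ i, β i = m + 1) :
    ∃ γ : Fin N → ℕ, ∃ i, β = γ + Pi.single i 1 ∧ ∑ i, γ i = m := by
  induction β using multiIndex_induction with
  | zero => simp at h
  | add_single γ i _ => exact ⟨γ, i, rfl, by rw [sum_add_single] at h; omega⟩

theorem lintegral_enorm_sq_le_of_eLpNorm_le {N : ℕ} {E : Type*} [NormedAddCommGroup E]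
    {f : Space N → E} {A : ℝ} (hA : 0 ≤ A) (h : eLpNorm f 2 volume ≤ ENNReal.ofReal A) :
    ∫⁻ x, ‖f x‖ₑ ^ (2 : ℝ) ≤ ENNReal.ofReal (A ^ 2) := by
  rw [eLpNorm_eq_lintegral_rpow_enorm_toReal (by simp) (by simp)] at h
  simp only [ENNReal.toReal_ofNat, one_div] at h
  rw [ENNReal.rpow_inv_le_iff (by norm_num), ENNReal.ofReal_rpow_of_nonneg hA (by norm_num)] at h
  simpa using h

theorem eLpNorm_le_of_lintegral_enorm_sq_le {N : ℕ} {E : Type*} [NormedAddCommGroup E]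
    {f : Space N → E} {A : ℝ} (hA : 0 ≤ A)
    (h : ∫⁻ x, ‖f x‖ₑ ^ (2 : ℝ) ≤ ENNReal.ofReal (A ^ 2)) :
    eLpNorm f 2 volume ≤ ENNReal.ofReal A := by
  rw [eLpNorm_eq_lintegral_rpow_enorm_toReal (by simp) (by simp)]
  simp only [ENNReal.toReal_ofNat, one_div]
  rw [ENNReal.rpow_inv_le_iff (by norm_num), ENNReal.ofReal_rpow_of_nonneg hA (by norm_num)]
  simpa using h

/-- The **Gagliardo–Nirenberg inequality** for bounded test functions. -/
theorem gagliardo_nirenberg (N n : ℕ) :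
    ∃ C : ℝ, 0 ≤ C ∧ ∀ f : Space N → ℝ, IsTest f → (∀ x, |f x| ≤ 1) → ∀ A : ℝ, 0 ≤ A →
      (∀ β ∈ indices N n, eLpNorm (multiD β f) 2 volume ≤ ENNReal.ofReal A) →
      ∀ j, 1 ≤ j → j ≤ n → ∀ β ∈ indices N j,
        ∫⁻ x, ‖multiD β f x‖ₑ ^ (2 * n / j : ℝ) ≤ ENNReal.ofReal (C * A ^ 2) := by
  -- The factor `2n` comes from one rung of the ladder; the squared cardinality pays for replacing a
  -- single multi-index by the sum over all those of the same length.
  obtain ⟨c, hcdef⟩ : ∃ c : ℝ,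
      c = (∑ j ∈ Finset.range (n + 1), ((indices N j).card : ℝ)) ^ 2 * (2 * n) := ⟨_, rfl⟩
  have hc : 0 ≤ c := by rw [hcdef]; positivity
  obtain ⟨C, hC, hlog⟩ := exists_pow_le_of_sq_le_mul n c hc
  obtain ⟨K, hK⟩ : ∃ K : ℝ, K = (indices N n).card := ⟨_, rfl⟩
  have hK0 : 0 ≤ K := by rw [hK]; positivity
  refine ⟨∑ j ∈ Finset.range (n + 1), C ^ (2 / j : ℝ) * K ^ 2,
    Finset.sum_nonneg fun j _ => by positivity, fun f hf hf1 A hA hfA j hj hjn β hβ => ?_⟩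
  have hn0 : (0 : ℝ) < n := by exact_mod_cast (by omega : 0 < n)
  set X : ℕ → (Fin N → ℕ) → ℝ≥0∞ := fun m β => ∫⁻ x, ‖multiD β f x‖ₑ ^ (2 * n / m : ℝ) with hX
  have hXtop : ∀ m, 1 ≤ m → ∀ β, X m β ≠ ⊤ := fun m hm β =>
    ((hf.multiDeriv β).lintegral_rpow_lt_top
      (div_pos (by positivity) (by exact_mod_cast hm))).ne
  -- This is the `L^(2n/m)` norm of `∂^β f`. For `m = 0` the outer exponent is zero and the value is
  -- `1`, in accordance with `|f| ≤ 1`.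
  set a : ℕ → (Fin N → ℕ) → ℝ := fun m β => (X m β ^ (m / (2 * n) : ℝ)).toReal with ha
  have ha0 : ∀ m β, 0 ≤ a m β := fun _ _ => ENNReal.toReal_nonneg
  have hfin : ∀ m β, X m β ^ (m / (2 * n) : ℝ) ≠ ⊤ := fun m β => by
    rcases Nat.eq_zero_or_pos m with rfl | hm
    · simp
    · exact ENNReal.rpow_ne_top_of_nonneg (by positivity) (hXtop m hm β)
  set S : ℕ → ℝ := fun m => ∑ β ∈ indices N m, a m β with hS
  have hS0 : ∀ m, 0 ≤ S m := fun m => Finset.sum_nonneg fun β _ => ha0 m β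
  have haS : ∀ m β, β ∈ indices N m → a m β ≤ S m := fun m β hβ =>
    Finset.single_le_sum (f := a m) (fun _ _ => ha0 _ _) hβ
  have hS0' : S 0 ≤ 1 := by
    have : indices N 0 = {0} := by simp [indices]
    simp [hS, this, ha]
  have hstep : ∀ m, m + 1 < n → S (m + 1) ^ 2 ≤ c * (S (m + 2) * S m) := by
    intro m hm
    have hterm : ∀ β ∈ indices N (m + 1), a (m + 1) β ^ 2 ≤ 2 * n * (S (m + 2) * S m) := by
      intro β hβ
      -- The ladder is applied to `∂^γ f` in the direction `i`, which involves the lengths `m`, `m +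
      -- 1` and `m + 2`.
      obtain ⟨γ, i, rfl, hγ⟩ := exists_eq_add_single (mem_indices.1 hβ)
      have h1 := (hf.multiDeriv γ).lintegral_partialD_rpow_le i hm (fun h0 x => by
        subst h0
        have : γ = 0 := by
          funext i
          have := Finset.sum_eq_zero_iff.1 hγ i (Finset.mem_univ i)
          simpa using this
        rw [this, multiD_zero]; exact hf1 x)
      rw [← multiD_add_single hf.1, ← multiD_add_single hf.1] at h1
      have h2 := ENNReal.toReal_mono (ENNReal.mul_ne_top ENNReal.ofReal_ne_top
        (ENNReal.mul_ne_top (by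
          have := hfin (m + 2) (γ + Pi.single i 1 + Pi.single i 1)
          simp only [hX] at this
          push_cast at this
          exact this)
          (hfin m γ))) h1
      rw [ENNReal.toReal_mul, ENNReal.toReal_mul, ENNReal.toReal_ofReal (by positivity)] at h2
      have e1 : a (m + 1) (γ + Pi.single i 1) ^ 2 = ((∫⁻ x, ‖multiD (γ + Pi.single i 1) f x‖ₑ ^
          (2 * n / (m + 1) : ℝ)) ^ ((m + 1) / n : ℝ)).toReal := by
        simp only [ha, hX]
        rw [← ENNReal.toReal_pow, ← ENNReal.rpow_natCast, ← ENNReal.rpow_mul]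
        push_cast
        congr 2
        field_simp
      rw [e1]
      refine h2.trans ?_
      refine mul_le_mul_of_nonneg_left (mul_le_mul ?_ (haS m γ (mem_indices.2 hγ)) (ha0 _ _)
        (hS0 _)) (by positivity)
      have := haS (m + 2) (γ + Pi.single i 1 + Pi.single i 1)
        (mem_indices.2 (by rw [sum_add_single, sum_add_single, hγ]))
      simpa [ha, hX] using this
    calc S (m + 1) ^ 2 ≤ (indices N (m + 1)).card * ∑ β ∈ indices N (m + 1), a (m + 1) β ^ 2 :=
          sq_sum_le_card_mul_sum_sq
      _ ≤ (indices N (m + 1)).card *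
          ((indices N (m + 1)).card * (2 * n * (S (m + 2) * S m))) := by
          gcongr
          refine (Finset.sum_le_sum hterm).trans (le_of_eq ?_)
          rw [Finset.sum_const, nsmul_eq_mul]
      _ = ((indices N (m + 1)).card : ℝ) ^ 2 * (2 * n) * (S (m + 2) * S m) := by ring
      _ ≤ c * (S (m + 2) * S m) := by
          refine mul_le_mul_of_nonneg_right ?_ (mul_nonneg (hS0 _) (hS0 _))
          rw [hcdef]
          gcongr
          exact Finset.single_le_sum (f := fun j => ((indices N j).card : ℝ))
            (fun _ _ => by positivity) (Finset.mem_range.2 (by omega))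
  have hfinal := hlog S hS0 hS0' hstep j hj hjn
  have hSn : S n ≤ K * A := by
    have : ∀ β ∈ indices N n, a n β ≤ A := fun β hβ => by
      have h1 := lintegral_enorm_sq_le_of_eLpNorm_le hA (hfA β hβ)
      simp only [ha, hX]
      rw [show (2 * n / n : ℝ) = 2 by field_simp, show (n / (2 * n) : ℝ) = 1 / 2 by field_simp]
      refine ENNReal.toReal_le_of_le_ofReal hA ?_
      refine (ENNReal.rpow_le_rpow h1 (by norm_num)).trans (le_of_eq ?_)
      rw [ENNReal.ofReal_rpow_of_nonneg (by positivity) (by norm_num), ← Real.sqrt_eq_rpow,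
        Real.sqrt_sq hA]
    refine (Finset.sum_le_sum this).trans (le_of_eq ?_)
    rw [Finset.sum_const, nsmul_eq_mul, hK]
  have hj0 : (0 : ℝ) < j := by exact_mod_cast hj
  have h1 : a j β ^ n ≤ C * (K * A) ^ j :=
    (pow_le_pow_left₀ (ha0 _ _) (haS j β hβ) n).trans (hfinal.trans
      (mul_le_mul_of_nonneg_left (pow_le_pow_left₀ (hS0 _) hSn _) hC))
  have h2 : (X j β).toReal ≤ C ^ (2 / j : ℝ) * K ^ 2 * A ^ 2 := by
    -- The power `2/j` turns the interpolated bound `(KA)^j` into `(KA)²`, whatever `j` is.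
    have e1 : (X j β).toReal = (a j β ^ n) ^ (2 / j : ℝ) := by
      simp only [ha]
      rw [← ENNReal.toReal_pow, ENNReal.toReal_rpow, ← ENNReal.rpow_natCast, ← ENNReal.rpow_mul,
        ← ENNReal.rpow_mul]
      rw [show (j / (2 * n) * ((n : ℕ) * (2 / j)) : ℝ) = 1 by field_simp, ENNReal.rpow_one]
    rw [e1]
    refine (Real.rpow_le_rpow (pow_nonneg (ha0 _ _) _) h1 (by positivity)).trans (le_of_eq ?_)
    rw [Real.mul_rpow hC (by positivity), ← Real.rpow_natCast, ← Real.rpow_mul (by positivity),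
      show ((j : ℕ) * (2 / j) : ℝ) = (2 : ℕ) by push_cast; field_simp, Real.rpow_natCast]
    ring
  refine (ENNReal.ofReal_toReal (hXtop j hj β)).symm.le.trans
    (ENNReal.ofReal_le_ofReal (h2.trans ?_))
  refine mul_le_mul_of_nonneg_right ?_ (by positivity)
  exact Finset.single_le_sum (f := fun j : ℕ => C ^ (2 / j : ℝ) * K ^ 2)
    (fun _ _ => by positivity) (Finset.mem_range.2 (by omega))

/-! ### Moser estimate for the composition with a smooth function -/

/-- The multi-indices of length at most `k`. -/
def indicesLE (N k : ℕ) : Finset (Fin N → ℕ) := (Finset.range (k + 1)).biUnion (indices N)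

theorem mem_indicesLE {N k : ℕ} {α : Fin N → ℕ} : α ∈ indicesLE N k ↔ ∑ i, α i ≤ k := by
  simp [indicesLE, Finset.mem_piAntidiag]

theorem norm_iteratedFDeriv_pi_le {N : ℕ} {ι : Type*} [Fintype ι] {w : ι → Space N → ℝ}
    (hw : ∀ c, ContDiff ℝ ∞ (w c)) (n : ℕ) (x : Space N) :
    ‖iteratedFDeriv ℝ n (fun x c => w c x) x‖ ≤ ∑ c, ‖iteratedFDeriv ℝ n (w c) x‖ := by
  refine ContinuousMultilinearMap.opNorm_le_bound (Finset.sum_nonneg fun _ _ => norm_nonneg _)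
    fun m => ?_
  have hnn : 0 ≤ ∏ i, ‖m i‖ := Finset.prod_nonneg fun _ _ => norm_nonneg _
  refine (pi_norm_le_iff_of_nonneg
    (mul_nonneg (Finset.sum_nonneg fun _ _ => norm_nonneg _) hnn)).2 fun c => ?_
  have h1 : w c = (ContinuousLinearMap.proj (R := ℝ) (φ := fun _ : ι => ℝ) c) ∘
      (fun x c => w c x) := rfl
  have h2 : iteratedFDeriv ℝ n (w c) x m = iteratedFDeriv ℝ n (fun x c => w c x) x m c := by
    rw [h1, ContinuousLinearMap.iteratedFDeriv_comp_left _
      ((contDiff_pi.2 hw : ContDiff ℝ ∞ fun x c => w c x).contDiffAt) (i := n)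
      (by exact_mod_cast le_top)]
    rfl
  rw [← h2]
  refine ((iteratedFDeriv ℝ n (w c) x).le_opNorm m).trans
    (mul_le_mul_of_nonneg_right ?_ hnn)
  exact Finset.single_le_sum (f := fun c => ‖iteratedFDeriv ℝ n (w c) x‖)
    (fun _ _ => norm_nonneg _) (Finset.mem_univ c)

theorem pow_sum_le_card_pow_mul_sum_pow {ι : Type*} (T : Finset ι) {z : ι → ℝ}
    (hz : ∀ i ∈ T, 0 ≤ z i) {m : ℕ} (hm : 1 ≤ m) :
    (∑ i ∈ T, z i) ^ m ≤ (T.card : ℝ) ^ m * ∑ i ∈ T, z i ^ m := by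
  rcases T.eq_empty_or_nonempty with rfl | hT
  · simp [zero_pow (by omega : m ≠ 0)]
  obtain ⟨i, hi, hmax⟩ := T.exists_max_image z hT
  have h1 : ∑ j ∈ T, z j ≤ T.card * z i := by
    refine (Finset.sum_le_sum hmax).trans (le_of_eq ?_)
    rw [Finset.sum_const, nsmul_eq_mul]
  calc (∑ j ∈ T, z j) ^ m ≤ (T.card * z i) ^ m :=
        pow_le_pow_left₀ (Finset.sum_nonneg hz) h1 m
    _ = (T.card : ℝ) ^ m * z i ^ m := mul_pow _ _ _
    _ ≤ _ := by
        gcongr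
        exact Finset.single_le_sum (f := fun j => z j ^ m)
          (fun j hj => pow_nonneg (hz j hj) m) hi

theorem sum_pow_le_pow_sum_of_subset {ι : Type*} {T T' : Finset ι} (hT : T' ⊆ T) {z : ι → ℝ}
    (hz : ∀ i ∈ T, 0 ≤ z i) {m : ℕ} (hm : 1 ≤ m) :
    ∑ i ∈ T', z i ^ m ≤ (∑ i ∈ T, z i) ^ m := by
  obtain ⟨m, rfl⟩ : ∃ l, m = l + 1 := ⟨m - 1, by omega⟩
  have hZ : 0 ≤ ∑ i ∈ T, z i := Finset.sum_nonneg hz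
  calc ∑ i ∈ T', z i ^ (m + 1) ≤ ∑ i ∈ T', (∑ i ∈ T, z i) ^ m * z i := by
        refine Finset.sum_le_sum fun i hi => ?_
        rw [pow_succ]
        exact mul_le_mul_of_nonneg_right (pow_le_pow_left₀ (hz i (hT hi))
          (Finset.single_le_sum hz (hT hi)) m) (hz i (hT hi))
    _ = (∑ i ∈ T, z i) ^ m * ∑ i ∈ T', z i := by rw [Finset.mul_sum]
    _ ≤ (∑ i ∈ T, z i) ^ m * ∑ i ∈ T, z i :=
        mul_le_mul_of_nonneg_left
          (Finset.sum_le_sum_of_subset_of_nonneg hT fun i hi _ => hz i hi) (pow_nonneg hZ m)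
    _ = _ := (pow_succ _ _).symm

theorem norm_le_one_of_abs_le_one {ι : Type*} [Fintype ι] {v : ι → ℝ} (h : ∀ c, |v c| ≤ 1) :
    ‖v‖ ≤ 1 :=
  (pi_norm_le_iff_of_nonneg zero_le_one).2 h

/-- The Faà di Bruno bound requires a single `D` with `‖D^i w‖ ≤ D^i` for all `i`. The homogeneous
choice is a multiple of the sum of the `|∂^β w_c|^(1/|β|)`; then `D^(2n)` is bounded by the powers
`|∂^β w_c|^(2n/|β|)`, exactly those integrated by `gagliardo_nirenberg`. The derivatives of `G` are
bounded because `w` stays in the unit cube. -/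
theorem sq_multiD_comp_le (N n : ℕ) {ι : Type*} [Fintype ι] {G : (ι → ℝ) → ℝ}
    (hG : ContDiff ℝ ∞ G) (hn : 1 ≤ n) :
    ∃ C : ℝ, 0 ≤ C ∧ ∀ w : ι → Space N → ℝ, (∀ c, ContDiff ℝ ∞ (w c)) →
      (∀ c x, |w c x| ≤ 1) → ∀ α ∈ indices N n, ∀ x,
        |multiD α (fun x => G fun c => w c x) x| ^ 2 ≤
          C * ∑ p ∈ (Finset.univ : Finset ι) ×ˢ (indicesLE N n).filter (fun β => 1 ≤ ∑ i, β i),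
            |multiD p.2 (w p.1) x| ^ (2 * n / (∑ i, p.2 i : ℕ) : ℝ) := by
  have hB : ∀ i : ℕ, ∃ B, ∀ v ∈ Metric.closedBall (0 : ι → ℝ) 1, ‖iteratedFDeriv ℝ i G v‖ ≤ B :=
    fun i => (isCompact_closedBall _ _).exists_bound_of_continuousOn
      (hG.continuous_iteratedFDeriv (by exact_mod_cast le_top)).continuousOn
  choose B hB using hB
  obtain ⟨B', hB'⟩ : ∃ B', ∀ i ≤ n, B i ≤ B' := by
    obtain ⟨M, hM⟩ := ((Finset.range (n + 1)).image B).bddAbove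
    exact ⟨M, fun i hi => hM (by simpa using ⟨i, by omega, rfl⟩)⟩
  set T := (Finset.univ : Finset ι) ×ˢ (indicesLE N n).filter (fun β => 1 ≤ ∑ i, β i) with hT
  set K : ℝ := ((N : ℝ) + 1) ^ n with hK
  have hK1 : 1 ≤ K := one_le_pow₀ (by linarith [(Nat.cast_nonneg N : (0 : ℝ) ≤ N)])
  refine ⟨(n.factorial * B' * K ^ n) ^ 2 * (T.card : ℝ) ^ (2 * n), by positivity,
    fun w hw hw1 α hα x => ?_⟩
  set z : ι × (Fin N → ℕ) → ℝ := fun p => |multiD p.2 (w p.1) x| ^ (1 / (∑ i, p.2 i : ℕ) : ℝ)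
    with hz
  have hz0 : ∀ p, 0 ≤ z p := fun p => Real.rpow_nonneg (abs_nonneg _) _
  have hzpow : ∀ p ∈ T, ∀ i, ∑ j, p.2 j = i → z p ^ i = |multiD p.2 (w p.1) x| := by
    intro p hp i hi
    simp only [hT, Finset.mem_product, Finset.mem_filter] at hp
    have : ((∑ j, p.2 j : ℕ) : ℝ) ≠ 0 := by
      have := hp.2.2; exact_mod_cast (by omega : ∑ j, p.2 j ≠ 0)
    simp only [hz]
    rw [← Real.rpow_natCast, ← Real.rpow_mul (abs_nonneg _), ← hi, one_div_mul_cancel this,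
      Real.rpow_one]
  set D : ℝ := K * ∑ p ∈ T, z p with hD
  have hDi : ∀ i, 1 ≤ i → i ≤ n → ‖iteratedFDeriv ℝ i (fun x c => w c x) x‖ ≤ D ^ i := by
    intro i hi hin
    refine (norm_iteratedFDeriv_pi_le hw i x).trans ?_
    calc ∑ c, ‖iteratedFDeriv ℝ i (w c) x‖
        ≤ ∑ c, K * ∑ β ∈ indices N i, |multiD β (w c) x| := by
          refine Finset.sum_le_sum fun c _ => (norm_iteratedFDeriv_le_sum (hw c) i x).trans ?_
          refine mul_le_mul_of_nonneg_right ?_ (Finset.sum_nonneg fun _ _ => abs_nonneg _)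
          calc (N : ℝ) ^ i ≤ ((N : ℝ) + 1) ^ i := by gcongr; linarith
            _ ≤ K := pow_le_pow_right₀ (by linarith [(Nat.cast_nonneg N : (0 : ℝ) ≤ N)]) hin
      _ = K * ∑ p ∈ (Finset.univ : Finset ι) ×ˢ indices N i, |multiD p.2 (w p.1) x| := by
          rw [Finset.sum_product, Finset.mul_sum]
      _ = K * ∑ p ∈ (Finset.univ : Finset ι) ×ˢ indices N i, z p ^ i := by
          congr 1
          refine Finset.sum_congr rfl fun p hp => ?_
          simp only [Finset.mem_product, mem_indices, Finset.mem_univ, true_and] at hp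
          refine (hzpow p ?_ i hp).symm
          simp [hT, mem_indicesLE, hp, hi, hin]
      _ ≤ K * (∑ p ∈ T, z p) ^ i := by
          refine mul_le_mul_of_nonneg_left ?_ (by linarith)
          refine sum_pow_le_pow_sum_of_subset ?_ (fun p _ => hz0 p) hi
          intro p hp
          simp only [Finset.mem_product, mem_indices, Finset.mem_univ, true_and] at hp
          simp [hT, mem_indicesLE, hp, hi, hin]
      _ ≤ K ^ i * (∑ p ∈ T, z p) ^ i := by
          refine mul_le_mul_of_nonneg_right (le_self_pow₀ hK1 (by omega)) ?_
          exact pow_nonneg (Finset.sum_nonneg fun p _ => hz0 p) _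
      _ = D ^ i := by rw [hD, mul_pow]
  have hwx : (fun c => w c x) ∈ Metric.closedBall (0 : ι → ℝ) 1 := by
    rw [mem_closedBall_zero_iff]; exact norm_le_one_of_abs_le_one fun c => hw1 c x
  have hcomp := norm_iteratedFDeriv_comp_le (n := n) (N := ∞) hG
    (contDiff_pi.2 hw : ContDiff ℝ ∞ fun x c => w c x) (by exact_mod_cast le_top) x (fun i hi => (hB i _ hwx).trans (hB' i hi)) hDi
  have h1 := abs_multiD_le_norm_iteratedFDeriv
    (φ := fun x => G fun c => w c x) (hG.comp (contDiff_pi.2 hw)) α x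
  rw [mem_indices.1 hα] at h1
  have h2 : |multiD α (fun x => G fun c => w c x) x| ≤ n.factorial * B' * D ^ n :=
    h1.trans hcomp
  calc |multiD α (fun x => G fun c => w c x) x| ^ 2
      ≤ (n.factorial * B' * D ^ n) ^ 2 := pow_le_pow_left₀ (abs_nonneg _) h2 2
    _ = (n.factorial * B' * K ^ n) ^ 2 * (∑ p ∈ T, z p) ^ (2 * n) := by rw [hD]; ring
    _ ≤ (n.factorial * B' * K ^ n) ^ 2 * ((T.card : ℝ) ^ (2 * n) * ∑ p ∈ T, z p ^ (2 * n)) := by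
        refine mul_le_mul_of_nonneg_left ?_ (by positivity)
        exact pow_sum_le_card_pow_mul_sum_pow T (fun p _ => hz0 p) (by omega)
    _ = _ := by
        have e : ∑ p ∈ T, z p ^ (2 * n) =
            ∑ p ∈ T, |multiD p.2 (w p.1) x| ^ (2 * n / (∑ i, p.2 i : ℕ) : ℝ) := by
          refine Finset.sum_congr rfl fun p hp => ?_
          simp only [hz]
          rw [← Real.rpow_natCast, ← Real.rpow_mul (abs_nonneg _)]
          congr 1
          push_cast
          ring
        rw [e, mul_assoc (_ ^ 2)]

/-- The order-zero case of the Moser estimate: `G` is Lipschitz on the unit cube and vanishes at the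
origin. -/
theorem exists_abs_le_sum_of_contDiff {ι : Type*} [Fintype ι] {G : (ι → ℝ) → ℝ}
    (hG : ContDiff ℝ ∞ G) (hG0 : G 0 = 0) :
    ∃ L : ℝ, 0 ≤ L ∧ ∀ v : ι → ℝ, (∀ c, |v c| ≤ 1) → |G v| ≤ L * ∑ c, |v c| := by
  obtain ⟨L, hL⟩ := (isCompact_closedBall (0 : ι → ℝ) 1).exists_bound_of_continuousOn
    (hG.continuous_fderiv (by simp)).continuousOn
  have hL0 : 0 ≤ L := (norm_nonneg _).trans (hL 0 (by simp))
  refine ⟨L, hL0, fun v hv => ?_⟩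
  have h := (convex_closedBall (0 : ι → ℝ) 1).norm_image_sub_le_of_norm_fderiv_le
    (fun x _ => hG.differentiable (by simp) x) hL (by simp : (0 : ι → ℝ) ∈ _)
    (mem_closedBall_zero_iff.2 (norm_le_one_of_abs_le_one hv))
  rw [hG0, sub_zero, sub_zero] at h
  refine h.trans (mul_le_mul_of_nonneg_left ?_ hL0)
  refine (pi_norm_le_iff_of_nonneg (Finset.sum_nonneg fun _ _ => abs_nonneg _)).2 fun c => ?_
  exact Finset.single_le_sum (f := fun c => |v c|) (fun _ _ => abs_nonneg _) (Finset.mem_univ c)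

/-- For `n ≥ 1` each term of the pointwise bound has integral at most a constant times `A²`, so the
square root is linear in `A`. For `n = 0` the Lipschitz bound plays this role. -/
theorem moser_aux (N n : ℕ) {ι : Type*} [Fintype ι] {G : (ι → ℝ) → ℝ}
    (hG : ContDiff ℝ ∞ G) (hG0 : G 0 = 0) :
    ∃ C : ℝ, 0 ≤ C ∧ ∀ w : ι → Space N → ℝ, (∀ c, IsTest (w c)) →
      (∀ c x, |w c x| ≤ 1) → ∀ A : ℝ, 0 ≤ A →
      (∀ c, ∀ β : Fin N → ℕ, ∑ i, β i ≤ n →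
        eLpNorm (multiD β (w c)) 2 volume ≤ ENNReal.ofReal A) →
      ∀ α ∈ indices N n,
        eLpNorm (multiD α (fun x => G fun c => w c x)) 2 volume ≤ ENNReal.ofReal (C * A) := by
  -- it suffices to bound the square pointwise by a sum with controlled integrals
  suffices H : ∃ (C : ℝ) (T : Finset (ι × (Fin N → ℕ))) (e : ι × (Fin N → ℕ) → ℝ)
      (C' : ι × (Fin N → ℕ) → ℝ), 0 ≤ C ∧ (∀ p, 0 ≤ C' p) ∧ (∀ p, 0 ≤ e p) ∧
      ∀ w : ι → Space N → ℝ, (∀ c, IsTest (w c)) → (∀ c x, |w c x| ≤ 1) →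
      ∀ α ∈ indices N n, (∀ x,
        |multiD α (fun x => G fun c => w c x) x| ^ 2 ≤
          C * ∑ p ∈ T, |multiD p.2 (w p.1) x| ^ e p) ∧
      ∀ A : ℝ, 0 ≤ A → (∀ c, ∀ β : Fin N → ℕ, ∑ i, β i ≤ n →
        eLpNorm (multiD β (w c)) 2 volume ≤ ENNReal.ofReal A) →
      ∀ p ∈ T, ∫⁻ x, ‖multiD p.2 (w p.1) x‖ₑ ^ e p ≤ ENNReal.ofReal (C' p * A ^ 2) by
    obtain ⟨C, T, e, C', hC, hC', he, H⟩ := H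
    have hS : 0 ≤ ∑ p ∈ T, C' p := Finset.sum_nonneg fun p _ => hC' p
    refine ⟨Real.sqrt (C * ∑ p ∈ T, C' p), by positivity, fun w hw hw1 A hA hwA α hα => ?_⟩
    obtain ⟨h1, h2⟩ := H w hw hw1 α hα
    refine eLpNorm_le_of_lintegral_enorm_sq_le (by positivity) ?_
    have h3 : ∀ x, ‖multiD α (fun x => G fun c => w c x) x‖ₑ ^ (2 : ℝ) ≤
        ENNReal.ofReal C * ∑ p ∈ T, ‖multiD p.2 (w p.1) x‖ₑ ^ e p := by
      intro x
      rw [enorm_rpow_eq_ofReal _ (by norm_num)]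
      simp_rw [enorm_rpow_eq_ofReal _ (he _)]
      rw [← ENNReal.ofReal_sum_of_nonneg (fun p _ => by positivity), ← ENNReal.ofReal_mul hC]
      exact ENNReal.ofReal_le_ofReal (by simpa using h1 x)
    refine (lintegral_mono h3).trans ?_
    rw [lintegral_const_mul' _ _ ENNReal.ofReal_ne_top, lintegral_finsetSum' _ (fun p _ =>
      ((((hw p.1).multiDeriv p.2).1.continuous.measurable.enorm.pow_const _).aemeasurable))]
    refine (mul_le_mul_right (Finset.sum_le_sum fun p hp => h2 A hA hwA p hp) _).trans ?_
    rw [← ENNReal.ofReal_sum_of_nonneg (fun p _ => mul_nonneg (hC' p) (sq_nonneg A)),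
      ← ENNReal.ofReal_mul hC]
    refine ENNReal.ofReal_le_ofReal (le_of_eq ?_)
    rw [mul_pow, Real.sq_sqrt (by positivity), ← Finset.sum_mul, mul_assoc]
  rcases Nat.eq_zero_or_pos n with rfl | hn
  · obtain ⟨L, hL, hLv⟩ := exists_abs_le_sum_of_contDiff hG hG0
    refine ⟨L ^ 2 * (Fintype.card ι : ℝ) ^ 2, Finset.univ ×ˢ {0}, fun _ => 2, fun _ => 1,
      by positivity, fun _ => zero_le_one, fun _ => by norm_num, fun w hw hw1 α hα => ⟨fun x => ?_,
        fun A hA hwA p hp => ?_⟩⟩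
    · have : α = 0 := by simpa [indices] using hα
      subst this
      have h1 := hLv (fun c => w c x) fun c => hw1 c x
      simp only [multiD_zero, Finset.sum_product, Finset.sum_singleton, Real.rpow_ofNat]
      calc |G fun c => w c x| ^ 2 ≤ (L * ∑ c, |w c x|) ^ 2 := pow_le_pow_left₀ (abs_nonneg _) h1 2
        _ = L ^ 2 * (∑ c, |w c x|) ^ 2 := by ring
        _ ≤ L ^ 2 * ((Finset.univ : Finset ι).card ^ 2 * ∑ c, |w c x| ^ 2) := by
            refine mul_le_mul_of_nonneg_left ?_ (by positivity)
            exact pow_sum_le_card_pow_mul_sum_pow _ (fun _ _ => abs_nonneg _) (by norm_num)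
        _ = _ := by rw [Finset.card_univ]; ring
    · have hp2 : p.2 = 0 := Finset.mem_singleton.1 (Finset.mem_product.1 hp).2
      rw [one_mul]
      exact lintegral_enorm_sq_le_of_eLpNorm_le hA (hwA p.1 p.2 (by simp [hp2]))
  · obtain ⟨C, hC, h1⟩ := sq_multiD_comp_le N n hG hn
    obtain ⟨C', hC', h2⟩ := gagliardo_nirenberg N n
    refine ⟨C, _, fun p => 2 * n / (∑ i, p.2 i : ℕ), fun _ => C', hC, fun _ => hC',
      fun _ => by positivity, fun w hw hw1 α hα => ⟨h1 w (fun c => (hw c).1) hw1 α hα,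
        fun A hA hwA p hp => ?_⟩⟩
    simp only [Finset.mem_product, Finset.mem_filter, mem_indicesLE] at hp
    exact h2 (w p.1) (hw p.1) (hw1 p.1) A hA
      (fun β hβ => hwA p.1 β (mem_indices.1 hβ).le) _ hp.2.2 hp.2.1 p.2 (mem_indices.2 rfl)

/-- The **Moser estimate**: composition with a smooth function vanishing at the origin is bounded
on the test functions with values in the unit cube. -/
theorem moser (N s : ℕ) {ι : Type*} [Fintype ι] {G : (ι → ℝ) → ℝ}
    (hG : ContDiff ℝ ∞ G) (hG0 : G 0 = 0) :
    ∃ C : ℝ, 0 ≤ C ∧ ∀ w : ι → Space N → ℝ, (∀ c, IsTest (w c)) →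
      (∀ c x, |w c x| ≤ 1) → ∀ A : ℝ, 0 ≤ A →
      (∀ c, ∀ β : Fin N → ℕ, ∑ i, β i ≤ s →
        eLpNorm (multiD β (w c)) 2 volume ≤ ENNReal.ofReal A) →
      ∀ α : Fin N → ℕ, ∑ i, α i ≤ s →
        eLpNorm (multiD α (fun x => G fun c => w c x)) 2 volume ≤ ENNReal.ofReal (C * A) := by
  choose C hC h using fun n => moser_aux N n hG hG0
  refine ⟨∑ n ∈ Finset.range (s + 1), C n, Finset.sum_nonneg fun n _ => hC n,
    fun w hw hw1 A hA hwA α hα => ?_⟩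
  refine (h _ w hw hw1 A hA (fun c β hβ => hwA c β (hβ.trans hα)) α (mem_indices.2 rfl)).trans
    (ENNReal.ofReal_le_ofReal (mul_le_mul_of_nonneg_right ?_ hA))
  exact Finset.single_le_sum (fun n _ => hC n) (Finset.mem_range.2 (by omega))

/-! ### The Sobolev embedding for test functions -/

/-- A real test function as a complex Schwartz function. -/
noncomputable def IsTest.toSchwartz {N : ℕ} {φ : Space N → ℝ} (h : IsTest φ) :
    SchwartzMap (Space N) ℂ :=
  HasCompactSupport.toSchwartzMap (f := fun x => (φ x : ℂ))
    (h.2.comp_left (g := fun y : ℝ => (y : ℂ)) (by simp))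
    (Complex.ofRealCLM.contDiff.comp h.1)

@[simp] theorem IsTest.toSchwartz_apply {N : ℕ} {φ : Space N → ℝ} (h : IsTest φ) (x : Space N) :
    h.toSchwartz x = (φ x : ℂ) := rfl

open FourierTransform LineDeriv in
theorem IsTest.fourier_toSchwartz_partialDeriv {N : ℕ} {φ : Space N → ℝ} (h : IsTest φ)
    (i : Fin N) (ξ : Space N) :
    𝓕 (h.partialDeriv i).toSchwartz ξ =
      (2 * Real.pi * Complex.I) * (ξ i : ℂ) * 𝓕 h.toSchwartz ξ := by
  have e : (h.partialDeriv i).toSchwartz =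
      ∂_{(EuclideanSpace.single i (1 : ℝ) : Space N)} h.toSchwartz := by
    ext x
    rw [SchwartzMap.lineDerivOp_apply_eq_fderiv]
    have h1 : HasFDerivAt (fun y => (φ y : ℂ)) (Complex.ofRealCLM ∘L fderiv ℝ φ x) x :=
      Complex.ofRealCLM.hasFDerivAt.comp x (h.1.differentiable (by simp) x).hasFDerivAt
    change ((partialD i φ x : ℝ) : ℂ) = fderiv ℝ (fun y => (φ y : ℂ)) x _
    rw [h1.fderiv]
    rfl
  rw [e, SchwartzMap.fourier_lineDerivOp_eq]
  have : (inner ℝ · (EuclideanSpace.single i (1 : ℝ)) : Space N → ℝ).HasTemperateGrowth := by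
    fun_prop
  rw [smul_apply, SchwartzMap.smulLeftCLM_apply_apply this]
  simp [EuclideanSpace.inner_single_right, mul_assoc]

open FourierTransform in
theorem IsTest.fourier_toSchwartz_multiD_single {N : ℕ} {φ : Space N → ℝ} (h : IsTest φ)
    (i : Fin N) (m : ℕ) (ξ : Space N) :
    𝓕 (h.multiDeriv (Pi.single i m)).toSchwartz ξ =
      ((2 * Real.pi * Complex.I) * (ξ i : ℂ)) ^ m * 𝓕 h.toSchwartz ξ := by
  induction m with
  | zero => simp
  | succ m ih =>
    have e : (h.multiDeriv (Pi.single i (m + 1))).toSchwartz =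
        ((h.multiDeriv (Pi.single i m)).partialDeriv i).toSchwartz := by
      ext x
      simp only [IsTest.toSchwartz_apply]
      rw [← multiD_add_single h.1, ← Pi.single_add]
    rw [e, IsTest.fourier_toSchwartz_partialDeriv (h.multiDeriv (Pi.single i m)), ih]
    ring

open FourierTransform in
theorem IsTest.abs_le_integral_fourier {N : ℕ} {φ : Space N → ℝ} (h : IsTest φ) (x : Space N) :
    |φ x| ≤ ∫ ξ, ‖𝓕 h.toSchwartz ξ‖ := by
  have h1 : h.toSchwartz x = 𝓕⁻ (𝓕 h.toSchwartz) x := by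
    rw [fourierInv_fourier_eq]
  have h2 : |φ x| = ‖h.toSchwartz x‖ := by simp
  rw [h2, h1, SchwartzMap.fourierInv_coe, Real.fourierInv_eq]
  refine (norm_integral_le_integral_norm _).trans (le_of_eq ?_)
  simp

/-- Shows that the pure derivatives `∂_i^s`, together with the function itself, control the full
Sobolev weight on the Fourier side. -/
theorem one_add_norm_pow_le {N s : ℕ} (hs : 1 ≤ s) (ξ : Space N) :
    (1 + ‖ξ‖) ^ (2 * s) ≤ ((N : ℝ) + 1) ^ (2 * s) * (1 + ∑ i, |ξ i| ^ (2 * s)) := by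
  have h1 : ‖ξ‖ ≤ ∑ i, |ξ i| := by
    rw [EuclideanSpace.norm_eq, Real.sqrt_le_iff]
    refine ⟨Finset.sum_nonneg fun _ _ => abs_nonneg _, ?_⟩
    exact sum_pow_le_pow_sum_of_subset (subset_refl _) (fun _ _ => norm_nonneg _) one_le_two
  have h2 := pow_sum_le_card_pow_mul_sum_pow (Finset.univ : Finset (Option (Fin N)))
    (z := fun o => o.elim 1 fun i => |ξ i|) (by rintro (_ | i) _ <;> simp) (m := 2 * s) (by omega)
  rw [Fintype.sum_option, Fintype.sum_option] at h2
  simp only [Option.elim_none, Option.elim_some, one_pow, Finset.card_univ, Fintype.card_option,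
    Fintype.card_fin, Nat.cast_add, Nat.cast_one] at h2
  exact (pow_le_pow_left₀ (by positivity) (by linarith) _).trans h2

open FourierTransform in
/-- The **Sobolev embedding** of `H^s` in `L^∞` for test functions. -/
theorem sobolev_test (N s : ℕ) (hs : N < 2 * s) :
    ∃ C : ℝ, 0 < C ∧ ∀ φ : Space N → ℝ, IsTest φ → ∀ A : ℝ, 0 < A →
      (∀ β : Fin N → ℕ, ∑ i, β i ≤ s → eLpNorm (multiD β φ) 2 volume ≤ ENNReal.ofReal A) →
      ∀ x, |φ x| ≤ C * A := by
  set J : ℝ := ∫ ξ : Space N, (1 + ‖ξ‖) ^ (-(2 * s : ℕ) : ℝ) with hJ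
  have hJ0 : 0 ≤ J := integral_nonneg fun ξ => by positivity
  set K : ℝ := ((N : ℝ) + 1) ^ (2 * s) with hK
  refine ⟨J + K * (N + 1), by positivity, fun φ hφ A hA hφA x => ?_⟩
  have hint : Integrable fun ξ : Space N => (1 + ‖ξ‖) ^ (-(2 * s : ℕ) : ℝ) :=
    integrable_one_add_norm (by
      rw [finrank_euclideanSpace_fin]; exact_mod_cast hs)
  have hsq : ∀ (ψ : Space N → ℝ) (hψ : IsTest ψ), Integrable fun ξ => ‖𝓕 hψ.toSchwartz ξ‖ ^ 2 :=
    fun ψ hψ => ((𝓕 hψ.toSchwartz).memLp 2).integrable_norm_pow (by norm_num)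
  have hpl : ∀ (ψ : Space N → ℝ) (hψ : IsTest ψ), eLpNorm ψ 2 volume ≤ ENNReal.ofReal A →
      ∫ ξ, ‖𝓕 hψ.toSchwartz ξ‖ ^ 2 ≤ A ^ 2 := by
    intro ψ hψ h
    rw [SchwartzMap.integral_norm_sq_fourier]
    have h1 := lintegral_enorm_sq_le_of_eLpNorm_le hA.le h
    have h2 : ∫ x, ‖hψ.toSchwartz x‖ ^ 2 = (∫⁻ x, ‖ψ x‖ₑ ^ (2 : ℝ)).toReal := by
      rw [integral_eq_lintegral_of_nonneg_ae (.of_forall fun x => by positivity)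
        (by
          have := hψ.toSchwartz.continuous
          exact (this.norm.pow 2).aestronglyMeasurable)]
      congr 2
      funext x
      rw [enorm_rpow_eq_ofReal _ (by norm_num)]
      simp
    rw [h2]
    exact ENNReal.toReal_le_of_le_ofReal (by positivity) h1
  set h := 𝓕 hφ.toSchwartz with hh
  -- A pointwise form of Cauchy–Schwarz: with `p` the weight, `|h| ≤ A/p + p|h|²/A`. The first term
  -- is integrable because `2s > N`, and balancing with `A` makes both integrals linear in `A`.
  have hpt : ∀ ξ, ‖h ξ‖ ≤ A * (1 + ‖ξ‖) ^ (-(2 * s : ℕ) : ℝ) +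
      K / A * (‖h ξ‖ ^ 2 + ∑ i, ‖𝓕 (hφ.multiDeriv (Pi.single i s)).toSchwartz ξ‖ ^ 2) := by
    intro ξ
    have hp : 0 < (1 + ‖ξ‖) ^ (2 * s) := by positivity
    have h1 : (1 + ‖ξ‖) ^ (2 * s) * ‖h ξ‖ ^ 2 ≤
        K * (‖h ξ‖ ^ 2 + ∑ i, ‖𝓕 (hφ.multiDeriv (Pi.single i s)).toSchwartz ξ‖ ^ 2) := by
      calc (1 + ‖ξ‖) ^ (2 * s) * ‖h ξ‖ ^ 2
          ≤ (K * (1 + ∑ i, |ξ i| ^ (2 * s))) * ‖h ξ‖ ^ 2 :=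
            mul_le_mul_of_nonneg_right (one_add_norm_pow_le (by omega) ξ) (by positivity)
        _ = K * (‖h ξ‖ ^ 2 + ∑ i, |ξ i| ^ (2 * s) * ‖h ξ‖ ^ 2) := by
            rw [← Finset.sum_mul]; ring
        _ ≤ _ := by
            refine mul_le_mul_of_nonneg_left ?_ (by positivity)
            refine add_le_add le_rfl (Finset.sum_le_sum fun i _ => ?_)
            rw [IsTest.fourier_toSchwartz_multiD_single, norm_mul, norm_pow, mul_pow, ← pow_mul,
              mul_comm s 2]
            refine mul_le_mul_of_nonneg_right (pow_le_pow_left₀ (abs_nonneg _) ?_ _)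
              (by positivity)
            simp only [norm_mul, Complex.norm_ofNat, Complex.norm_real, Complex.norm_I, mul_one,
              Real.norm_eq_abs, abs_of_pos Real.pi_pos]
            exact le_mul_of_one_le_left (abs_nonneg _) (by linarith [Real.pi_gt_three])
    rw [Real.rpow_neg (by positivity), Real.rpow_natCast]
    set p := (1 + ‖ξ‖) ^ (2 * s)
    have h2 : ‖h ξ‖ ≤ A * p⁻¹ + 1 / A * (p * ‖h ξ‖ ^ 2) := by
      have h3 : A * p⁻¹ + 1 / A * (p * ‖h ξ‖ ^ 2) - ‖h ξ‖ =
          ((A - p * ‖h ξ‖) ^ 2 + A * p * ‖h ξ‖) / (A * p) := by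
        field_simp; ring
      have h4 : 0 ≤ ((A - p * ‖h ξ‖) ^ 2 + A * p * ‖h ξ‖) / (A * p) := by positivity
      linarith
    refine h2.trans (add_le_add le_rfl ?_)
    calc 1 / A * (p * ‖h ξ‖ ^ 2) ≤ 1 / A * (K * (‖h ξ‖ ^ 2 +
          ∑ i, ‖𝓕 (hφ.multiDeriv (Pi.single i s)).toSchwartz ξ‖ ^ 2)) :=
          mul_le_mul_of_nonneg_left h1 (by positivity)
      _ = _ := by ring
  have hI2 : Integrable fun ξ => ‖h ξ‖ ^ 2 +
      ∑ i, ‖𝓕 (hφ.multiDeriv (Pi.single i s)).toSchwartz ξ‖ ^ 2 :=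
    (hsq φ hφ).add (integrable_finsetSum _ fun i _ => hsq _ _)
  refine (hφ.abs_le_integral_fourier x).trans ((integral_mono h.integrable.norm
    ((hint.const_mul A).add (hI2.const_mul (K / A))) hpt).trans ?_)
  simp only [Pi.add_apply]
  rw [integral_add (hint.const_mul A) (hI2.const_mul (K / A)), integral_const_mul,
    integral_const_mul, integral_add (hsq φ hφ) (integrable_finsetSum _ fun i _ => hsq _ _),
    integral_finsetSum _ fun i _ => hsq _ _]
  have h5 : ∫ ξ, ‖h ξ‖ ^ 2 ≤ A ^ 2 := hpl φ hφ (by simpa using hφA 0 (by simp))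
  have h6 : ∑ i : Fin N, ∫ ξ, ‖𝓕 (hφ.multiDeriv (Pi.single i s)).toSchwartz ξ‖ ^ 2 ≤
      N * A ^ 2 := by
    refine (Finset.sum_le_sum fun i _ => hpl _ (hφ.multiDeriv (Pi.single i s))
      (hφA _ (by simp))).trans (le_of_eq ?_)
    simp
  change A * J + K / A * ((∫ ξ, ‖h ξ‖ ^ 2) +
    ∑ i : Fin N, ∫ ξ, ‖𝓕 (hφ.multiDeriv (Pi.single i s)).toSchwartz ξ‖ ^ 2) ≤ _
  calc A * J + K / A * ((∫ ξ, ‖h ξ‖ ^ 2) +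
        ∑ i : Fin N, ∫ ξ, ‖𝓕 (hφ.multiDeriv (Pi.single i s)).toSchwartz ξ‖ ^ 2)
      ≤ A * J + K / A * (A ^ 2 + N * A ^ 2) := by gcongr
    _ = (J + K * (N + 1)) * A := by field_simp; ring

/-! ### Weak derivatives of real-valued functions -/

/-- `b` is the weak derivative `∂^α a`, for real-valued functions. -/
def HasRealWeakDeriv {N : ℕ} (α : Fin N → ℕ) (a b : Space N → ℝ) : Prop :=
  LocallyIntegrable a ∧ LocallyIntegrable b ∧
    ∀ φ : Space N → ℝ, IsTest φ →
      ∫ x, multiD α φ x * a x = (-1 : ℝ) ^ (∑ i, α i) * ∫ x, φ x * b x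

theorem IsTest.integrable_smul {N : ℕ} {E : Type*} [NormedAddCommGroup E] [NormedSpace ℝ E]
    {φ : Space N → ℝ} (h : IsTest φ) {f : Space N → E} (hf : LocallyIntegrable f) :
    Integrable fun x => φ x • f x :=
  hf.integrable_smul_left_of_hasCompactSupport h.1.continuous h.2

theorem IsTest.re_integral_smul {N : ℕ} {φ : Space N → ℝ} (h : IsTest φ) {f : Space N → ℂ}
    (hf : LocallyIntegrable f) : (∫ x, φ x • f x).re = ∫ x, φ x * (f x).re := by
  rw [← Complex.reCLM_apply, ← Complex.reCLM.integral_comp_comm (h.integrable_smul hf)]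
  simp

theorem IsTest.im_integral_smul {N : ℕ} {φ : Space N → ℝ} (h : IsTest φ) {f : Space N → ℂ}
    (hf : LocallyIntegrable f) : (∫ x, φ x • f x).im = ∫ x, φ x * (f x).im := by
  rw [← Complex.imCLM_apply, ← Complex.imCLM.integral_comp_comm (h.integrable_smul hf)]
  simp

theorem LocallyIntegrable.re {N : ℕ} {f : Space N → ℂ} (hf : LocallyIntegrable f) :
    LocallyIntegrable fun x => (f x).re := fun x => by
  obtain ⟨s, hs, h⟩ := hf x
  exact ⟨s, hs, h.re⟩

theorem LocallyIntegrable.im {N : ℕ} {f : Space N → ℂ} (hf : LocallyIntegrable f) :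
    LocallyIntegrable fun x => (f x).im := fun x => by
  obtain ⟨s, hs, h⟩ := hf x
  exact ⟨s, hs, h.im⟩

theorem neg_one_pow_mul_re (n : ℕ) (z : ℂ) : ((-1 : ℂ) ^ n * z).re = (-1 : ℝ) ^ n * z.re := by
  rcases Nat.even_or_odd n with hn | hn <;> simp [hn]

theorem neg_one_pow_mul_im (n : ℕ) (z : ℂ) : ((-1 : ℂ) ^ n * z).im = (-1 : ℝ) ^ n * z.im := by
  rcases Nat.even_or_odd n with hn | hn <;> simp [hn]

theorem HasWeakDeriv.re {N : ℕ} {α : Fin N → ℕ} {f g : Space N → ℂ} (h : HasWeakDeriv α f g) :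
    HasRealWeakDeriv α (fun x => (f x).re) fun x => (g x).re := by
  refine ⟨LocallyIntegrable.re h.1, LocallyIntegrable.re h.2.1, fun φ hφ => ?_⟩
  rw [← (hφ.multiDeriv α).re_integral_smul h.1, ← hφ.re_integral_smul h.2.1, h.2.2 φ hφ,
    neg_one_pow_mul_re]

theorem HasWeakDeriv.im {N : ℕ} {α : Fin N → ℕ} {f g : Space N → ℂ} (h : HasWeakDeriv α f g) :
    HasRealWeakDeriv α (fun x => (f x).im) fun x => (g x).im := by
  refine ⟨LocallyIntegrable.im h.1, LocallyIntegrable.im h.2.1, fun φ hφ => ?_⟩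
  rw [← (hφ.multiDeriv α).im_integral_smul h.1, ← hφ.im_integral_smul h.2.1, h.2.2 φ hφ,
    neg_one_pow_mul_im]

theorem LocallyIntegrable.of_re_im {N : ℕ} {f : Space N → ℂ}
    (hr : LocallyIntegrable fun x => (f x).re) (hi : LocallyIntegrable fun x => (f x).im) :
    LocallyIntegrable f := fun x => by
  obtain ⟨s, hs, h⟩ := hr x
  obtain ⟨t, ht, h'⟩ := hi x
  refine ⟨s ∩ t, Filter.inter_mem hs ht, ?_⟩
  have h1 := ((h.mono_set inter_subset_left).ofReal (𝕜 := ℂ)).add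
    (((h'.mono_set inter_subset_right).ofReal (𝕜 := ℂ)).const_mul Complex.I)
  refine h1.congr (.of_forall fun y => ?_)
  simpa [mul_comm] using Complex.re_add_im (f y)

theorem HasWeakDeriv.of_re_im {N : ℕ} {α : Fin N → ℕ} {f g : Space N → ℂ}
    (hr : HasRealWeakDeriv α (fun x => (f x).re) fun x => (g x).re)
    (hi : HasRealWeakDeriv α (fun x => (f x).im) fun x => (g x).im) : HasWeakDeriv α f g := by
  have hf := LocallyIntegrable.of_re_im hr.1 hi.1
  have hg := LocallyIntegrable.of_re_im hr.2.1 hi.2.1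
  refine ⟨hf, hg, fun φ hφ => Complex.ext ?_ ?_⟩
  · rw [(hφ.multiDeriv α).re_integral_smul hf, neg_one_pow_mul_re, hφ.re_integral_smul hg,
      hr.2.2 φ hφ]
  · rw [(hφ.multiDeriv α).im_integral_smul hf, neg_one_pow_mul_im, hφ.im_integral_smul hg,
      hi.2.2 φ hφ]

theorem HasRealWeakDeriv.congr {N : ℕ} {α : Fin N → ℕ} {a b a' b' : Space N → ℝ}
    (h : HasRealWeakDeriv α a b) (ha : a =ᵐ[volume] a') (hb : b =ᵐ[volume] b') :
    HasRealWeakDeriv α a' b' := by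
  refine ⟨h.1.congr ha, h.2.1.congr hb, fun φ hφ => ?_⟩
  rw [← integral_congr_ae (ha.mono fun x hx => by simp only [hx] :
    (fun x => multiD α φ x * a x) =ᵐ[volume] _), h.2.2 φ hφ,
    integral_congr_ae (hb.mono fun x hx => by simp only [hx] :
    (fun x => φ x * b x) =ᵐ[volume] fun x => φ x * b' x)]

theorem HasWeakDeriv.congr {N : ℕ} {α : Fin N → ℕ} {a b a' b' : Space N → ℂ}
    (h : HasWeakDeriv α a b) (ha : a =ᵐ[volume] a') (hb : b =ᵐ[volume] b') :
    HasWeakDeriv α a' b' := by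
  refine ⟨h.1.congr ha, h.2.1.congr hb, fun φ hφ => ?_⟩
  rw [← integral_congr_ae (ha.mono fun x hx => by simp only [hx] :
    (fun x => multiD α φ x • a x) =ᵐ[volume] _), h.2.2 φ hφ,
    integral_congr_ae (hb.mono fun x hx => by simp only [hx] :
    (fun x => φ x • b x) =ᵐ[volume] fun x => φ x • b' x)]

/-- Test the relation for `∂^α` against `∂^β φ`, which is again a test function, and cancel the sign
`(-1)^|α|`. -/
theorem HasWeakDeriv.of_add {N : ℕ} {α β : Fin N → ℕ} {f g h : Space N → ℂ}
    (hα : HasWeakDeriv α f g) (hαβ : HasWeakDeriv (β + α) f h) : HasWeakDeriv β g h := by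
  refine ⟨hα.2.1, hαβ.2.1, fun φ hφ => ?_⟩
  have h1 := hα.2.2 _ (hφ.multiDeriv β)
  have h2 := hαβ.2.2 φ hφ
  rw [add_comm, multiD_add hφ.1, h1] at h2
  simp only [Pi.add_apply, Finset.sum_add_distrib, pow_add, mul_assoc] at h2
  exact mul_left_cancel₀ (pow_ne_zero _ (by norm_num)) h2

theorem HasRealWeakDeriv.of_add {N : ℕ} {α β : Fin N → ℕ} {f g h : Space N → ℝ}
    (hα : HasRealWeakDeriv α f g) (hαβ : HasRealWeakDeriv (β + α) f h) :
    HasRealWeakDeriv β g h := by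
  refine ⟨hα.2.1, hαβ.2.1, fun φ hφ => ?_⟩
  have h1 := hα.2.2 _ (hφ.multiDeriv β)
  have h2 := hαβ.2.2 φ hφ
  rw [add_comm, multiD_add hφ.1, h1] at h2
  simp only [Pi.add_apply, Finset.sum_add_distrib, pow_add, mul_assoc] at h2
  exact mul_left_cancel₀ (pow_ne_zero _ (by norm_num)) h2

theorem HasRealWeakDeriv.ae_eq_of_zero {N : ℕ} {a b : Space N → ℝ}
    (h : HasRealWeakDeriv 0 a b) : a =ᵐ[volume] b := by
  refine ae_eq_of_integral_contDiff_smul_eq h.1 h.2.1 fun φ hφ hc => ?_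
  simpa using h.2.2 φ ⟨hφ, hc⟩

theorem integral_multiD_mul_eq {N : ℕ} {φ F : Space N → ℝ} (hφ : IsTest φ)
    (hF : ContDiff ℝ ∞ F) (α : Fin N → ℕ) :
    ∫ x, multiD α φ x * F x = (-1 : ℝ) ^ (∑ i, α i) * ∫ x, φ x * multiD α F x := by
  have key : ∀ (i : Fin N) (ψ G : Space N → ℝ), IsTest ψ → ContDiff ℝ ∞ G →
      ∫ x, partialD i ψ x * G x = -∫ x, ψ x * partialD i G x := fun i ψ G hψ hG => by
    have := hψ.integral_mul_partialD (hG.of_le (by simp)) i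
    simp_rw [mul_comm (G _)] at this
    rw [this]
    simp_rw [mul_comm _ (ψ _)]
    rfl
  induction α using multiIndex_induction generalizing F with
  | zero => simp
  | add_single α i ih =>
    rw [multiD_add_single hφ.1, key i _ _ (hφ.multiDeriv α) hF, ih (contDiff_partialD hF i),
      multiD_partialD hF, ← multiD_add_single hF, sum_add_single, pow_succ]
    ring

/-! ### Weak limits in `L²` -/

theorem eLpNorm_sub_le_of_le {N : ℕ} {f g : Space N → ℝ} {A : ℝ} (hA : 0 ≤ A)
    (hf : AEStronglyMeasurable f volume) (hg : AEStronglyMeasurable g volume)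
    (h1 : eLpNorm f 2 volume ≤ ENNReal.ofReal A) (h2 : eLpNorm g 2 volume ≤ ENNReal.ofReal A) :
    eLpNorm (f - g) 2 volume ≤ ENNReal.ofReal (2 * A) := by
  refine (eLpNorm_sub_le hf hg one_le_two).trans ((add_le_add h1 h2).trans (le_of_eq ?_))
  rw [← ENNReal.ofReal_add hA hA, two_mul]

theorem eLpNorm_le_of_tendsto_ae {N : ℕ} {f : ℕ → Space N → ℝ} {g : Space N → ℝ} {A : ℝ}
    (hf : ∀ n, AEStronglyMeasurable (f n) volume)
    (hA : ∀ n, eLpNorm (f n) 2 volume ≤ ENNReal.ofReal A)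
    (hlim : ∀ᵐ x, Tendsto (fun n => f n x) atTop (𝓝 (g x))) :
    MemLp g 2 volume ∧ eLpNorm g 2 volume ≤ ENNReal.ofReal A := by
  have h1 : eLpNorm g 2 volume ≤ ENNReal.ofReal A := by
    refine (Lp.eLpNorm_lim_le_liminf_eLpNorm hf g hlim).trans ?_
    refine (liminf_le_liminf (v := fun _ => ENNReal.ofReal A) (.of_forall hA)).trans ?_
    simp
  exact ⟨⟨aestronglyMeasurable_of_tendsto_ae atTop hf hlim, h1.trans_lt ENNReal.ofReal_lt_top⟩, h1⟩

theorem integral_sq_le_of_eLpNorm_le {N : ℕ} {d : Space N → ℝ} {A : ℝ} (hA : 0 ≤ A)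
    (hd : AEStronglyMeasurable d volume) (h : eLpNorm d 2 volume ≤ ENNReal.ofReal A) :
    ∫ x, d x ^ 2 ≤ A ^ 2 := by
  rw [integral_eq_lintegral_of_nonneg_ae (.of_forall fun x => sq_nonneg _)
    (hd.aemeasurable.pow_const 2).aestronglyMeasurable]
  refine ENNReal.toReal_le_of_le_ofReal (by positivity) (le_trans (le_of_eq ?_)
    (lintegral_enorm_sq_le_of_eLpNorm_le hA h))
  congr 1
  funext x
  rw [enorm_rpow_eq_ofReal _ (by norm_num)]
  simp

/-- A sequence which is bounded in `L²` and converges almost everywhere converges weakly. -/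
theorem tendsto_integral_mul_of_tendsto_ae {N : ℕ} {f : ℕ → Space N → ℝ} {g : Space N → ℝ} {A : ℝ}
    (hA0 : 0 ≤ A) (hf : ∀ n, AEStronglyMeasurable (f n) volume)
    (hA : ∀ n, eLpNorm (f n) 2 volume ≤ ENNReal.ofReal A)
    (hlim : ∀ᵐ x, Tendsto (fun n => f n x) atTop (𝓝 (g x)))
    {φ : Space N → ℝ} (hφ : MemLp φ 2 volume) :
    Tendsto (fun n => ∫ x, φ x * f n x) atTop (𝓝 (∫ x, φ x * g x)) := by
  obtain ⟨hg, hgA⟩ := eLpNorm_le_of_tendsto_ae hf hA hlim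
  have hfm : ∀ n, MemLp (f n) 2 volume := fun n => ⟨hf n, (hA n).trans_lt ENNReal.ofReal_lt_top⟩
  have hd : ∀ n, MemLp (f n - g) 2 volume := fun n => (hfm n).sub hg
  have hdA : ∀ n, ∫ x, (f n x - g x) ^ 2 ≤ (2 * A) ^ 2 := fun n =>
    integral_sq_le_of_eLpNorm_le (by positivity) (hd n).1
      (eLpNorm_sub_le_of_le hA0 (hf n) hg.1 (hA n) hgA)
  have hdint : ∀ n, Integrable fun x => (f n x - g x) ^ 2 := fun n => (hd n).integrable_sq
  have hφsq : Integrable fun x => φ x ^ 2 := hφ.integrable_sq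
  have hint : ∀ n, Integrable fun x => φ x * f n x := fun n => hφ.integrable_mul (hfm n)
  have hint' : Integrable fun x => φ x * g x := hφ.integrable_mul hg
  rw [Metric.tendsto_atTop]
  intro ε hε
  -- The difference `d = f n - g` is cut at height `K|φ|`. Below it, `|dφ|` is dominated by `Kφ²`
  -- and dominated convergence applies; above it, `|dφ| ≤ d²/K`, whose integral is at most `(2A)²/K
  -- ≤ ε/2`.
  set K : ℝ := 2 * (2 * A) ^ 2 / ε + 1 with hK
  have hKpos : 0 < K := by positivity
  have hmeas : ∀ n, AEStronglyMeasurable (fun x => min |f n x - g x| (K * |φ x|) * |φ x|)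
      volume := fun n =>
    ((((hd n).1.aemeasurable.abs).min (hφ.1.aemeasurable.abs.const_mul K)).mul
      hφ.1.aemeasurable.abs).aestronglyMeasurable
  have hbd : ∀ n x, ‖min |f n x - g x| (K * |φ x|) * |φ x|‖ ≤ K * φ x ^ 2 := by
    intro n x
    rw [Real.norm_of_nonneg (by positivity), ← sq_abs (φ x)]
    calc min |f n x - g x| (K * |φ x|) * |φ x| ≤ (K * |φ x|) * |φ x| :=
          mul_le_mul_of_nonneg_right (min_le_right _ _) (abs_nonneg _)
      _ = _ := by ring
  have hminlim : Tendsto (fun n => ∫ x, min |f n x - g x| (K * |φ x|) * |φ x|) atTop (𝓝 0) := by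
    have := tendsto_integral_of_dominated_convergence (fun x => K * φ x ^ 2)
      (F := fun n x => min |f n x - g x| (K * |φ x|) * |φ x|) (f := fun _ => 0) hmeas
      (hφsq.const_mul K) (fun n => .of_forall (hbd n)) (by
        filter_upwards [hlim] with x hx
        have h1 : Tendsto (fun n => |f n x - g x|) atTop (𝓝 0) := by
          have := (hx.sub_const (g x)).abs
          simpa using this
        have h2 := (h1.min (tendsto_const_nhds (x := K * |φ x|))).mul_const |φ x|
        rwa [min_eq_left (by positivity), zero_mul] at h2)
    simpa using this
  obtain ⟨n0, hn0⟩ := (Metric.tendsto_atTop.1 hminlim) (ε / 2) (by positivity)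
  refine ⟨n0, fun n hn => ?_⟩
  have h3 := hn0 n hn
  rw [Real.dist_eq, sub_zero] at h3
  have hmint : Integrable fun x => min |f n x - g x| (K * |φ x|) * |φ x| :=
    (hφsq.const_mul K).mono' (hmeas n) (.of_forall (hbd n))
  rw [Real.dist_eq, ← integral_sub (hint n) hint']
  have hpt : ∀ x, ‖φ x * f n x - φ x * g x‖ ≤
      min |f n x - g x| (K * |φ x|) * |φ x| + 1 / K * (f n x - g x) ^ 2 := by
    intro x
    rw [← mul_sub, norm_mul, Real.norm_eq_abs, Real.norm_eq_abs, mul_comm]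
    rcases le_total |f n x - g x| (K * |φ x|) with h | h
    · rw [min_eq_left h]
      have : 0 ≤ 1 / K * (f n x - g x) ^ 2 := by positivity
      linarith
    · rw [min_eq_right h]
      have h5 : |f n x - g x| * |φ x| ≤ 1 / K * (f n x - g x) ^ 2 := by
        rw [← sq_abs (f n x - g x), one_div, ← div_eq_inv_mul, le_div_iff₀ hKpos]
        calc |f n x - g x| * |φ x| * K = |f n x - g x| * (K * |φ x|) := by ring
          _ ≤ |f n x - g x| * |f n x - g x| := mul_le_mul_of_nonneg_left h (abs_nonneg _)
          _ = _ := by ring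
      have : 0 ≤ K * |φ x| * |φ x| := by positivity
      linarith
  have h6 : ‖∫ x, (φ x * f n x - φ x * g x)‖ ≤
      ∫ x, (min |f n x - g x| (K * |φ x|) * |φ x| + 1 / K * (f n x - g x) ^ 2) :=
    norm_integral_le_of_norm_le (hmint.add ((hdint n).const_mul _)) (.of_forall hpt)
  rw [integral_add hmint ((hdint n).const_mul _), integral_const_mul] at h6
  rw [← Real.norm_eq_abs]
  refine h6.trans_lt ?_
  have h7 : 1 / K * ∫ x, (f n x - g x) ^ 2 ≤ ε / 2 := by
    calc 1 / K * ∫ x, (f n x - g x) ^ 2 ≤ 1 / K * (2 * A) ^ 2 :=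
          mul_le_mul_of_nonneg_left (hdA n) (by positivity)
      _ ≤ ε / 2 := by
          rw [one_div, ← div_eq_inv_mul, div_le_iff₀ hKpos, hK]
          have : ε / 2 * (2 * (2 * A) ^ 2 / ε + 1) = (2 * A) ^ 2 + ε / 2 := by field_simp
          rw [this]; linarith
  have := (abs_lt.1 h3).2
  linarith

/-- The bound makes `L` factor through the range of `T`; Hahn–Banach extends the resulting
functional without increasing its norm, and Riesz represents it. Neither injectivity of `T` nor
density of its range is needed. -/
theorem exists_inner_representation {V H : Type*} [AddCommGroup V] [Module ℝ V]
    [NormedAddCommGroup H] [InnerProductSpace ℝ H] [CompleteSpace H] (T : V →ₗ[ℝ] H)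
    (L : V →ₗ[ℝ] ℝ) {A : ℝ} (hA : 0 ≤ A) (h : ∀ v, |L v| ≤ A * ‖T v‖) :
    ∃ g : H, ‖g‖ ≤ A ∧ ∀ v, L v = inner ℝ g (T v) := by
  have hker : LinearMap.ker T ≤ LinearMap.ker L := fun v hv => by
    rw [LinearMap.mem_ker] at hv ⊢
    have := h v
    rw [hv, norm_zero, mul_zero] at this
    exact abs_nonpos_iff.1 this
  let L' : LinearMap.range T →ₗ[ℝ] ℝ :=
    ((LinearMap.ker T).liftQ L hker).comp T.quotKerEquivRange.symm.toLinearMap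
  have hL' : ∀ v, L' ⟨T v, LinearMap.mem_range_self T v⟩ = L v := fun v => by
    have : T.quotKerEquivRange.symm ⟨T v, LinearMap.mem_range_self T v⟩ =
        (LinearMap.ker T).mkQ v := by
      rw [LinearEquiv.symm_apply_eq]; rfl
    simp only [L', LinearMap.comp_apply, LinearEquiv.coe_coe, this]
    simp
  have hbd : ∀ y, ‖L' y‖ ≤ A * ‖y‖ := by
    rintro ⟨_, v, rfl⟩
    rw [hL', Real.norm_eq_abs]
    exact h v
  obtain ⟨g, hg1, hg2⟩ := _root_.exists_extension_norm_eq (LinearMap.range T) (L'.mkContinuous A hbd)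
  refine ⟨(InnerProductSpace.toDual ℝ H).symm g, ?_, fun v => ?_⟩
  · rw [LinearIsometryEquiv.norm_map, hg2]
    exact LinearMap.mkContinuous_norm_le _ hA _
  · rw [InnerProductSpace.toDual_symm_apply]
    have := hg1 ⟨T v, LinearMap.mem_range_self T v⟩
    rw [LinearMap.mkContinuous_apply, hL'] at this
    exact this.symm

/-- The space of test functions. -/
def testSubmodule (N : ℕ) : Submodule ℝ (Space N → ℝ) where
  carrier := {φ | IsTest φ}
  add_mem' h h' := ⟨h.1.add h'.1, h.2.add h'.2⟩
  zero_mem' := ⟨contDiff_const, HasCompactSupport.zero⟩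
  smul_mem' c _ h := h.const_mul c

theorem multiD_add_fun {N : ℕ} {φ ψ : Space N → ℝ} (hφ : ContDiff ℝ ∞ φ) (hψ : ContDiff ℝ ∞ ψ)
    (α : Fin N → ℕ) : multiD α (φ + ψ) = multiD α φ + multiD α ψ := by
  induction α using multiIndex_induction with
  | zero => simp
  | add_single α i ih =>
    rw [multiD_add_single (φ := φ + ψ) (hφ.add hψ), ih, multiD_add_single hφ, multiD_add_single hψ]
    funext x
    simp [partialD, fderiv_add ((contDiff_multiD hφ α).differentiable (by simp) x)
      ((contDiff_multiD hψ α).differentiable (by simp) x)]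

theorem MemLp.locallyIntegrable_two {N : ℕ} {E : Type*} [NormedAddCommGroup E] {g : Space N → E}
    (h : MemLp g 2 volume) : LocallyIntegrable g :=
  h.locallyIntegrable one_le_two

/-- A distribution derivative which is bounded for the `L²`-norm is a weak derivative in `L²`. -/
theorem exists_hasRealWeakDeriv_of_bound {N : ℕ} {F : Space N → ℝ} (hF : LocallyIntegrable F)
    (α : Fin N → ℕ) {A : ℝ} (hA : 0 ≤ A)
    (h : ∀ φ : Space N → ℝ, IsTest φ →
      |∫ x, multiD α φ x * F x| ≤ A * (eLpNorm φ 2 volume).toReal) :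
    ∃ g, HasRealWeakDeriv α F g ∧ MemLp g 2 volume ∧ eLpNorm g 2 volume ≤ ENNReal.ofReal A := by
  let T : testSubmodule N →ₗ[ℝ] Lp ℝ 2 (volume : Measure (Space N)) :=
    { toFun := fun φ => (IsTest.memLp (show IsTest φ.1 from φ.2) 2).toLp φ.1
      map_add' := fun _ _ => rfl
      map_smul' := fun _ _ => rfl }
  let L : testSubmodule N →ₗ[ℝ] ℝ :=
    { toFun := fun φ => (-1 : ℝ) ^ (∑ i, α i) * ∫ x, multiD α φ.1 x * F x
      map_add' := fun φ ψ => by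
        have hφ : IsTest φ.1 := φ.2
        have hψ : IsTest ψ.1 := ψ.2
        have e : ∀ x, multiD α (φ + ψ).1 x * F x =
            multiD α φ.1 x * F x + multiD α ψ.1 x * F x := fun x => by
          rw [← add_mul]
          exact congrArg (· * F x) (congrFun (multiD_add_fun hφ.1 hψ.1 α) x)
        simp_rw [e]
        have h1 := (hφ.multiDeriv α).integrable_smul hF
        have h2 := (hψ.multiDeriv α).integrable_smul hF
        simp only [smul_eq_mul] at h1 h2
        rw [integral_add h1 h2, mul_add]
      map_smul' := fun c φ => by
        have hφ : IsTest φ.1 := φ.2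
        have e : ∀ x, multiD α (c • φ).1 x * F x = c * (multiD α φ.1 x * F x) := fun x => by
          rw [← mul_assoc]
          exact congrArg (· * F x) (congrFun (multiD_const_mul hφ.1 c α) x)
        simp_rw [e]
        rw [integral_const_mul, RingHom.id_apply, smul_eq_mul]
        ring }
  obtain ⟨g, hg1, hg2⟩ := exists_inner_representation T L hA fun φ => by
    have hφ : IsTest φ.1 := φ.2
    change |(-1 : ℝ) ^ (∑ i, α i) * ∫ x, multiD α φ.1 x * F x| ≤ A * ‖(hφ.memLp 2).toLp φ.1‖
    rw [abs_mul, abs_pow, abs_neg, abs_one, one_pow, one_mul, Lp.norm_toLp]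
    exact h _ hφ
  refine ⟨g, ⟨hF, MemLp.locallyIntegrable_two (Lp.memLp g), fun φ hφ => ?_⟩, Lp.memLp g, ?_⟩
  · have h1 := hg2 ⟨φ, hφ⟩
    change (-1 : ℝ) ^ (∑ i, α i) * ∫ x, multiD α φ x * F x =
      inner ℝ g ((hφ.memLp 2).toLp φ) at h1
    have h2 : inner ℝ g ((hφ.memLp 2).toLp φ) = ∫ x, φ x * g x := by
      rw [L2.inner_def]
      refine integral_congr_ae ?_
      filter_upwards [(hφ.memLp 2).coeFn_toLp] with x hx
      rw [hx]
      simp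
    rw [h2] at h1
    rw [← h1, ← mul_assoc, ← mul_pow]
    norm_num
  · rw [Lp.norm_def] at hg1
    exact (ENNReal.le_ofReal_iff_toReal_le (Lp.eLpNorm_ne_top g) hA).2 hg1

/-- `L²` bounds and almost everywhere convergence give weak convergence, so classical integration by
parts passes to the limit on both sides. -/
theorem hasRealWeakDeriv_of_tendsto {N : ℕ} {F : ℕ → Space N → ℝ} {G H : Space N → ℝ}
    (hF : ∀ n, IsTest (F n)) (α : Fin N → ℕ) {A : ℝ} (hA : 0 ≤ A)
    (h0 : ∀ n, eLpNorm (F n) 2 volume ≤ ENNReal.ofReal A)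
    (h1 : ∀ n, eLpNorm (multiD α (F n)) 2 volume ≤ ENNReal.ofReal A)
    (hG : ∀ᵐ x, Tendsto (fun n => F n x) atTop (𝓝 (G x)))
    (hH : ∀ᵐ x, Tendsto (fun n => multiD α (F n) x) atTop (𝓝 (H x))) :
    HasRealWeakDeriv α G H := by
  have hm0 := fun n => (hF n).1.continuous.aestronglyMeasurable (μ := volume)
  have hm1 := fun n => ((hF n).multiDeriv α).1.continuous.aestronglyMeasurable (μ := volume)
  refine ⟨MemLp.locallyIntegrable_two (eLpNorm_le_of_tendsto_ae hm0 h0 hG).1,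
    MemLp.locallyIntegrable_two (eLpNorm_le_of_tendsto_ae hm1 h1 hH).1, fun φ hφ => ?_⟩
  refine tendsto_nhds_unique
    (tendsto_integral_mul_of_tendsto_ae hA hm0 h0 hG ((hφ.multiDeriv α).memLp 2)) ?_
  have := (tendsto_integral_mul_of_tendsto_ae hA hm1 h1 hH (hφ.memLp 2)).const_mul
    ((-1 : ℝ) ^ (∑ i, α i))
  refine this.congr fun n => ?_
  rw [integral_multiD_mul_eq hφ (hF n).1]

/-- The derivatives need not converge here: the estimate `|∫ ∂^α φ F_n| ≤ A ‖φ‖` survives the limit,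
and duality produces the derivative of the limit together with its bound. -/
theorem exists_hasRealWeakDeriv_of_tendsto {N : ℕ} {F : ℕ → Space N → ℝ} {G : Space N → ℝ}
    (hF : ∀ n, IsTest (F n)) (α : Fin N → ℕ) {A₀ A : ℝ} (hA₀ : 0 ≤ A₀) (hA : 0 ≤ A)
    (h0 : ∀ n, eLpNorm (F n) 2 volume ≤ ENNReal.ofReal A₀)
    (h1 : ∀ n, eLpNorm (multiD α (F n)) 2 volume ≤ ENNReal.ofReal A)
    (hG : ∀ᵐ x, Tendsto (fun n => F n x) atTop (𝓝 (G x))) :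
    ∃ g, HasRealWeakDeriv α G g ∧ MemLp g 2 volume ∧ eLpNorm g 2 volume ≤ ENNReal.ofReal A := by
  have hm0 := fun n => (hF n).1.continuous.aestronglyMeasurable (μ := volume)
  refine exists_hasRealWeakDeriv_of_bound
    (MemLp.locallyIntegrable_two (eLpNorm_le_of_tendsto_ae hm0 h0 hG).1) α hA fun φ hφ => ?_
  refine le_of_tendsto (tendsto_integral_mul_of_tendsto_ae hA₀ hm0 h0 hG
    ((hφ.multiDeriv α).memLp 2)).abs (.of_forall fun n => ?_)
  rw [integral_multiD_mul_eq hφ (hF n).1, abs_mul, abs_pow, abs_neg, abs_one, one_pow, one_mul]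
  have hFα := ((hF n).multiDeriv α).memLp 2
  have h2 : ∫ x, φ x * multiD α (F n) x =
      inner ℝ (hFα.toLp _) ((hφ.memLp 2).toLp φ) := by
    rw [L2.inner_def]
    refine integral_congr_ae ?_
    filter_upwards [(hφ.memLp 2).coeFn_toLp, hFα.coeFn_toLp] with x hx hx'
    rw [hx, hx']
    simp
  rw [h2]
  refine (abs_real_inner_le_norm _ _).trans ?_
  rw [Lp.norm_toLp, Lp.norm_toLp]
  exact mul_le_mul_of_nonneg_right (ENNReal.toReal_le_of_le_ofReal hA (h1 n))
    ENNReal.toReal_nonneg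

/-! ### Mollification and truncation -/

/-- The mollification of `a` by the normalized bump function `η`. -/
noncomputable def mollify {N : ℕ} (η : ContDiffBump (0 : Space N)) (a : Space N → ℝ) :
    Space N → ℝ :=
  convolution (η.normed volume) a (ContinuousLinearMap.lsmul ℝ ℝ) volume

theorem isTest_normed {N : ℕ} (η : ContDiffBump (0 : Space N)) : IsTest (η.normed volume) :=
  ⟨η.contDiff_normed, η.hasCompactSupport_normed⟩

theorem mollify_apply {N : ℕ} (η : ContDiffBump (0 : Space N)) (a : Space N → ℝ) (x : Space N) :
    mollify η a x = ∫ t, η.normed volume t * a (x - t) := rfl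

theorem mollify_apply_swap {N : ℕ} (η : ContDiffBump (0 : Space N)) (a : Space N → ℝ)
    (x : Space N) : mollify η a x = ∫ t, η.normed volume (x - t) * a t := by
  unfold mollify
  rw [convolution_eq_swap]
  rfl

theorem mollify_congr {N : ℕ} (η : ContDiffBump (0 : Space N)) {a b : Space N → ℝ}
    (h : a =ᵐ[volume] b) : mollify η a = mollify η b := by
  funext x
  rw [mollify_apply_swap, mollify_apply_swap]
  exact integral_congr_ae (h.mono fun t ht => by simp only [ht])

theorem contDiff_mollify {N : ℕ} (η : ContDiffBump (0 : Space N)) {a : Space N → ℝ}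
    (ha : LocallyIntegrable a) : ContDiff ℝ ∞ (mollify η a) :=
  (isTest_normed η).2.contDiff_convolution_left _ (isTest_normed η).1 ha

theorem IsTest.comp_const_sub {N : ℕ} {φ : Space N → ℝ} (h : IsTest φ) (x : Space N) :
    IsTest fun t => φ (x - t) :=
  ⟨h.1.comp (contDiff_const.sub contDiff_id), h.2.comp_homeomorph (Homeomorph.subLeft x)⟩

theorem partialD_comp_const_sub {N : ℕ} {φ : Space N → ℝ} (h : ContDiff ℝ ∞ φ) (x : Space N)
    (i : Fin N) : partialD i (fun t => φ (x - t)) = fun t => -partialD i φ (x - t) := by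
  funext t
  have h1 : HasFDerivAt (fun t => φ (x - t)) ((fderiv ℝ φ (x - t)).comp
      (-ContinuousLinearMap.id ℝ (Space N))) t :=
    ((h.differentiable (by simp) (x - t)).hasFDerivAt).comp t ((hasFDerivAt_id t).const_sub x)
  simp [partialD, h1.fderiv]

/-- The derivative falls on the kernel; `t ↦ η(x - t)` is a test function whose derivative in `t`
has the opposite sign, which compensates the sign in the definition of a weak derivative. -/
theorem partialD_mollify {N : ℕ} (η : ContDiffBump (0 : Space N)) {a b : Space N → ℝ} {i : Fin N}
    (h : HasRealWeakDeriv (Pi.single i 1) a b) :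
    partialD i (mollify η a) = mollify η b := by
  funext x
  have hη := isTest_normed η
  have h1 := hη.2.hasFDerivAt_convolution_left (μ := volume) (ContinuousLinearMap.lsmul ℝ ℝ)
    (hη.1.of_le (by simp)) h.1 x
  have h2 : partialD i (mollify η a) x =
      ∫ t, partialD i (η.normed volume) (x - t) * a t := by
    unfold partialD mollify
    rw [h1.fderiv, convolution_def, ContinuousLinearMap.integral_apply]
    · have e := convolution_eq_swap (μ := (volume : Measure (Space N)))
        (f := partialD i (η.normed volume)) (g := a) (x := x) (ContinuousLinearMap.lsmul ℝ ℝ)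
      rw [convolution_def] at e
      exact e
    · exact (hη.2.fderiv (𝕜 := ℝ)).convolutionExists_left _
        (hη.1.continuous_fderiv (by simp)) h.1 x
  rw [h2, mollify_apply_swap]
  have h3 := h.2.2 _ (hη.comp_const_sub x)
  rw [multiD_single (hη.comp_const_sub x).1, partialD_comp_const_sub hη.1] at h3
  simp only [neg_mul, integral_neg, Finset.sum_pi_single', Finset.mem_univ, if_true, pow_one,
    one_mul, neg_inj] at h3
  exact h3

/-- `D` gathers the weak derivatives of order at most `k` of `a`, which lie in `L²`. -/
def HasSobolevDerivs {N : ℕ} (k : ℕ) (a : Space N → ℝ) (D : (Fin N → ℕ) → Space N → ℝ) : Prop :=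
  ∀ α : Fin N → ℕ, ∑ i, α i ≤ k → HasRealWeakDeriv α a (D α) ∧ MemLp (D α) 2 volume

theorem HasSobolevDerivs.locallyIntegrable {N k : ℕ} {a : Space N → ℝ}
    {D : (Fin N → ℕ) → Space N → ℝ} (h : HasSobolevDerivs k a D) : LocallyIntegrable a :=
  (h 0 (by simp)).1.1

theorem HasSobolevDerivs.multiD_mollify {N k : ℕ} {a : Space N → ℝ}
    {D : (Fin N → ℕ) → Space N → ℝ} (h : HasSobolevDerivs k a D)
    (η : ContDiffBump (0 : Space N)) {α : Fin N → ℕ} (hα : ∑ i, α i ≤ k) :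
    multiD α (mollify η a) = mollify η (D α) := by
  induction α using multiIndex_induction with
  | zero => rw [multiD_zero]; exact mollify_congr η (h 0 (by simp)).1.ae_eq_of_zero
  | add_single α i ih =>
    have hα' : ∑ j, α j ≤ k := by rw [sum_add_single] at hα; omega
    rw [multiD_add_single (contDiff_mollify η h.locallyIntegrable), ih hα']
    refine partialD_mollify η ((h α hα').1.of_add ?_)
    rw [add_comm]
    exact (h _ hα).1

theorem lintegral_normed {N : ℕ} (η : ContDiffBump (0 : Space N)) :
    ∫⁻ t, ENNReal.ofReal (η.normed volume t) = 1 := by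
  rw [← ofReal_integral_eq_lintegral_ofReal (isTest_normed η).integrable
    (.of_forall fun t => η.nonneg_normed t), η.integral_normed, ENNReal.ofReal_one]

/-- Jensen's inequality for the probability density `η`, obtained from Cauchy–Schwarz by splitting
`η = η^(1/2) η^(1/2)`. -/
theorem enorm_mollify_sq_le {N : ℕ} (η : ContDiffBump (0 : Space N)) {a : Space N → ℝ}
    (ha : AEStronglyMeasurable a volume) (x : Space N) :
    ‖mollify η a x‖ₑ ^ (2 : ℝ) ≤
      ∫⁻ t, ENNReal.ofReal (η.normed volume t) * ‖a (x - t)‖ₑ ^ (2 : ℝ) := by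
  have hηm : Measurable fun t => ENNReal.ofReal (η.normed volume t) :=
    (isTest_normed η).1.continuous.measurable.ennreal_ofReal
  have ham : AEMeasurable (fun t => ‖a (x - t)‖ₑ) volume :=
    (ha.comp_quasiMeasurePreserving (quasiMeasurePreserving_sub_left volume x)).enorm
  have h1 : ‖mollify η a x‖ₑ ≤ ∫⁻ t, ENNReal.ofReal (η.normed volume t) * ‖a (x - t)‖ₑ := by
    rw [mollify_apply]
    refine (enorm_integral_le_lintegral_enorm _).trans (le_of_eq ?_)
    congr 1
    funext t
    rw [enorm_mul, Real.enorm_of_nonneg (η.nonneg_normed t)]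
  have h2 : ∫⁻ t, ENNReal.ofReal (η.normed volume t) * ‖a (x - t)‖ₑ ≤
      (∫⁻ t, ENNReal.ofReal (η.normed volume t)) ^ (1 / 2 : ℝ) *
      (∫⁻ t, ENNReal.ofReal (η.normed volume t) * ‖a (x - t)‖ₑ ^ (2 : ℝ)) ^ (1 / 2 : ℝ) := by
    have H := ENNReal.lintegral_mul_norm_pow_le (μ := (volume : Measure (Space N)))
      (f := fun t => ENNReal.ofReal (η.normed volume t))
      (g := fun t => ENNReal.ofReal (η.normed volume t) * ‖a (x - t)‖ₑ ^ (2 : ℝ))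
      hηm.aemeasurable (hηm.aemeasurable.mul (ham.pow_const _))
      (p := 1 / 2) (q := 1 / 2) (by norm_num) (by norm_num) (by norm_num)
    refine le_trans (lintegral_mono fun t => le_of_eq ?_) H
    rw [ENNReal.mul_rpow_of_nonneg _ _ (by norm_num), ← ENNReal.rpow_mul, ← mul_assoc,
      ← ENNReal.rpow_add_of_nonneg _ _ (by norm_num) (by norm_num)]
    norm_num
  rw [lintegral_normed, ENNReal.one_rpow, one_mul] at h2
  refine (ENNReal.rpow_le_rpow (h1.trans h2) (by norm_num)).trans (le_of_eq ?_)
  rw [← ENNReal.rpow_mul]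
  norm_num

theorem eLpNorm_mollify_le {N : ℕ} (η : ContDiffBump (0 : Space N)) {a : Space N → ℝ}
    (ha : AEStronglyMeasurable a volume) {A : ℝ} (hA : 0 ≤ A)
    (h : eLpNorm a 2 volume ≤ ENNReal.ofReal A) :
    eLpNorm (mollify η a) 2 volume ≤ ENNReal.ofReal A := by
  refine eLpNorm_le_of_lintegral_enorm_sq_le hA ?_
  have hηm : Measurable fun t => ENNReal.ofReal (η.normed volume t) :=
    (isTest_normed η).1.continuous.measurable.ennreal_ofReal
  refine (lintegral_mono fun x => enorm_mollify_sq_le η ha x).trans ?_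
  rw [lintegral_lintegral_swap]
  · have e : ∀ t, ∫⁻ x, ENNReal.ofReal (η.normed volume t) * ‖a (x - t)‖ₑ ^ (2 : ℝ) =
        ENNReal.ofReal (η.normed volume t) * ∫⁻ x, ‖a x‖ₑ ^ (2 : ℝ) := fun t => by
      rw [lintegral_const_mul' _ _ ENNReal.ofReal_ne_top,
        lintegral_sub_right_eq_self (fun x => ‖a x‖ₑ ^ (2 : ℝ)) t]
    simp_rw [e]
    rw [lintegral_mul_const _ hηm, lintegral_normed, one_mul]
    exact lintegral_enorm_sq_le_of_eLpNorm_le hA h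
  · refine (hηm.comp measurable_snd).aemeasurable.mul (AEMeasurable.pow_const ?_ _)
    exact (ha.comp_quasiMeasurePreserving
      (quasiMeasurePreserving_sub_of_right_invariant volume volume)).enorm

/-- The bump functions used for the mollification. -/
noncomputable def mollifier (N n : ℕ) : ContDiffBump (0 : Space N) where
  rIn := 1 / (n + 1)
  rOut := 2 / (n + 1)
  rIn_pos := by positivity
  rIn_lt_rOut := by gcongr; norm_num

theorem mollify_tendsto {N : ℕ} {a : Space N → ℝ} (ha : LocallyIntegrable a) :
    ∀ᵐ x, Tendsto (fun n => mollify (mollifier N n) a x) atTop (𝓝 (a x)) := by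
  -- The ratio `rOut / rIn` is equal to `2` for all `n`, which is the uniformity required for
  -- convergence at Lebesgue points.
  refine ContDiffBump.ae_convolution_tendsto_right_of_locallyIntegrable (K := 2) ?_ ?_ ha
  · have := (tendsto_one_div_add_atTop_nhds_zero_nat (𝕜 := ℝ)).const_mul 2
    simpa [mollifier, div_eq_mul_inv] using this
  · refine .of_forall fun n => le_of_eq ?_
    simp [mollifier, div_eq_mul_inv]

/-- The cutoff functions `χ(x / (n + 1))`. -/
noncomputable def cutoff (N n : ℕ) (x : Space N) : ℝ :=
  (⟨1, 2, one_pos, one_lt_two⟩ : ContDiffBump (0 : Space N)) (((n : ℝ) + 1)⁻¹ • x)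

theorem cutoff_isTest (N n : ℕ) : IsTest (cutoff N n) := by
  refine ⟨(ContDiffBump.contDiff _).comp (contDiff_const_smul _), ?_⟩
  exact (ContDiffBump.hasCompactSupport _).comp_homeomorph
    (Homeomorph.smulOfNeZero ((n : ℝ) + 1)⁻¹ (by positivity))

theorem cutoff_eventuallyEq_one {N : ℕ} (x : Space N) :
    ∀ᶠ n in atTop, cutoff N n =ᶠ[𝓝 x] fun _ => 1 := by
  obtain ⟨n0, hn0⟩ := exists_nat_gt ‖x‖
  filter_upwards [eventually_ge_atTop n0] with n hn
  have hx : ‖x‖ < n + 1 := hn0.trans_le (by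
    have : (n0 : ℝ) ≤ n := by exact_mod_cast hn
    linarith)
  have : ∀ᶠ y in 𝓝 x, ‖y‖ < n + 1 := continuous_norm.continuousAt.eventually_lt_const hx
  filter_upwards [this] with y hy
  refine ContDiffBump.one_of_mem_closedBall _ ?_
  rw [mem_closedBall_zero_iff, norm_smul, norm_inv, Real.norm_of_nonneg (by positivity),
    inv_mul_le_iff₀ (by positivity)]
  simpa using hy.le

theorem cutoff_mem_Icc {N n : ℕ} (x : Space N) : cutoff N n x ∈ Icc (0 : ℝ) 1 :=
  ⟨ContDiffBump.nonneg _, ContDiffBump.le_one _⟩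

/-- Each derivative of `χ(x/(n+1))` gains a factor `1/(n+1) ≤ 1`, whence bounds uniform in `n`. -/
theorem exists_norm_iteratedFDeriv_cutoff_le (N k : ℕ) :
    ∃ B : ℝ, 0 ≤ B ∧ ∀ n, ∀ i ≤ k, ∀ x, ‖iteratedFDeriv ℝ i (cutoff N n) x‖ ≤ B := by
  set χ : ContDiffBump (0 : Space N) := ⟨1, 2, one_pos, one_lt_two⟩ with hχ
  have h : ∀ i : ℕ, ∃ B, ∀ x, ‖iteratedFDeriv ℝ i χ x‖ ≤ B := fun i =>
    (χ.contDiff.continuous_iteratedFDeriv (n := ∞)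
      (by exact_mod_cast le_top)).bounded_above_of_compact_support
      (χ.hasCompactSupport.iteratedFDeriv i)
  choose B hB using h
  have hB0 : ∀ i, 0 ≤ B i := fun i => (norm_nonneg _).trans (hB i 0)
  refine ⟨∑ i ∈ Finset.range (k + 1), B i, Finset.sum_nonneg fun i _ => hB0 i,
    fun n i hi x => ?_⟩
  have e : cutoff N n = fun x => χ (((n : ℝ) + 1)⁻¹ • x) := rfl
  rw [e, iteratedFDeriv_comp_const_smul _ (χ.contDiff (n := i)), norm_smul, norm_pow, norm_inv,
    Real.norm_of_nonneg (by positivity)]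
  have h1 : (((n : ℝ) + 1)⁻¹) ^ i ≤ 1 :=
    pow_le_one₀ (by positivity) (inv_le_one_of_one_le₀ (by linarith [(Nat.cast_nonneg n : (0:ℝ) ≤ n)]))
  calc _ ≤ 1 * B i := mul_le_mul h1 (hB i _) (norm_nonneg _) zero_le_one
    _ ≤ _ := by
      rw [one_mul]
      exact Finset.single_le_sum (fun i _ => hB0 i) (Finset.mem_range.2 (by omega))

theorem exists_abs_multiD_cutoff_mul_le (N k : ℕ) :
    ∃ C : ℝ, 0 ≤ C ∧ ∀ n, ∀ P : Space N → ℝ, ContDiff ℝ ∞ P → ∀ α : Fin N → ℕ, ∑ i, α i ≤ k →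
      ∀ x, |multiD α (fun x => cutoff N n x * P x) x| ≤
        C * ∑ β ∈ indicesLE N k, |multiD β P x| := by
  obtain ⟨B, hB, h⟩ := exists_norm_iteratedFDeriv_cutoff_le N k
  refine ⟨∑ i ∈ Finset.range (k + 1), (∑ j ∈ Finset.range (k + 1), (j.choose i : ℝ)) * B *
    ((N : ℝ) + 1) ^ k, by positivity, fun n P hP α hα x => ?_⟩
  have hN : (1 : ℝ) ≤ N + 1 := by linarith [(Nat.cast_nonneg N : (0 : ℝ) ≤ N)]
  refine (abs_multiD_le_norm_iteratedFDeriv ((cutoff_isTest N n).1.mul hP) α x).trans ?_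
  set m := ∑ i, α i
  refine (norm_iteratedFDeriv_mul_le (N := ∞) (cutoff_isTest N n).1 hP x (n := m)
    (by exact_mod_cast le_top)).trans ?_
  rw [Finset.sum_mul]
  have hS : 0 ≤ ∑ β ∈ indicesLE N k, |multiD β P x| := Finset.sum_nonneg fun _ _ => abs_nonneg _
  refine (Finset.sum_le_sum fun i hi => ?_).trans
    (Finset.sum_le_sum_of_subset_of_nonneg (Finset.range_subset_range.2 (by omega : m + 1 ≤ k + 1))
      fun i _ _ => by positivity)
  rw [Finset.mem_range] at hi
  have h1 : ‖iteratedFDeriv ℝ (m - i) P x‖ ≤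
      ((N : ℝ) + 1) ^ k * ∑ β ∈ indicesLE N k, |multiD β P x| := by
    refine (norm_iteratedFDeriv_le_sum hP _ x).trans (mul_le_mul ?_ ?_
      (Finset.sum_nonneg fun _ _ => abs_nonneg _) (by positivity))
    · exact (pow_le_pow_left₀ (by positivity) (by linarith) _).trans
        (pow_le_pow_right₀ hN (by omega))
    · refine Finset.sum_le_sum_of_subset_of_nonneg (fun β hβ => ?_) fun _ _ _ => abs_nonneg _
      rw [mem_indicesLE, mem_indices.1 hβ]; omega
  have h2 : (m.choose i : ℝ) ≤ ∑ j ∈ Finset.range (k + 1), (j.choose i : ℝ) :=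
    Finset.single_le_sum (f := fun j => ((j.choose i : ℕ) : ℝ)) (fun _ _ => by positivity)
      (Finset.mem_range.2 (by omega))
  calc (m.choose i : ℝ) * ‖iteratedFDeriv ℝ i (cutoff N n) x‖ * ‖iteratedFDeriv ℝ (m - i) P x‖
      ≤ (∑ j ∈ Finset.range (k + 1), (j.choose i : ℝ)) * B *
        (((N : ℝ) + 1) ^ k * ∑ β ∈ indicesLE N k, |multiD β P x|) := by
        gcongr
        exact h n i (by omega) x
    _ = _ := by ring

/-- The regularization of `a` by mollification and truncation. -/
noncomputable def regularize {N : ℕ} (n : ℕ) (a : Space N → ℝ) (x : Space N) : ℝ :=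
  cutoff N n x * mollify (mollifier N n) a x

theorem regularize_isTest {N : ℕ} (n : ℕ) {a : Space N → ℝ} (ha : LocallyIntegrable a) :
    IsTest (regularize n a) :=
  ⟨(cutoff_isTest N n).1.mul (contDiff_mollify _ ha), (cutoff_isTest N n).2.mul_right⟩

theorem eLpNorm_multiD_regularize_le (N k : ℕ) :
    ∃ C : ℝ, 0 ≤ C ∧ ∀ (a : Space N → ℝ) (D : (Fin N → ℕ) → Space N → ℝ),
      HasSobolevDerivs k a D → ∀ A : ℝ, 0 ≤ A →
      (∀ α : Fin N → ℕ, ∑ i, α i ≤ k → eLpNorm (D α) 2 volume ≤ ENNReal.ofReal A) →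
      ∀ n, ∀ α : Fin N → ℕ, ∑ i, α i ≤ k →
        eLpNorm (multiD α (regularize n a)) 2 volume ≤ ENNReal.ofReal (C * A) := by
  obtain ⟨C, hC, h⟩ := exists_abs_multiD_cutoff_mul_le N k
  refine ⟨C * (indicesLE N k).card, by positivity, fun a D hD A hA hDA n α hα => ?_⟩
  have hP := contDiff_mollify (mollifier N n) hD.locallyIntegrable
  have h1 := eLpNorm_le_mul_eLpNorm_of_ae_le_mul (μ := (volume : Measure (Space N)))
    (f := multiD α (regularize n a))
    (g := ∑ β ∈ indicesLE N k, fun x => |multiD β (mollify (mollifier N n) a) x|) (c := C)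
    (.of_forall fun x => by
      rw [Real.norm_eq_abs, Real.norm_eq_abs, Finset.sum_apply]
      exact (h n _ hP α hα x).trans (mul_le_mul_of_nonneg_left (le_abs_self _) hC)) 2
  refine h1.trans ?_
  have h2 : eLpNorm (∑ β ∈ indicesLE N k, fun x => |multiD β (mollify (mollifier N n) a) x|) 2
      volume ≤ ∑ β ∈ indicesLE N k, ENNReal.ofReal A := by
    refine (eLpNorm_sum_le (fun β _ =>
      (contDiff_multiD hP β).continuous.abs.aestronglyMeasurable) one_le_two).trans
      (Finset.sum_le_sum fun β hβ => ?_)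
    rw [mem_indicesLE] at hβ
    have e : eLpNorm (fun x => |multiD β (mollify (mollifier N n) a) x|) 2 volume =
        eLpNorm (multiD β (mollify (mollifier N n) a)) 2 volume :=
      eLpNorm_norm (multiD β (mollify (mollifier N n) a))
    rw [e, hD.multiD_mollify _ hβ]
    exact eLpNorm_mollify_le _ (hD β hβ).2.1 hA (hDA β hβ)
  refine (mul_le_mul_right h2 _).trans (le_of_eq ?_)
  rw [Finset.sum_const, nsmul_eq_mul, ← ENNReal.ofReal_natCast, ← ENNReal.ofReal_mul (by positivity),
    ← ENNReal.ofReal_mul hC, mul_assoc]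

/-- Near a fixed `x` the cutoff is eventually equal to one, so no derivative hits it, and what
remains is the mollification of `D α`. -/
theorem multiD_regularize_tendsto {N k : ℕ} {a : Space N → ℝ} {D : (Fin N → ℕ) → Space N → ℝ}
    (hD : HasSobolevDerivs k a D) {α : Fin N → ℕ} (hα : ∑ i, α i ≤ k) :
    ∀ᵐ x, Tendsto (fun n => multiD α (regularize n a) x) atTop (𝓝 (D α x)) := by
  filter_upwards [mollify_tendsto (hD α hα).1.2.1] with x hx
  refine hx.congr' ?_
  filter_upwards [cutoff_eventuallyEq_one x] with n hn
  have hP := contDiff_mollify (mollifier N n) hD.locallyIntegrable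
  rw [← hD.multiD_mollify _ hα]
  refine (multiD_congr_of_eventuallyEq (regularize_isTest n hD.locallyIntegrable).1 hP ?_ α).symm
  filter_upwards [hn] with y hy
  rw [regularize, hy, one_mul]

/-- The disc of radius `m` is convex and mollification is an average. Concretely, pairing the
averaged vector `(c, d)` with itself gives `c² + d² ≤ m √(c² + d²)`. This keeps the regularized
functions where the square root is smooth. -/
theorem sq_add_sq_mollify_le {N : ℕ} (η : ContDiffBump (0 : Space N)) {a b : Space N → ℝ}
    (ha : LocallyIntegrable a) (hb : LocallyIntegrable b) {m : ℝ} (hm : 0 ≤ m)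
    (h : ∀ᵐ x, a x ^ 2 + b x ^ 2 ≤ m ^ 2) (x : Space N) :
    mollify η a x ^ 2 + mollify η b x ^ 2 ≤ m ^ 2 := by
  set c := mollify η a x with hc
  set d := mollify η b x with hd
  have hη := (isTest_normed η).comp_const_sub x
  have hia := (hη.integrable_smul ha).mul_const c
  have hib := (hη.integrable_smul hb).mul_const d
  simp only [smul_eq_mul] at hia hib
  have h1 : c ^ 2 + d ^ 2 = ∫ t, (η.normed volume (x - t) * a t * c +
      η.normed volume (x - t) * b t * d) := by
    rw [integral_add hia hib, integral_mul_const, integral_mul_const, ← mollify_apply_swap,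
      ← mollify_apply_swap, ← hc, ← hd]
    ring
  have h2 : ∫ t, (η.normed volume (x - t) * a t * c + η.normed volume (x - t) * b t * d) ≤
      ∫ t, η.normed volume (x - t) * (m * Real.sqrt (c ^ 2 + d ^ 2)) := by
    refine integral_mono_ae (hia.add hib) (hη.integrable.mul_const _) ?_
    filter_upwards [h] with t ht
    have h3 : a t * c + b t * d ≤ m * Real.sqrt (c ^ 2 + d ^ 2) := by
      refine le_trans (Real.le_sqrt_of_sq_le ?_)
        (le_of_eq (by rw [Real.sqrt_mul (sq_nonneg m), Real.sqrt_sq hm]) :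
          Real.sqrt (m ^ 2 * (c ^ 2 + d ^ 2)) ≤ _)
      refine le_trans ?_ (mul_le_mul_of_nonneg_right ht (by positivity))
      nlinarith [sq_nonneg (a t * d - b t * c)]
    have := mul_le_mul_of_nonneg_left h3 (η.nonneg_normed (x - t) (μ := volume))
    linarith
  rw [← h1, integral_mul_const, integral_sub_left_eq_self (fun t => η.normed volume t),
    η.integral_normed, one_mul] at h2
  have h4 : 0 ≤ c ^ 2 + d ^ 2 := by positivity
  have h5 := Real.sq_sqrt h4
  set r := Real.sqrt (c ^ 2 + d ^ 2)
  have hr : 0 ≤ r := Real.sqrt_nonneg _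
  rw [← h5] at h2 ⊢
  rcases hr.eq_or_lt with h6 | h6
  · rw [h6.symm.trans rfl, zero_pow two_ne_zero]; positivity
  · have : r ≤ m := by
      by_contra! hlt
      nlinarith
    exact pow_le_pow_left₀ hr this 2

theorem sq_add_sq_regularize_le {N : ℕ} {a b : Space N → ℝ}
    (ha : LocallyIntegrable a) (hb : LocallyIntegrable b) {m : ℝ} (hm : 0 ≤ m)
    (h : ∀ᵐ x, a x ^ 2 + b x ^ 2 ≤ m ^ 2) (n : ℕ) (x : Space N) :
    regularize n a x ^ 2 + regularize n b x ^ 2 ≤ m ^ 2 := by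
  have h1 := sq_add_sq_mollify_le (mollifier N n) ha hb hm h x
  obtain ⟨h2, h3⟩ := cutoff_mem_Icc (n := n) x
  unfold regularize
  rw [mul_pow, mul_pow, ← mul_add]
  have : cutoff N n x ^ 2 ≤ 1 := pow_le_one₀ h2 h3
  calc _ ≤ 1 * m ^ 2 := mul_le_mul this h1 (by positivity) zero_le_one
    _ = m ^ 2 := one_mul _

/-! ### The Sobolev norms -/

theorem hNorm_eq {N : ℕ} (k : ℕ) (f : Space N → ℂ) :
    hNorm k f = Real.sqrt (∑ α ∈ indicesLE N k, (eLpNorm (weakDeriv α f) 2 volume).toReal ^ 2) := by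
  unfold hNorm indicesLE
  rw [Finset.sum_biUnion]
  · rfl
  · intro i _ j _ hij
    rw [Function.onFun, Finset.disjoint_left]
    intro α hi hj
    exact hij ((mem_indices.1 hi).symm.trans (mem_indices.1 hj))

theorem hNorm_nonneg {N : ℕ} (k : ℕ) (f : Space N → ℂ) : 0 ≤ hNorm k f := Real.sqrt_nonneg _

theorem MemH.hasWeakDeriv {N k : ℕ} {f : Space N → ℂ} (h : MemH k f) {α : Fin N → ℕ}
    (hα : ∑ i, α i ≤ k) : HasWeakDeriv α f (weakDeriv α f) := by
  obtain ⟨g, hg, _⟩ := h α hα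
  exact hg.congr .rfl hg.weakDeriv_ae_eq.symm

theorem MemH.memLp_weakDeriv {N k : ℕ} {f : Space N → ℂ} (h : MemH k f) {α : Fin N → ℕ}
    (hα : ∑ i, α i ≤ k) : MemLp (weakDeriv α f) 2 volume := by
  obtain ⟨g, hg, hgL⟩ := h α hα
  exact hgL.ae_eq hg.weakDeriv_ae_eq.symm

theorem MemH.mono {N k l : ℕ} {f : Space N → ℂ} (h : MemH k f) (hl : l ≤ k) : MemH l f :=
  fun α hα => h α (hα.trans hl)

theorem HasWeakDeriv.zero {N : ℕ} {f : Space N → ℂ} (hf : LocallyIntegrable f) :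
    HasWeakDeriv 0 f f :=
  ⟨hf, hf, fun φ _ => by simp⟩

theorem MemH.locallyIntegrable {N k : ℕ} {f : Space N → ℂ} (h : MemH k f) :
    LocallyIntegrable f := (h.hasWeakDeriv (α := 0) (by simp)).1

theorem MemH.weakDeriv_zero_ae_eq {N k : ℕ} {f : Space N → ℂ} (h : MemH k f) :
    weakDeriv 0 f =ᵐ[volume] f :=
  (HasWeakDeriv.zero h.locallyIntegrable).weakDeriv_ae_eq

theorem MemH.eLpNorm_weakDeriv_le {N k : ℕ} {f : Space N → ℂ} (h : MemH k f) {α : Fin N → ℕ}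
    (hα : ∑ i, α i ≤ k) : eLpNorm (weakDeriv α f) 2 volume ≤ ENNReal.ofReal (hNorm k f) := by
  rw [ENNReal.le_ofReal_iff_toReal_le (h.memLp_weakDeriv hα).eLpNorm_ne_top (hNorm_nonneg _ _),
    hNorm_eq]
  refine Real.le_sqrt_of_sq_le ?_
  exact Finset.single_le_sum (f := fun α => (eLpNorm (weakDeriv α f) 2 volume).toReal ^ 2)
    (fun _ _ => sq_nonneg _) (mem_indicesLE.2 hα)

theorem hNorm_le_of_eLpNorm_le {N k : ℕ} {f : Space N → ℂ} {A : ℝ} (hA : 0 ≤ A)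
    (h : ∀ α : Fin N → ℕ, ∑ i, α i ≤ k → eLpNorm (weakDeriv α f) 2 volume ≤ ENNReal.ofReal A) :
    hNorm k f ≤ (indicesLE N k).card * A := by
  rw [hNorm_eq, Real.sqrt_le_iff]
  refine ⟨by positivity, ?_⟩
  refine (Finset.sum_le_sum fun α hα => pow_le_pow_left₀ ENNReal.toReal_nonneg
    (ENNReal.toReal_le_of_le_ofReal hA (h α (mem_indicesLE.1 hα))) 2).trans ?_
  rw [Finset.sum_const, nsmul_eq_mul, mul_pow]
  refine mul_le_mul_of_nonneg_right ?_ (sq_nonneg A)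
  have : (1 : ℝ) ≤ (indicesLE N k).card := by
    have : 0 < (indicesLE N k).card := Finset.card_pos.2 ⟨0, mem_indicesLE.2 (by simp)⟩
    exact_mod_cast this
  nlinarith

theorem hNorm_mono {N k l : ℕ} (f : Space N → ℂ) (hl : l ≤ k) : hNorm l f ≤ hNorm k f := by
  rw [hNorm_eq, hNorm_eq]
  refine Real.sqrt_le_sqrt (Finset.sum_le_sum_of_subset_of_nonneg (fun α hα => ?_)
    fun _ _ _ => sq_nonneg _)
  rw [mem_indicesLE] at *
  omega

theorem HasWeakDeriv.sub {N : ℕ} {α : Fin N → ℕ} {f g f' g' : Space N → ℂ}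
    (h : HasWeakDeriv α f g) (h' : HasWeakDeriv α f' g') : HasWeakDeriv α (f - f') (g - g') := by
  refine ⟨h.1.sub h'.1, h.2.1.sub h'.2.1, fun φ hφ => ?_⟩
  simp only [Pi.sub_apply, smul_sub]
  rw [integral_sub ((hφ.multiDeriv α).integrable_smul h.1)
    ((hφ.multiDeriv α).integrable_smul h'.1), integral_sub (hφ.integrable_smul h.2.1)
    (hφ.integrable_smul h'.2.1), h.2.2 φ hφ, h'.2.2 φ hφ, mul_sub]

theorem MemH.sub {N k : ℕ} {f g : Space N → ℂ} (hf : MemH k f) (hg : MemH k g) :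
    MemH k (f - g) := fun _ hα =>
  ⟨_, (hf.hasWeakDeriv hα).sub (hg.hasWeakDeriv hα),
    (hf.memLp_weakDeriv hα).sub (hg.memLp_weakDeriv hα)⟩

theorem MemH.weakDeriv_sub_ae_eq {N k : ℕ} {f g : Space N → ℂ} (hf : MemH k f) (hg : MemH k g)
    {α : Fin N → ℕ} (hα : ∑ i, α i ≤ k) :
    weakDeriv α (f - g) =ᵐ[volume] weakDeriv α f - weakDeriv α g :=
  ((hf.hasWeakDeriv hα).sub (hg.hasWeakDeriv hα)).weakDeriv_ae_eq

theorem sqrt_sum_add_sq_le {ι : Type*} (T : Finset ι) {x y z : ι → ℝ} (hx : ∀ i ∈ T, 0 ≤ x i)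
    (hy : ∀ i ∈ T, 0 ≤ y i) (hz : ∀ i ∈ T, 0 ≤ z i) (h : ∀ i ∈ T, x i ≤ y i + z i) :
    Real.sqrt (∑ i ∈ T, x i ^ 2) ≤
      Real.sqrt (∑ i ∈ T, y i ^ 2) + Real.sqrt (∑ i ∈ T, z i ^ 2) := by
  have h1 := Real.Lp_add_le_of_nonneg T (p := 2) one_le_two hy hz
  simp only [Real.rpow_ofNat, ← Real.sqrt_eq_rpow] at h1
  exact (Real.sqrt_le_sqrt (Finset.sum_le_sum fun i hi =>
    pow_le_pow_left₀ (hx i hi) (h i hi) 2)).trans h1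

theorem hNorm_sub_le {N k : ℕ} {f g : Space N → ℂ} (hf : MemH k f) (hg : MemH k g) :
    hNorm k (f - g) ≤ hNorm k f + hNorm k g := by
  rw [hNorm_eq, hNorm_eq, hNorm_eq]
  refine sqrt_sum_add_sq_le _ (fun _ _ => ENNReal.toReal_nonneg)
    (fun _ _ => ENNReal.toReal_nonneg) (fun _ _ => ENNReal.toReal_nonneg) fun α hα => ?_
  rw [mem_indicesLE] at hα
  have h1 := hf.memLp_weakDeriv hα
  have h2 := hg.memLp_weakDeriv hα
  rw [eLpNorm_congr_ae (hf.weakDeriv_sub_ae_eq hg hα),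
    ← ENNReal.toReal_add h1.eLpNorm_ne_top h2.eLpNorm_ne_top]
  exact ENNReal.toReal_mono (ENNReal.add_ne_top.2 ⟨h1.eLpNorm_ne_top, h2.eLpNorm_ne_top⟩)
    (eLpNorm_sub_le h1.1 h2.1 one_le_two)

theorem hNorm_le_add_hNorm_sub {N k : ℕ} {f g : Space N → ℂ} (hf : MemH k f) (hg : MemH k g) :
    hNorm k f ≤ hNorm k g + hNorm k (f - g) := by
  rw [hNorm_eq, hNorm_eq, hNorm_eq]
  refine sqrt_sum_add_sq_le _ (fun _ _ => ENNReal.toReal_nonneg)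
    (fun _ _ => ENNReal.toReal_nonneg) (fun _ _ => ENNReal.toReal_nonneg) fun α hα => ?_
  rw [mem_indicesLE] at hα
  have h1 := hg.memLp_weakDeriv hα
  have h2 := (hf.sub hg).memLp_weakDeriv hα
  rw [← ENNReal.toReal_add h1.eLpNorm_ne_top h2.eLpNorm_ne_top]
  refine ENNReal.toReal_mono (ENNReal.add_ne_top.2 ⟨h1.eLpNorm_ne_top, h2.eLpNorm_ne_top⟩) ?_
  refine le_trans (le_of_eq (eLpNorm_congr_ae ?_)) (eLpNorm_add_le h1.1 h2.1 one_le_two)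
  filter_upwards [hf.weakDeriv_sub_ae_eq hg hα] with x hx
  simp [hx]

theorem MemH.hasSobolevDerivs_re {N k : ℕ} {f : Space N → ℂ} (h : MemH k f) :
    HasSobolevDerivs k (fun x => (f x).re) fun α x => (weakDeriv α f x).re :=
  fun _ hα => ⟨(h.hasWeakDeriv hα).re, (h.memLp_weakDeriv hα).re⟩

theorem MemH.hasSobolevDerivs_im {N k : ℕ} {f : Space N → ℂ} (h : MemH k f) :
    HasSobolevDerivs k (fun x => (f x).im) fun α x => (weakDeriv α f x).im :=
  fun _ hα => ⟨(h.hasWeakDeriv hα).im, (h.memLp_weakDeriv hα).im⟩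

theorem eLpNorm_re_le {N : ℕ} (f : Space N → ℂ) :
    eLpNorm (fun x => (f x).re) 2 volume ≤ eLpNorm f 2 volume :=
  eLpNorm_mono fun x => Complex.abs_re_le_norm (f x)

theorem eLpNorm_im_le {N : ℕ} (f : Space N → ℂ) :
    eLpNorm (fun x => (f x).im) 2 volume ≤ eLpNorm f 2 volume :=
  eLpNorm_mono fun x => Complex.abs_im_le_norm (f x)

/-- All weak derivatives of order at most `s` of the real-valued function `F` have `L²`-norm
at most `A`. -/
def RealHBound {N : ℕ} (s : ℕ) (A : ℝ) (F : Space N → ℝ) : Prop :=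
  ∀ α : Fin N → ℕ, ∑ i, α i ≤ s →
    ∃ g, HasRealWeakDeriv α F g ∧ MemLp g 2 volume ∧ eLpNorm g 2 volume ≤ ENNReal.ofReal A

/-! ### Elementary operations on real-valued functions bounded in `H^s`. -/

theorem RealHBound.congr {N s : ℕ} {A : ℝ} {F G : Space N → ℝ} (h : RealHBound s A F)
    (hFG : F =ᵐ[volume] G) : RealHBound s A G := fun α hα => by
  obtain ⟨g, h1, h2⟩ := h α hα
  exact ⟨g, h1.congr hFG .rfl, h2⟩

theorem RealHBound.mono {N s : ℕ} {A B : ℝ} {F : Space N → ℝ} (h : RealHBound s A F)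
    (hAB : A ≤ B) : RealHBound s B F := fun α hα => by
  obtain ⟨g, h1, h2, h3⟩ := h α hα
  exact ⟨g, h1, h2, h3.trans (ENNReal.ofReal_le_ofReal hAB)⟩

theorem RealHBound.add {N s : ℕ} {A B : ℝ} {F G : Space N → ℝ} (hA : 0 ≤ A) (hB : 0 ≤ B)
    (hF : RealHBound s A F) (hG : RealHBound s B G) :
    RealHBound s (A + B) fun x => F x + G x := fun α hα => by
  obtain ⟨f, h1, h2, h3⟩ := hF α hα
  obtain ⟨g, h1', h2', h3'⟩ := hG α hα
  refine ⟨f + g, ⟨h1.1.add h1'.1, h1.2.1.add h1'.2.1, fun φ hφ => ?_⟩, h2.add h2', ?_⟩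
  · have i1 := (hφ.multiDeriv α).integrable_smul h1.1
    have i2 := (hφ.multiDeriv α).integrable_smul h1'.1
    have i3 := hφ.integrable_smul h1.2.1
    have i4 := hφ.integrable_smul h1'.2.1
    simp only [smul_eq_mul] at i1 i2 i3 i4
    simp only [Pi.add_apply, mul_add]
    rw [integral_add i1 i2, integral_add i3 i4, h1.2.2 φ hφ, h1'.2.2 φ hφ, mul_add]
  · rw [ENNReal.ofReal_add hA hB]
    exact (eLpNorm_add_le h2.1 h2'.1 one_le_two).trans (add_le_add h3 h3')

theorem RealHBound.const_mul {N s : ℕ} {A c : ℝ} {F : Space N → ℝ} (hc : 0 ≤ c)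
    (hF : RealHBound s A F) : RealHBound s (c * A) fun x => c * F x := fun α hα => by
  obtain ⟨f, h1, h2, h3⟩ := hF α hα
  refine ⟨fun x => c * f x, ⟨h1.1.smul c, h1.2.1.smul c, fun φ hφ => ?_⟩, h2.const_mul c, ?_⟩
  · simp_rw [mul_left_comm _ c]
    rw [integral_const_mul, integral_const_mul, h1.2.2 φ hφ]
    ring
  · have := eLpNorm_const_smul (μ := (volume : Measure (Space N))) (p := 2) c f
    change eLpNorm (c • f) 2 volume ≤ _
    rw [this, Real.enorm_of_nonneg hc, ENNReal.ofReal_mul hc]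
    exact mul_le_mul_right h3 _

theorem RealHBound.zero (N s : ℕ) {A : ℝ} : RealHBound (N := N) s A fun _ => 0 := fun α _ =>
  ⟨0, ⟨locallyIntegrable_zero, locallyIntegrable_zero, fun φ _ => by simp⟩, MemLp.zero', by simp⟩

theorem RealHBound.sum {N s : ℕ} {ι : Type*} (T : Finset ι) {A : ℝ} (hA : 0 ≤ A)
    {F : ι → Space N → ℝ} (hF : ∀ i ∈ T, RealHBound s A (F i)) :
    RealHBound s (T.card * A) fun x => ∑ i ∈ T, F i x := by
  classical
  induction T using Finset.induction with
  | empty =>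
    simp only [Finset.sum_empty]
    exact RealHBound.zero N s
  | insert j T hj ih =>
    have hTA : (0 : ℝ) ≤ T.card * A := mul_nonneg (Nat.cast_nonneg _) hA
    have h1 : RealHBound s (A + T.card * A) fun x => F j x + ∑ i ∈ T, F i x :=
      RealHBound.add hA hTA (hF j (Finset.mem_insert_self j T))
        (ih fun i hi => hF i (Finset.mem_insert_of_mem hi))
    simp only [Finset.sum_insert hj, Finset.card_insert_of_notMem hj]
    refine h1.mono (le_of_eq ?_)
    rw [Nat.cast_add, Nat.cast_one]
    ring

theorem memH_of_realHBound {N s : ℕ} {A : ℝ} (hA : 0 ≤ A) {f : Space N → ℂ}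
    (hr : RealHBound s A fun x => (f x).re) (hi : RealHBound s A fun x => (f x).im) :
    MemH s f ∧ hNorm s f ≤ (indicesLE N s).card * (2 * A) := by
  have key : ∀ α : Fin N → ℕ, ∑ i, α i ≤ s → ∃ g, HasWeakDeriv α f g ∧ MemLp g 2 volume ∧
      eLpNorm g 2 volume ≤ ENNReal.ofReal (2 * A) := fun α hα => by
    obtain ⟨a, h1, h2, h3⟩ := hr α hα
    obtain ⟨b, h1', h2', h3'⟩ := hi α hα
    have m1 : MemLp (fun x => (a x : ℂ)) 2 volume := MemLp.ofReal (K := ℂ) h2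
    have m2 : MemLp (fun x => Complex.I * (b x : ℂ)) 2 volume :=
      MemLp.const_mul (MemLp.ofReal (K := ℂ) h2') Complex.I
    refine ⟨fun x => (a x : ℂ) + Complex.I * (b x : ℂ), ?_, MemLp.add m1 m2, ?_⟩
    · refine HasWeakDeriv.of_re_im ?_ ?_
      · simpa using h1
      · simpa using h1'
    · refine (eLpNorm_add_le m1.1 m2.1 one_le_two).trans ?_
      rw [two_mul, ENNReal.ofReal_add hA hA]
      refine add_le_add (le_trans (le_of_eq (eLpNorm_congr_norm_ae (.of_forall fun x => ?_))) h3)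
        (le_trans (le_of_eq (eLpNorm_congr_norm_ae (.of_forall fun x => ?_))) h3')
      · simp
      · simp
  refine ⟨fun α hα => ?_, hNorm_le_of_eLpNorm_le (by positivity) fun α hα => ?_⟩
  · obtain ⟨g, h1, h2, _⟩ := key α hα
    exact ⟨g, h1, h2⟩
  · obtain ⟨g, h1, _, h3⟩ := key α hα
    rwa [eLpNorm_congr_ae h1.weakDeriv_ae_eq]

/-! ### Nonlinear functions of Sobolev functions -/

/-- `w` is the limit of the test functions `wn`, with values in `[-1, 1]` and bounded in `H^s`. -/
def IsApproximation {N : ℕ} (s : ℕ) (A : ℝ) (wn : ℕ → Space N → ℝ) (w : Space N → ℝ) : Prop :=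
  (∀ n, IsTest (wn n)) ∧ (∀ n x, |wn n x| ≤ 1) ∧
    (∀ n, ∀ β : Fin N → ℕ, ∑ i, β i ≤ s →
      eLpNorm (multiD β (wn n)) 2 volume ≤ ENNReal.ofReal A) ∧
    ∀ᵐ x, Tendsto (fun n => wn n x) atTop (𝓝 (w x))

theorem IsApproximation.mono {N s : ℕ} {A B : ℝ} {wn : ℕ → Space N → ℝ} {w : Space N → ℝ}
    (h : IsApproximation s A wn w) (hAB : A ≤ B) : IsApproximation s B wn w :=
  ⟨h.1, h.2.1, fun n β hβ => (h.2.2.1 n β hβ).trans (ENNReal.ofReal_le_ofReal hAB), h.2.2.2⟩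

/-- The Moser bounds of the approximations pass to the limit by duality; almost everywhere
convergence of the `w` themselves is enough. -/
theorem realHBound_comp (N s : ℕ) {ι : Type*} [Fintype ι] {G : (ι → ℝ) → ℝ}
    (hG : ContDiff ℝ ∞ G) (hG0 : G 0 = 0) :
    ∃ C : ℝ, 0 ≤ C ∧ ∀ (wn : ι → ℕ → Space N → ℝ) (w : ι → Space N → ℝ) (A : ℝ), 0 ≤ A →
      (∀ c, IsApproximation s A (wn c) (w c)) →
      RealHBound s (C * A) fun x => G fun c => w c x := by
  obtain ⟨C, hC, h⟩ := moser N s hG hG0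
  refine ⟨C, hC, fun wn w A hA hw α hα => ?_⟩
  have hb := fun n => h (fun c => wn c n) (fun c => (hw c).1 n) (fun c => (hw c).2.1 n) A hA
    fun c => (hw c).2.2.1 n
  refine exists_hasRealWeakDeriv_of_tendsto (F := fun n x => G fun c => wn c n x)
    (fun n => IsTest.comp (fun c => (hw c).1 n) hG hG0) α
    (by positivity : 0 ≤ C * A) (by positivity) (fun n => ?_) (fun n => hb n α hα) ?_
  · simpa using hb n 0 (by simp)
  · have : ∀ᵐ x, ∀ c, Tendsto (fun n => wn c n x) atTop (𝓝 (w c x)) :=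
      ae_all_iff.2 fun c => (hw c).2.2.2
    filter_upwards [this] with x hx
    exact (hG.continuous.tendsto _).comp (tendsto_pi_nhds.2 hx)

/-- Dividing by `C * M` normalizes both the sup norm, through the Sobolev embedding, and the `H^s`
bound. The `j` extra derivatives leave `s` of them for each `∂^β` with `|β| ≤ j`. The constant
combines those of the regularization and of the embedding. -/
theorem exists_isApproximation (N s j : ℕ) (hs : N < 2 * s) :
    ∃ C : ℝ, 1 ≤ C ∧ ∀ (a : Space N → ℝ) (D : (Fin N → ℕ) → Space N → ℝ) (M : ℝ), 0 < M →
      HasSobolevDerivs (s + j) a D →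
      (∀ α : Fin N → ℕ, ∑ i, α i ≤ s + j → eLpNorm (D α) 2 volume ≤ ENNReal.ofReal M) →
      (∀ β : Fin N → ℕ, ∑ i, β i ≤ j →
        IsApproximation s 1 (fun n x => (C * M)⁻¹ * multiD β (regularize n a) x)
          fun x => (C * M)⁻¹ * D β x) ∧
      ∀ n, ∀ β : Fin N → ℕ, ∑ i, β i ≤ s + j →
        eLpNorm (multiD β (regularize n a)) 2 volume ≤ ENNReal.ofReal (C * M) := by
  obtain ⟨C₁, hC₁, h1⟩ := eLpNorm_multiD_regularize_le N (s + j)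
  obtain ⟨C₂, hC₂, h2⟩ := sobolev_test N s hs
  have hCpos : 0 < (C₁ + 1) * (C₂ + 1) := by positivity
  refine ⟨(C₁ + 1) * (C₂ + 1), by nlinarith, fun a D M hM hD hDM => ?_⟩
  have hle : C₁ * M ≤ (C₁ + 1) * M := by nlinarith
  have hle2 : (C₁ + 1) * M ≤ (C₁ + 1) * (C₂ + 1) * M := by
    have : 0 ≤ (C₁ + 1) * C₂ * M := by positivity
    nlinarith
  have hb := h1 a D hD M hM.le hDM
  refine ⟨fun β hβ => ?_, fun n β hβ =>
    (hb n β hβ).trans (ENNReal.ofReal_le_ofReal (hle.trans hle2))⟩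
  have hreg := fun n => regularize_isTest n hD.locallyIntegrable
  have hb' : ∀ n, ∀ γ : Fin N → ℕ, ∑ i, γ i ≤ s →
      eLpNorm (multiD γ (multiD β (regularize n a))) 2 volume ≤
        ENNReal.ofReal ((C₁ + 1) * M) := fun n γ hγ => by
    rw [← multiD_add (hreg n).1]
    refine (hb n _ ?_).trans (ENNReal.ofReal_le_ofReal hle)
    simp only [Pi.add_apply, Finset.sum_add_distrib]
    omega
  refine ⟨fun n => ((hreg n).multiDeriv β).const_mul _, fun n x => ?_, fun n γ hγ => ?_, ?_⟩
  · have := h2 _ ((hreg n).multiDeriv β) ((C₁ + 1) * M) (by positivity) (hb' n) x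
    rw [abs_mul, abs_inv, abs_of_pos (by positivity : 0 < (C₁ + 1) * (C₂ + 1) * M),
      inv_mul_le_iff₀ (by positivity), mul_one]
    refine this.trans ?_
    have : 0 ≤ (C₁ + 1) * M := by positivity
    nlinarith
  · rw [multiD_const_mul ((hreg n).multiDeriv β).1]
    have := eLpNorm_const_smul (μ := (volume : Measure (Space N))) (p := 2)
      ((C₁ + 1) * (C₂ + 1) * M)⁻¹ (multiD γ (multiD β (regularize n a)))
    change eLpNorm (((C₁ + 1) * (C₂ + 1) * M)⁻¹ • multiD γ (multiD β (regularize n a))) 2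
      volume ≤ _
    rw [this, Real.enorm_of_nonneg (by positivity)]
    refine (mul_le_mul_right (hb' n γ hγ) _).trans ?_
    rw [← ENNReal.ofReal_mul (by positivity)]
    refine ENNReal.ofReal_le_ofReal ?_
    rw [inv_mul_le_iff₀ (by positivity), mul_one]
    exact hle2
  · filter_upwards [multiD_regularize_tendsto hD (α := β) (by omega)] with x hx
    exact hx.const_mul _

/-! ### The remainder of the quasilinear equation -/

/-- The bump function used to extend the square root smoothly. -/
noncomputable def sqrtBump {σ : ℝ} (hσ0 : 0 < σ) (hσ1 : σ < 1) : ContDiffBump (0 : ℝ) where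
  -- The inner radius is the midpoint of `σ²` and `1`, so the plateau contains a neighbourhood of
  -- `[0, σ²]`; the outer radius is the midpoint of the inner one and `1`, which keeps `1 - y`
  -- positive on the support.
  rIn := (1 + σ ^ 2) / 2
  rOut := (3 + σ ^ 2) / 4
  rIn_pos := by positivity
  rIn_lt_rOut := by nlinarith

/-- A positive smooth function which agrees with `√(1 - y)` for `|y| ≤ (1 + σ²) / 2`. -/
noncomputable def sqrtExt {σ : ℝ} (hσ0 : 0 < σ) (hσ1 : σ < 1) (y : ℝ) : ℝ :=
  Real.sqrt (1 - y * sqrtBump hσ0 hσ1 y)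

section

variable {σ : ℝ} (hσ0 : 0 < σ) (hσ1 : σ < 1)

theorem sqrtExt_arg_pos (y : ℝ) : 0 < 1 - y * sqrtBump hσ0 hσ1 y := by
  have h0 := (sqrtBump hσ0 hσ1).nonneg (x := y)
  have h1 := (sqrtBump hσ0 hσ1).le_one (x := y)
  by_cases hy : (sqrtBump hσ0 hσ1).rOut ≤ dist y 0
  · rw [(sqrtBump hσ0 hσ1).zero_of_le_dist hy]; simp
  · have h2 : |y| < (3 + σ ^ 2) / 4 := by
      rw [not_le, Real.dist_eq, sub_zero] at hy; exact hy
    have h3 : |y| < 1 := by nlinarith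
    have h4 : y * sqrtBump hσ0 hσ1 y ≤ |y| * 1 :=
      mul_le_mul (le_abs_self y) h1 h0 (abs_nonneg y)
    linarith

theorem sqrtExt_pos (y : ℝ) : 0 < sqrtExt hσ0 hσ1 y := Real.sqrt_pos.2 (sqrtExt_arg_pos hσ0 hσ1 y)

theorem contDiff_sqrtExt : ContDiff ℝ ∞ (sqrtExt hσ0 hσ1) :=
  (contDiff_const.sub (contDiff_id.mul (sqrtBump hσ0 hσ1).contDiff)).sqrt
    fun y => (sqrtExt_arg_pos hσ0 hσ1 y).ne'

theorem sqrtExt_eq {y : ℝ} (hy : |y| ≤ (1 + σ ^ 2) / 2) :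
    sqrtExt hσ0 hσ1 y = Real.sqrt (1 - y) := by
  unfold sqrtExt
  rw [(sqrtBump hσ0 hσ1).one_of_mem_closedBall, mul_one]
  rw [mem_closedBall_zero_iff]
  exact hy

theorem hasDerivAt_sqrtExt {y : ℝ} (h0 : 0 ≤ y) (h1 : y ≤ σ ^ 2) :
    HasDerivAt (sqrtExt hσ0 hσ1) (-(2 * sqrtExt hσ0 hσ1 y)⁻¹) y := by
  have hσ2 : σ ^ 2 < 1 := by nlinarith
  have hy : |y| < (1 + σ ^ 2) / 2 := by rw [abs_of_nonneg h0]; linarith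
  have h2 : HasDerivAt (fun y => Real.sqrt (1 - y)) (-(2 * sqrtExt hσ0 hσ1 y)⁻¹) y := by
    have := ((hasDerivAt_id y).const_sub 1).sqrt (by simp only [id]; linarith)
    rw [sqrtExt_eq hσ0 hσ1 hy.le]
    refine this.congr_deriv ?_
    simp [div_eq_mul_inv]
  refine h2.congr_of_eventuallyEq ?_
  filter_upwards [continuous_abs.continuousAt.eventually_lt_const hy] with x hx
  exact sqrtExt_eq hσ0 hσ1 hx.le

/-- The divergence of the flux, in rescaled variables. -/
noncomputable def divFun (v : Fin 8 → ℝ) : ℝ :=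
  (v 4 ^ 2 + v 5 ^ 2 + v 2 * v 6 + v 3 * v 7) * (sqrtExt hσ0 hσ1 (v 0 ^ 2 + v 1 ^ 2))⁻¹ +
    (v 0 * v 4 + v 1 * v 5) ^ 2 * (sqrtExt hσ0 hσ1 (v 0 ^ 2 + v 1 ^ 2))⁻¹ ^ 3

/-- The flux, in rescaled variables. -/
noncomputable def fluxFun (v : Fin 8 → ℝ) : ℝ :=
  (v 2 * v 4 + v 3 * v 5) * (sqrtExt hσ0 hσ1 (v 0 ^ 2 + v 1 ^ 2))⁻¹

/-- The cubic part of the remainder, in rescaled variables; `c = 0` is the real part and `c = 1` is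
the imaginary part. -/
noncomputable def cubicFun (c : Fin 2) (v : Fin 8 → ℝ) : ℝ :=
  divFun hσ0 hσ1 v * v (![2, 3] c) -
    (v 2 ^ 2 + v 3 ^ 2) * (1 + sqrtExt hσ0 hσ1 (v 0 ^ 2 + v 1 ^ 2))⁻¹ * v (![6, 7] c)

/-- The quintic part of the remainder, in rescaled variables. -/
noncomputable def quinticFun (c : Fin 2) (v : Fin 8 → ℝ) : ℝ :=
  (v 2 ^ 2 + v 3 ^ 2) ^ 2 * ((1 + sqrtExt hσ0 hσ1 (v 0 ^ 2 + v 1 ^ 2))⁻¹ ^ 2 / 2) *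
    v (![2, 3] c)

theorem contDiff_sqrtExt_comp :
    ContDiff ℝ ∞ fun v : Fin 8 → ℝ => sqrtExt hσ0 hσ1 (v 0 ^ 2 + v 1 ^ 2) :=
  (contDiff_sqrtExt hσ0 hσ1).comp (by fun_prop)

theorem contDiff_sqrtExt_comp_inv :
    ContDiff ℝ ∞ fun v : Fin 8 → ℝ => (sqrtExt hσ0 hσ1 (v 0 ^ 2 + v 1 ^ 2))⁻¹ :=
  (contDiff_sqrtExt_comp hσ0 hσ1).inv fun _ => (sqrtExt_pos hσ0 hσ1 _).ne'

theorem contDiff_one_add_sqrtExt_comp_inv :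
    ContDiff ℝ ∞ fun v : Fin 8 → ℝ => (1 + sqrtExt hσ0 hσ1 (v 0 ^ 2 + v 1 ^ 2))⁻¹ :=
  (contDiff_const.add (contDiff_sqrtExt_comp hσ0 hσ1)).inv fun _ =>
    (add_pos one_pos (sqrtExt_pos hσ0 hσ1 _)).ne'

theorem contDiff_divFun : ContDiff ℝ ∞ (divFun hσ0 hσ1) := by
  have := contDiff_sqrtExt_comp_inv hσ0 hσ1
  unfold divFun
  fun_prop

theorem contDiff_fluxFun : ContDiff ℝ ∞ (fluxFun hσ0 hσ1) := by
  have := contDiff_sqrtExt_comp_inv hσ0 hσ1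
  unfold fluxFun
  fun_prop

theorem contDiff_cubicFun (c : Fin 2) : ContDiff ℝ ∞ (cubicFun hσ0 hσ1 c) := by
  have := contDiff_one_add_sqrtExt_comp_inv hσ0 hσ1
  have := contDiff_divFun hσ0 hσ1
  unfold cubicFun
  fun_prop

theorem contDiff_quinticFun (c : Fin 2) : ContDiff ℝ ∞ (quinticFun hσ0 hσ1 c) := by
  have := contDiff_one_add_sqrtExt_comp_inv hσ0 hσ1
  unfold quinticFun
  fun_prop

end

/-- The rescaled second-order jet of the function with real and imaginary parts `D` and `E`. -/
noncomputable def jet {N : ℕ} (ε B : ℝ) (i : Fin N) (D E : (Fin N → ℕ) → Space N → ℝ)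
    (x : Space N) : Fin 8 → ℝ :=
  -- The function occurs twice: with the weight `√ε` as the argument of the square root, and with
  -- the weight `B⁻¹` in the polynomial factors, where it will be counted as a power of `B`.
  ![Real.sqrt ε * D 0 x, Real.sqrt ε * E 0 x, B⁻¹ * D 0 x, B⁻¹ * E 0 x,
    B⁻¹ * D (Pi.single i 1) x, B⁻¹ * E (Pi.single i 1) x,
    B⁻¹ * D (Pi.single i 2) x, B⁻¹ * E (Pi.single i 2) x]

theorem hasDerivAt_line {N : ℕ} {φ : Space N → ℝ} (h : ContDiff ℝ ∞ φ) (i : Fin N) (x : Space N) :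
    HasDerivAt (fun t : ℝ => φ (x + t • EuclideanSpace.single i 1)) (partialD i φ x) 0 := by
  have h1 : HasFDerivAt φ (fderiv ℝ φ x) (x + (0 : ℝ) • EuclideanSpace.single i 1) := by
    rw [zero_smul, add_zero]
    exact (h.differentiable (by simp) x).hasFDerivAt
  have h2 : HasDerivAt (fun t : ℝ => x + t • (EuclideanSpace.single i 1 : Space N))
      (EuclideanSpace.single i 1) 0 := by
    simpa using ((hasDerivAt_id (0 : ℝ)).smul_const (EuclideanSpace.single i 1 : Space N)).const_add x
  exact h1.comp_hasDerivAt 0 h2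

/-- One-variable calculus along the line `x + t e_i`. With `h` the square root, `h' = -ε⟨z, ∂z⟩/h`,
hence `(h⁻¹)' = ε⟨z, ∂z⟩ h⁻³`, the source of the second term. The constraint on `p`, `q` is what
gives access to the derivative of the extended square root. -/
theorem partialD_flux {N : ℕ} {σ : ℝ} (hσ0 : 0 < σ) (hσ1 : σ < 1) {ε : ℝ} (hε : 0 ≤ ε)
    {p q : Space N → ℝ} (hp : ContDiff ℝ ∞ p) (hq : ContDiff ℝ ∞ q)
    (hpq : ∀ x, ε * (p x ^ 2 + q x ^ 2) ≤ σ ^ 2) (i : Fin N) (x : Space N)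
    (hF : ContDiff ℝ ∞ fun x => (p x * partialD i p x + q x * partialD i q x) *
      (sqrtExt hσ0 hσ1 (ε * (p x ^ 2 + q x ^ 2)))⁻¹) :
    partialD i (fun x => (p x * partialD i p x + q x * partialD i q x) *
        (sqrtExt hσ0 hσ1 (ε * (p x ^ 2 + q x ^ 2)))⁻¹) x =
      (partialD i p x ^ 2 + partialD i q x ^ 2 + p x * partialD i (partialD i p) x +
        q x * partialD i (partialD i q) x) * (sqrtExt hσ0 hσ1 (ε * (p x ^ 2 + q x ^ 2)))⁻¹ +
      ε * (p x * partialD i p x + q x * partialD i q x) ^ 2 *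
        (sqrtExt hσ0 hσ1 (ε * (p x ^ 2 + q x ^ 2)))⁻¹ ^ 3 := by
  have dp := hasDerivAt_line hp i x
  have dq := hasDerivAt_line hq i x
  have dp1 := hasDerivAt_line (contDiff_partialD hp i) i x
  have dq1 := hasDerivAt_line (contDiff_partialD hq i) i x
  have e0 : x + (0 : ℝ) • (EuclideanSpace.single i 1 : Space N) = x := by simp
  have dy := ((dp.pow 2).add (dq.pow 2)).const_mul ε
  have hy : HasDerivAt (sqrtExt hσ0 hσ1)
      (-(2 * sqrtExt hσ0 hσ1 (ε * (p x ^ 2 + q x ^ 2)))⁻¹)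
      (ε * (p (x + (0 : ℝ) • EuclideanSpace.single i 1) ^ 2 +
        q (x + (0 : ℝ) • EuclideanSpace.single i 1) ^ 2)) := by
    rw [e0]
    exact hasDerivAt_sqrtExt hσ0 hσ1 (by positivity) (hpq x)
  have dh := (hy.comp (0 : ℝ) dy).inv (by
    simp only [Function.comp]
    exact (sqrtExt_pos hσ0 hσ1 _).ne')
  have key := ((dp.mul dp1).add (dq.mul dq1)).mul dh
  refine (hasDerivAt_line hF i x).unique (key.congr_deriv ?_)
  simp only [Pi.add_apply, Pi.mul_apply, Pi.pow_apply, Pi.inv_apply, Function.comp, e0]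
  have hpos := sqrtExt_pos hσ0 hσ1 (ε * (p x ^ 2 + q x ^ 2))
  field_simp
  ring

/-- The sup bound comes from the pointwise constraint and not from the Sobolev embedding, so no
division by `B` is made and the extended square root needs no rescaling. The price is an `H^s` bound
`B` instead of `1`. -/
theorem isApproximation_sqrt_mul {N s : ℕ} {ε B σ : ℝ} (hε0 : 0 < ε) (hε1 : ε ≤ 1) (hσ0 : 0 ≤ σ)
    (hσ1 : σ ≤ 1) {a : Space N → ℝ} {D : (Fin N → ℕ) → Space N → ℝ}
    (hD : HasSobolevDerivs s a D) (hB0 : 0 ≤ B)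
    (hB : ∀ n, ∀ β : Fin N → ℕ, ∑ i, β i ≤ s →
      eLpNorm (multiD β (regularize n a)) 2 volume ≤ ENNReal.ofReal B)
    (ha : ∀ n x, regularize n a x ^ 2 ≤ (σ / Real.sqrt ε) ^ 2) :
    IsApproximation s B (fun n x => Real.sqrt ε * regularize n a x)
      fun x => Real.sqrt ε * D 0 x := by
  have hreg := fun n => regularize_isTest n hD.locallyIntegrable
  have hs0 : 0 < Real.sqrt ε := Real.sqrt_pos.2 hε0
  have hs1 : Real.sqrt ε ≤ 1 := Real.sqrt_le_one.2 hε1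
  refine ⟨fun n => (hreg n).const_mul _, fun n x => ?_, fun n γ hγ => ?_, ?_⟩
  · have h1 := abs_le_of_sq_le_sq (ha n x) (by positivity)
    rw [abs_mul, abs_of_pos hs0]
    rw [le_div_iff₀ hs0] at h1
    linarith
  · rw [multiD_const_mul (hreg n).1]
    have := eLpNorm_const_smul (μ := (volume : Measure (Space N))) (p := 2)
      (Real.sqrt ε) (multiD γ (regularize n a))
    change eLpNorm (Real.sqrt ε • multiD γ (regularize n a)) 2 volume ≤ _
    rw [this, Real.enorm_of_nonneg hs0.le]
    refine (mul_le_mul_right (hB n γ hγ) _).trans ?_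
    rw [← ENNReal.ofReal_mul hs0.le]
    exact ENNReal.ofReal_le_ofReal (mul_le_of_le_one_left hB0 hs1)
  · filter_upwards [multiD_regularize_tendsto hD (α := 0) (by simp)] with x hx
    simpa using hx.const_mul (Real.sqrt ε)

theorem HasSobolevDerivs.mono {N k l : ℕ} {a : Space N → ℝ} {D : (Fin N → ℕ) → Space N → ℝ}
    (h : HasSobolevDerivs k a D) (hl : l ≤ k) : HasSobolevDerivs l a D :=
  fun α hα => h α (hα.trans hl)

/-- The rescaled jet of a function in `H^{s+2}` is approximated by the jets of its
regularizations. -/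
theorem exists_isApproximation_jet (N s : ℕ) (hs : N < 2 * s) :
    ∃ C : ℝ, 1 ≤ C ∧ ∀ (σ ε M : ℝ) (z : Space N → ℂ), 0 < σ → σ < 1 → 0 < ε → ε < 1 → 0 < M →
      MemH (s + 2) z → hNorm (s + 2) z ≤ M → (∀ᵐ x, ε * ‖z x‖ ^ 2 ≤ σ ^ 2) →
      (∀ n x, ε * (regularize n (fun x => (z x).re) x ^ 2 +
        regularize n (fun x => (z x).im) x ^ 2) ≤ σ ^ 2) ∧
      ∀ i c, IsApproximation s (1 + C * M)
        (fun n x => jet ε (C * M) i (fun β => multiD β (regularize n fun x => (z x).re))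
          (fun β => multiD β (regularize n fun x => (z x).im)) x c)
        fun x => jet ε (C * M) i (fun β x => (weakDeriv β z x).re)
          (fun β x => (weakDeriv β z x).im) x c := by
  obtain ⟨C, hC, h⟩ := exists_isApproximation N s 2 hs
  refine ⟨C, hC, fun σ ε M z hσ0 hσ1 hε0 hε1 hM hz hzM hzσ => ?_⟩
  have hs0 : 0 < Real.sqrt ε := Real.sqrt_pos.2 hε0
  have hre := hz.hasSobolevDerivs_re
  have him := hz.hasSobolevDerivs_im
  obtain ⟨r1, r2⟩ := h _ _ M hM hre fun α hα => (eLpNorm_re_le _).trans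
    ((hz.eLpNorm_weakDeriv_le hα).trans (ENNReal.ofReal_le_ofReal hzM))
  obtain ⟨i1, i2⟩ := h _ _ M hM him fun α hα => (eLpNorm_im_le _).trans
    ((hz.eLpNorm_weakDeriv_le hα).trans (ENNReal.ofReal_le_ofReal hzM))
  -- Real and imaginary parts are regularized by the same average, so the disc of radius `σ/√ε` is
  -- preserved.
  have hmem : ∀ n x, regularize n (fun x => (z x).re) x ^ 2 +
      regularize n (fun x => (z x).im) x ^ 2 ≤ (σ / Real.sqrt ε) ^ 2 := by
    refine fun n x => sq_add_sq_regularize_le hre.locallyIntegrable him.locallyIntegrable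
      (by positivity) ?_ n x
    filter_upwards [hzσ] with x hx
    rw [div_pow, Real.sq_sqrt hε0.le, le_div_iff₀ hε0]
    rw [Complex.sq_norm, Complex.normSq_apply] at hx
    linarith
  have hB : 0 < C * M := by positivity
  have hsum : ∀ (i : Fin N) (m : ℕ), ∑ j, (Pi.single i m : Fin N → ℕ) j = m := fun i m => by simp
  have q0 := isApproximation_sqrt_mul hε0 hε1.le hσ0.le hσ1.le (hre.mono (Nat.le_add_right s 2))
    hB.le (fun n β hβ => r2 n β (by omega)) fun n x =>
      (le_add_of_nonneg_right (sq_nonneg _)).trans (hmem n x)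
  have q1 := isApproximation_sqrt_mul hε0 hε1.le hσ0.le hσ1.le (him.mono (Nat.le_add_right s 2))
    hB.le (fun n β hβ => i2 n β (by omega)) fun n x =>
      (le_add_of_nonneg_left (sq_nonneg _)).trans (hmem n x)
  refine ⟨fun n x => ?_, fun i c => ?_⟩
  · have := hmem n x
    rw [div_pow, Real.sq_sqrt hε0.le, le_div_iff₀ hε0] at this
    linarith
  · fin_cases c
    · simpa [jet] using q0.mono (by linarith)
    · simpa [jet] using q1.mono (by linarith)
    · exact (r1 0 (by simp)).mono (by linarith)
    · exact (i1 0 (by simp)).mono (by linarith)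
    · exact (r1 (Pi.single i 1) (by rw [hsum]; norm_num)).mono (by linarith)
    · exact (i1 (Pi.single i 1) (by rw [hsum]; norm_num)).mono (by linarith)
    · exact (r1 (Pi.single i 2) (by rw [hsum])).mono (by linarith)
    · exact (i1 (Pi.single i 2) (by rw [hsum])).mono (by linarith)

/-- For the regularized functions the divergence is computed classically; the order-zero Moser
estimate bounds flux and divergence in `L²`, and both converge almost everywhere. Uniqueness of weak
derivatives then identifies the chosen one. The factor `B²` undoes the scaling of the two factors
normalized by `B⁻¹`. -/
theorem weakPartial_nlsFlux_ae_eq {N s : ℕ} {σ ε A B : ℝ} (hσ0 : 0 < σ) (hσ1 : σ < 1)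
    (hε : 0 < ε) (hA : 0 ≤ A) (hB : 0 < B) {z : Space N → ℂ} (hz : MemH (s + 2) z)
    (hzσ : ∀ᵐ x, ε * ‖z x‖ ^ 2 ≤ σ ^ 2)
    (hreg : ∀ n x, ε * (regularize n (fun x => (z x).re) x ^ 2 +
      regularize n (fun x => (z x).im) x ^ 2) ≤ σ ^ 2) (i : Fin N)
    (hjet : ∀ c, IsApproximation s A
      (fun n x => jet ε B i (fun β => multiD β (regularize n fun x => (z x).re))
        (fun β => multiD β (regularize n fun x => (z x).im)) x c)
      fun x => jet ε B i (fun β x => (weakDeriv β z x).re)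
        (fun β x => (weakDeriv β z x).im) x c) :
    weakPartial i (nlsFlux ε z i) =ᵐ[volume] fun x =>
      ((B ^ 2 * divFun hσ0 hσ1 (jet ε B i (fun β x => (weakDeriv β z x).re)
        (fun β x => (weakDeriv β z x).im) x) : ℝ) : ℂ) := by
  have hc1 : ContDiff ℝ ∞ fun v => B ^ 2 * fluxFun hσ0 hσ1 v :=
    contDiff_const.mul (contDiff_fluxFun hσ0 hσ1)
  have hc2 : ContDiff ℝ ∞ fun v => B ^ 2 * divFun hσ0 hσ1 v :=
    contDiff_const.mul (contDiff_divFun hσ0 hσ1)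
  have hc10 : B ^ 2 * fluxFun hσ0 hσ1 0 = 0 := by simp [fluxFun]
  have hc20 : B ^ 2 * divFun hσ0 hσ1 0 = 0 := by simp [divFun]
  obtain ⟨C₁, hC₁, h1⟩ := moser N s hc1 hc10
  obtain ⟨C₂, hC₂, h2⟩ := moser N s hc2 hc20
  have hp := fun n => regularize_isTest n hz.hasSobolevDerivs_re.locallyIntegrable
  have hq := fun n => regularize_isTest n hz.hasSobolevDerivs_im.locallyIntegrable
  set J : ℕ → Space N → Fin 8 → ℝ := fun n x =>
    jet ε B i (fun β => multiD β (regularize n fun x => (z x).re))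
        (fun β => multiD β (regularize n fun x => (z x).im)) x with hJ
  set J' : Space N → Fin 8 → ℝ := fun x => jet ε B i (fun β x => (weakDeriv β z x).re)
        (fun β x => (weakDeriv β z x).im) x with hJ'
  have hε2 : Real.sqrt ε ^ 2 = ε := Real.sq_sqrt hε.le
  have htest : ∀ n, IsTest fun x => B ^ 2 * fluxFun hσ0 hσ1 (J n x) := fun n =>
    IsTest.comp (fun c => (hjet c).1 n) hc1 hc10
  have hflux : ∀ n, (fun x => B ^ 2 * fluxFun hσ0 hσ1 (J n x)) = fun x =>
      (regularize n (fun x => (z x).re) x * partialD i (regularize n fun x => (z x).re) x +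
        regularize n (fun x => (z x).im) x * partialD i (regularize n fun x => (z x).im) x) *
      (sqrtExt hσ0 hσ1 (ε * (regularize n (fun x => (z x).re) x ^ 2 +
        regularize n (fun x => (z x).im) x ^ 2)))⁻¹ := fun n => by
    funext x
    simp only [hJ, jet, fluxFun, multiD_zero, multiD_single (hp n).1, multiD_single (hq n).1,
      Matrix.cons_val, mul_pow, hε2, ← mul_add]
    field_simp
  have hdiv : ∀ n x, multiD (Pi.single i 1) (fun x => B ^ 2 * fluxFun hσ0 hσ1 (J n x)) x =
      B ^ 2 * divFun hσ0 hσ1 (J n x) := fun n x => by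
    have hF := (htest n).1
    rw [multiD_single hF]
    rw [hflux] at hF ⊢
    rw [partialD_flux hσ0 hσ1 hε.le (hp n).1 (hq n).1 (hreg n) i x hF]
    simp only [hJ, jet, divFun, multiD_zero, multiD_single (hp n).1, multiD_single (hq n).1,
      multiD_single_two (hp n).1, multiD_single_two (hq n).1, Matrix.cons_val, mul_pow, hε2,
      ← mul_add]
    have hpos := sqrtExt_pos hσ0 hσ1 (ε * (regularize n (fun x => (z x).re) x ^ 2 +
        regularize n (fun x => (z x).im) x ^ 2))
    have hsq : ∀ a b c d : ℝ, (Real.sqrt ε * a * (B⁻¹ * b) + Real.sqrt ε * c * (B⁻¹ * d)) ^ 2 =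
        ε * (B⁻¹) ^ 2 * (a * b + c * d) ^ 2 := fun a b c d => by
      linear_combination (B⁻¹ ^ 2 * (a * b + c * d) ^ 2) * hε2
    rw [hsq]
    field_simp
  have hlim : ∀ᵐ x, Tendsto (fun n => J n x) atTop (𝓝 (J' x)) := by
    filter_upwards [ae_all_iff.2 fun c => (hjet c).2.2.2] with x hx
    exact tendsto_pi_nhds.2 hx
  have hb1 : ∀ n, eLpNorm (fun x => B ^ 2 * fluxFun hσ0 hσ1 (J n x)) 2 volume ≤
      ENNReal.ofReal ((C₁ + C₂) * A) := fun n => by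
    have := h1 (fun c x => J n x c) (fun c => (hjet c).1 n) (fun c => (hjet c).2.1 n) A hA
      (fun c => (hjet c).2.2.1 n) 0 (by simp)
    rw [multiD_zero] at this
    exact this.trans (ENNReal.ofReal_le_ofReal (by nlinarith))
  have hb2 : ∀ n, eLpNorm (multiD (Pi.single i 1) fun x => B ^ 2 * fluxFun hσ0 hσ1 (J n x)) 2
      volume ≤ ENNReal.ofReal ((C₁ + C₂) * A) := fun n => by
    rw [funext (hdiv n)]
    have := h2 (fun c x => J n x c) (fun c => (hjet c).1 n) (fun c => (hjet c).2.1 n) A hA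
      (fun c => (hjet c).2.2.1 n) 0 (by simp)
    rw [multiD_zero] at this
    exact this.trans (ENNReal.ofReal_le_ofReal (by nlinarith))
  have key : HasRealWeakDeriv (Pi.single i 1) (fun x => B ^ 2 * fluxFun hσ0 hσ1 (J' x))
      fun x => B ^ 2 * divFun hσ0 hσ1 (J' x) := by
    refine hasRealWeakDeriv_of_tendsto htest (Pi.single i 1)
      (by positivity : 0 ≤ (C₁ + C₂) * A) hb1 hb2 ?_ ?_
    · filter_upwards [hlim] with x hx
      exact (hc1.continuous.tendsto _).comp hx
    · filter_upwards [hlim] with x hx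
      simp only [hdiv]
      exact (hc2.continuous.tendsto _).comp hx
  have hσ2 : σ ^ 2 < 1 := by nlinarith
  refine HasWeakDeriv.weakDeriv_ae_eq (HasWeakDeriv.of_re_im ?_ ?_)
  · simp only [Complex.ofReal_re]
    refine key.congr ?_ .rfl
    filter_upwards [hzσ, hz.weakDeriv_zero_ae_eq] with x hx hx0
    have hn : ε * ‖z x‖ ^ 2 = ε * ((z x).re ^ 2 + (z x).im ^ 2) := by
      rw [Complex.sq_norm, Complex.normSq_apply]; ring
    simp only [hJ', jet, fluxFun, nlsFlux, weakPartial, cdot, Complex.ofReal_re, hx0,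
      Matrix.cons_val, mul_pow, hε2, ← mul_add, ← hn]
    rw [sqrtExt_eq hσ0 hσ1 (by rw [abs_of_nonneg (by positivity)]; linarith)]
    simp only [Complex.mul_re, Complex.conj_re, Complex.conj_im]
    field_simp
    ring
  · simp only [Complex.ofReal_im, nlsFlux]
    exact ⟨locallyIntegrable_zero, locallyIntegrable_zero, fun φ _ => by simp⟩

/-- From `h² = 1 - ε(a² + b²)` follow `h - 1 = -ε(a² + b²)/(1+h)` and `1/(1+h) - 1/2 = ε(a² +
b²)/(2(1+h)²)`. All contributions thus carry `ε`, and they are of degree three or five in the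
quantities scaled by `B⁻¹`. -/
theorem remainder_identity {ι : Type*} [Fintype ι] {ε B h a b z : ℝ} (w d : ι → ℝ) (hB : B ≠ 0)
    (hh : 0 < h) (h2 : h ^ 2 = 1 - ε * (a ^ 2 + b ^ 2)) :
    (h - 1) * ∑ i, w i + ((a ^ 2 + b ^ 2) / (1 + h) - (a ^ 2 + b ^ 2) / 2) * z +
        ε * (∑ i, B ^ 2 * d i) * z =
      ∑ i, ε * B ^ 3 * (d i * (B⁻¹ * z) -
        ((B⁻¹ * a) ^ 2 + (B⁻¹ * b) ^ 2) * (1 + h)⁻¹ * (B⁻¹ * w i)) +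
      ε * B ^ 5 * (((B⁻¹ * a) ^ 2 + (B⁻¹ * b) ^ 2) ^ 2 * ((1 + h)⁻¹ ^ 2 / 2) * (B⁻¹ * z)) := by
  have hp : 1 + h ≠ 0 := by positivity
  have e1 : ∀ i, ε * B ^ 3 * (d i * (B⁻¹ * z) -
        ((B⁻¹ * a) ^ 2 + (B⁻¹ * b) ^ 2) * (1 + h)⁻¹ * (B⁻¹ * w i)) =
      (h - 1) * w i + ε * (B ^ 2 * d i) * z := fun i => by
    field_simp
    linear_combination (-w i) * h2
  have e2 : ε * B ^ 5 * (((B⁻¹ * a) ^ 2 + (B⁻¹ * b) ^ 2) ^ 2 * ((1 + h)⁻¹ ^ 2 / 2) * (B⁻¹ * z)) =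
      ((a ^ 2 + b ^ 2) / (1 + h) - (a ^ 2 + b ^ 2) / 2) * z := by
    field_simp
    linear_combination ((a ^ 2 + b ^ 2) * z) * h2
  simp_rw [e1]
  rw [e2, Finset.sum_add_distrib, Finset.mul_sum, Finset.mul_sum Finset.univ _ ε, Finset.sum_mul]
  ring

/-- The difference of the nonlinear operators of the two equations, at the same function. -/
theorem exists_remainder_bound (N s : ℕ) (hN : 1 ≤ N) (hs : N < 2 * s) {σ : ℝ} (hσ0 : 0 < σ)
    (hσ1 : σ < 1) :
    ∃ C : ℝ, 0 ≤ C ∧ ∀ (ε M : ℝ) (z : Space N → ℂ), 0 < ε → ε < 1 → 0 < M →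
      MemH (s + 2) z → hNorm (s + 2) z ≤ M → (∀ᵐ x, ε * ‖z x‖ ^ 2 ≤ σ ^ 2) →
      MemH s (nlsOperator ε z - csOperator z) ∧
      hNorm s (nlsOperator ε z - csOperator z) ≤ C * (ε * (M ^ 3 + M ^ 5) * (1 + M)) := by
  obtain ⟨C₁, hC₁, h1⟩ := exists_isApproximation_jet N s hs
  choose C₂ hC₂ h2 using fun c => realHBound_comp N s (contDiff_cubicFun hσ0 hσ1 c)
    (by fin_cases c <;> simp [cubicFun])
  choose C₃ hC₃ h3 using fun c => realHBound_comp N s (contDiff_quinticFun hσ0 hσ1 c)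
    (by fin_cases c <;> simp [quinticFun])
  have hS₂ : 0 ≤ ∑ c, C₂ c := Finset.sum_nonneg fun c _ => hC₂ c
  have hS₃ : 0 ≤ ∑ c, C₃ c := Finset.sum_nonneg fun c _ => hC₃ c
  have hC0 : 0 ≤ C₁ := by linarith
  refine ⟨(indicesLE N s).card * (2 * (N * C₁ ^ 4 * ∑ c, C₂ c + C₁ ^ 6 * ∑ c, C₃ c)),
    by positivity, fun ε M z hε0 hε1 hM hz hzM hzσ => ?_⟩
  obtain ⟨hreg, hjet⟩ := h1 σ ε M z hσ0 hσ1 hε0 hε1 hM hz hzM hzσ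
  have hB : 0 < C₁ * M := by positivity
  have hA : 0 ≤ 1 + C₁ * M := by positivity
  have hflux := fun i => weakPartial_nlsFlux_ae_eq hσ0 hσ1 hε0 hA hB hz hzσ hreg i (hjet i)
  set B := C₁ * M with hBdef
  set A := 1 + B with hAdef
  set J : Fin N → Space N → Fin 8 → ℝ := fun i x => jet ε B i (fun β x => (weakDeriv β z x).re)
        (fun β x => (weakDeriv β z x).im) x with hJ
  -- The quintic part involves no derivative, so the jet in any direction serves.
  let i₀ : Fin N := ⟨0, hN⟩
  have hR : ∀ c : Fin 2, RealHBound s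
      (ε * (N * B ^ 3 * ∑ c, C₂ c + B ^ 5 * ∑ c, C₃ c) * A)
      fun x => ∑ i, ε * B ^ 3 * cubicFun hσ0 hσ1 c (J i x) +
        ε * B ^ 5 * quinticFun hσ0 hσ1 c (J i₀ x) := fun c => by
    have b1 := fun i => (h2 c _ (fun c x => J i x c) A hA (hjet i)).const_mul
      (by positivity : 0 ≤ ε * B ^ 3)
    have b2 := (h3 c _ (fun c x => J i₀ x c) A hA (hjet i₀)).const_mul
      (by positivity : 0 ≤ ε * B ^ 5)
    have n1 : 0 ≤ ε * B ^ 3 * (C₂ c * A) := mul_nonneg (by positivity) (mul_nonneg (hC₂ c) hA)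
    have n2 : 0 ≤ ε * B ^ 5 * (C₃ c * A) := mul_nonneg (by positivity) (mul_nonneg (hC₃ c) hA)
    have b3 := RealHBound.add (by positivity) n2
      (RealHBound.sum Finset.univ n1 fun i _ => b1 i) b2
    refine b3.mono ?_
    rw [Finset.card_univ, Fintype.card_fin]
    have l2 : C₂ c ≤ ∑ c, C₂ c :=
      Finset.single_le_sum (f := C₂) (fun c _ => hC₂ c) (Finset.mem_univ c)
    have l3 : C₃ c ≤ ∑ c, C₃ c :=
      Finset.single_le_sum (f := C₃) (fun c _ => hC₃ c) (Finset.mem_univ c)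
    calc (N : ℝ) * (ε * B ^ 3 * (C₂ c * A)) + ε * B ^ 5 * (C₃ c * A)
        ≤ N * (ε * B ^ 3 * ((∑ c, C₂ c) * A)) + ε * B ^ 5 * ((∑ c, C₃ c) * A) := by gcongr
      _ = _ := by ring
  have hσ2 : σ ^ 2 < 1 := by nlinarith
  have hε2 : Real.sqrt ε ^ 2 = ε := Real.sq_sqrt hε0.le
  have hid : ∀ᵐ x, ((nlsOperator ε z - csOperator z) x).re =
        ∑ i, ε * B ^ 3 * cubicFun hσ0 hσ1 0 (J i x) + ε * B ^ 5 * quinticFun hσ0 hσ1 0 (J i₀ x) ∧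
      ((nlsOperator ε z - csOperator z) x).im =
        ∑ i, ε * B ^ 3 * cubicFun hσ0 hσ1 1 (J i x) +
          ε * B ^ 5 * quinticFun hσ0 hσ1 1 (J i₀ x) := by
    filter_upwards [hzσ, hz.weakDeriv_zero_ae_eq, ae_all_iff.2 hflux] with x hx hx0 hxf
    have hn : ‖z x‖ ^ 2 = (z x).re ^ 2 + (z x).im ^ 2 := by
      rw [Complex.sq_norm, Complex.normSq_apply]; ring
    have hsq := sqrtExt_eq hσ0 hσ1 (y := ε * ‖z x‖ ^ 2)
      (by rw [abs_of_nonneg (by positivity)]; linarith)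
    have hpos := sqrtExt_pos hσ0 hσ1 (ε * ‖z x‖ ^ 2)
    rw [hn] at hsq hpos
    have hh : sqrtExt hσ0 hσ1 (ε * ((z x).re ^ 2 + (z x).im ^ 2)) ^ 2 =
        1 - ε * ((z x).re ^ 2 + (z x).im ^ 2) := by
      rw [hsq, Real.sq_sqrt]
      rw [hn] at hx
      linarith
    have hop : (nlsOperator ε z - csOperator z) x =
        ((sqrtExt hσ0 hσ1 (ε * ((z x).re ^ 2 + (z x).im ^ 2)) - 1 : ℝ) : ℂ) *
          (∑ i, weakDeriv (Pi.single i 2) z x) +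
        ((((z x).re ^ 2 + (z x).im ^ 2) /
            (1 + sqrtExt hσ0 hσ1 (ε * ((z x).re ^ 2 + (z x).im ^ 2))) -
          ((z x).re ^ 2 + (z x).im ^ 2) / 2 : ℝ) : ℂ) * z x +
        ((ε * ∑ i, B ^ 2 * divFun hσ0 hσ1 (J i x) : ℝ) : ℂ) * z x := by
      simp only [nlsOperator, csOperator, Pi.sub_apply, weakDiv, weakLaplacian, hxf, hn, hsq]
      push_cast
      ring
    rw [hop]
    have id0 := remainder_identity (z := (z x).re) (fun i => (weakDeriv (Pi.single i 2) z x).re)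
      (fun i => divFun hσ0 hσ1 (J i x)) hB.ne' hpos hh
    have id1 := remainder_identity (z := (z x).im) (fun i => (weakDeriv (Pi.single i 2) z x).im)
      (fun i => divFun hσ0 hσ1 (J i x)) hB.ne' hpos hh
    constructor
    · simp only [Complex.add_re, Complex.re_ofReal_mul, Complex.re_sum]
      rw [id0]
      simp [cubicFun, quinticFun, hJ, jet, hx0, mul_pow, hε2, ← mul_add]
    · simp only [Complex.add_im, Complex.im_ofReal_mul, Complex.im_sum]
      rw [id1]
      simp [cubicFun, quinticFun, hJ, jet, hx0, mul_pow, hε2, ← mul_add]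
  obtain ⟨m1, m2⟩ := memH_of_realHBound (f := nlsOperator ε z - csOperator z)
    (by positivity : 0 ≤ ε * (N * B ^ 3 * ∑ c, C₂ c + B ^ 5 * ∑ c, C₃ c) * A)
    ((hR 0).congr (by filter_upwards [hid] with x hx using hx.1.symm))
    ((hR 1).congr (by filter_upwards [hid] with x hx using hx.2.symm))
  refine ⟨m1, m2.trans ?_⟩
  have hAle : A ≤ C₁ * (1 + M) := by
    rw [hAdef, hBdef]; linarith
  -- These are the cross terms added when `B³` and `B⁵` are both replaced by multiples of `M³ + M⁵`.
  have hMM : 0 ≤ (N * C₁ ^ 3 * ∑ c, C₂ c) * M ^ 5 + (C₁ ^ 5 * ∑ c, C₃ c) * M ^ 3 := by positivity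
  calc ((indicesLE N s).card : ℝ) * (2 * (ε * (N * B ^ 3 * ∑ c, C₂ c + B ^ 5 * ∑ c, C₃ c) * A))
      ≤ (indicesLE N s).card * (2 * (ε * ((N * C₁ ^ 3 * ∑ c, C₂ c + C₁ ^ 5 * ∑ c, C₃ c) *
          (M ^ 3 + M ^ 5)) * (C₁ * (1 + M)))) := by
        gcongr
        rw [hBdef]
        linarith
    _ = _ := by ring

/-- The real parts (`c = 0`) and imaginary parts (`c = 1`) of `½ (|z|² z - |z'|² z')`, in terms of
those of `z`, `z'` and `z - z'`. -/
noncomputable def cubicDiffFun (c : Fin 2) (v : Fin 6 → ℝ) : ℝ :=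
  ((v 0 ^ 2 + v 1 ^ 2) * v (![4, 5] c) +
    (v 4 * (v 0 + v 2) + v 5 * (v 1 + v 3)) * v (![2, 3] c)) / 2

theorem contDiff_cubicDiffFun (c : Fin 2) : ContDiff ℝ ∞ (cubicDiffFun c) := by
  unfold cubicDiffFun
  fun_prop

/-- The Moser estimate applied to the polynomial `|z|²u + (|z|² - |w|²)w` with `u = z - w` treated
as a variable of its own. Scaling `z`, `w` by `M` and `u` by `m` makes all inputs of size one, and
homogeneity returns `M² m`. -/
theorem exists_cubic_difference_bound (N s : ℕ) (hs : N < 2 * s) :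
    ∃ C : ℝ, 0 ≤ C ∧ ∀ (z w : Space N → ℂ) (M m : ℝ), 0 < M → 0 < m → MemH s z → MemH s w →
      hNorm s z ≤ M → hNorm s w ≤ M → hNorm s (z - w) ≤ m →
      MemH s (fun x => ((‖z x‖ ^ 2 / 2 : ℝ) : ℂ) * z x - ((‖w x‖ ^ 2 / 2 : ℝ) : ℂ) * w x) ∧
      hNorm s (fun x => ((‖z x‖ ^ 2 / 2 : ℝ) : ℂ) * z x - ((‖w x‖ ^ 2 / 2 : ℝ) : ℂ) * w x) ≤
        C * (M ^ 2 * m) := by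
  obtain ⟨C₁, hC₁, h1⟩ := exists_isApproximation N s 0 hs
  choose C₂ hC₂ h2 using fun c => realHBound_comp N s (contDiff_cubicDiffFun c)
    (by simp [cubicDiffFun])
  have hS₂ : 0 ≤ ∑ c, C₂ c := Finset.sum_nonneg fun c _ => hC₂ c
  have hC0 : 0 < C₁ := by linarith
  refine ⟨(indicesLE N s).card * (2 * (C₁ ^ 3 * ∑ c, C₂ c)), by positivity,
    fun z w M m hM hm hz hw hzM hwM hzw => ?_⟩
  have happ : ∀ (f : Space N → ℂ) (L : ℝ), 0 < L → MemH s f → hNorm s f ≤ L →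
      IsApproximation s 1
        (fun n x => (C₁ * L)⁻¹ * multiD 0 (regularize n fun x => (f x).re) x)
        (fun x => (C₁ * L)⁻¹ * (weakDeriv 0 f x).re) ∧
      IsApproximation s 1
        (fun n x => (C₁ * L)⁻¹ * multiD 0 (regularize n fun x => (f x).im) x)
        (fun x => (C₁ * L)⁻¹ * (weakDeriv 0 f x).im) := fun f L hL hf hfL =>
    ⟨(h1 _ _ L hL hf.hasSobolevDerivs_re fun α hα => (eLpNorm_re_le _).trans
      ((hf.eLpNorm_weakDeriv_le hα).trans (ENNReal.ofReal_le_ofReal hfL))).1 0 (by simp),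
    (h1 _ _ L hL hf.hasSobolevDerivs_im fun α hα => (eLpNorm_im_le _).trans
      ((hf.eLpNorm_weakDeriv_le hα).trans (ENNReal.ofReal_le_ofReal hfL))).1 0 (by simp)⟩
  obtain ⟨az, bz⟩ := happ z M hM hz hzM
  obtain ⟨aw, bw⟩ := happ w M hM hw hwM
  obtain ⟨au, bu⟩ := happ (z - w) m hm (hz.sub hw) hzw
  set V : Space N → Fin 6 → ℝ := fun x => ![(C₁ * M)⁻¹ * (weakDeriv 0 z x).re,
    (C₁ * M)⁻¹ * (weakDeriv 0 z x).im, (C₁ * M)⁻¹ * (weakDeriv 0 w x).re,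
    (C₁ * M)⁻¹ * (weakDeriv 0 w x).im, (C₁ * m)⁻¹ * (weakDeriv 0 (z - w) x).re,
    (C₁ * m)⁻¹ * (weakDeriv 0 (z - w) x).im] with hV
  have hR : ∀ c : Fin 2, RealHBound s (C₁ ^ 3 * (∑ c, C₂ c) * (M ^ 2 * m))
      fun x => C₁ ^ 3 * M ^ 2 * m * cubicDiffFun c (V x) := fun c => by
    have b := (h2 c ![_, _, _, _, _, _] (fun c x => V x c) 1 zero_le_one (by
      intro c
      fin_cases c
      · exact az
      · exact bz
      · exact aw
      · exact bw
      · exact au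
      · exact bu)).const_mul (by positivity : 0 ≤ C₁ ^ 3 * M ^ 2 * m)
    refine b.mono ?_
    have l2 : C₂ c ≤ ∑ c, C₂ c :=
      Finset.single_le_sum (f := C₂) (fun c _ => hC₂ c) (Finset.mem_univ c)
    calc C₁ ^ 3 * M ^ 2 * m * (C₂ c * 1) ≤ C₁ ^ 3 * M ^ 2 * m * ((∑ c, C₂ c) * 1) := by gcongr
      _ = _ := by ring
  have hid : ∀ᵐ x,
      (((‖z x‖ ^ 2 / 2 : ℝ) : ℂ) * z x - ((‖w x‖ ^ 2 / 2 : ℝ) : ℂ) * w x).re =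
        C₁ ^ 3 * M ^ 2 * m * cubicDiffFun 0 (V x) ∧
      (((‖z x‖ ^ 2 / 2 : ℝ) : ℂ) * z x - ((‖w x‖ ^ 2 / 2 : ℝ) : ℂ) * w x).im =
        C₁ ^ 3 * M ^ 2 * m * cubicDiffFun 1 (V x) := by
    filter_upwards [hz.weakDeriv_zero_ae_eq, hw.weakDeriv_zero_ae_eq,
      (hz.sub hw).weakDeriv_zero_ae_eq] with x hx1 hx2 hx3
    have hn : ∀ y : ℂ, ‖y‖ ^ 2 = y.re ^ 2 + y.im ^ 2 := fun y => by
      rw [Complex.sq_norm, Complex.normSq_apply]; ring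
    simp only [Complex.sub_re, Complex.sub_im, Complex.re_ofReal_mul, Complex.im_ofReal_mul, hn,
      cubicDiffFun, hV, hx1, hx2, hx3, Pi.sub_apply, Matrix.cons_val]
    constructor <;> · field_simp; ring
  obtain ⟨m1, m2⟩ := memH_of_realHBound
    (f := fun x => ((‖z x‖ ^ 2 / 2 : ℝ) : ℂ) * z x - ((‖w x‖ ^ 2 / 2 : ℝ) : ℂ) * w x)
    (by positivity : 0 ≤ C₁ ^ 3 * (∑ c, C₂ c) * (M ^ 2 * m))
    ((hR 0).congr (by filter_upwards [hid] with x hx using hx.1.symm))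
    ((hR 1).congr (by filter_upwards [hid] with x hx using hx.2.symm))
  exact ⟨m1, m2.trans (le_of_eq (by ring))⟩

/-! ### Energy estimates -/

/-! ### Curves in a Hilbert space with a bounded weak derivative. -/

section Hilbert

variable {H : Type*} [NormedAddCommGroup H] [InnerProductSpace ℝ H] {T M : ℝ} {U V : ℝ → H}
  {D : Set H}

/-- The mean value inequality for each pairing with `φ ∈ D` extends to all `φ` by density; then take
`φ = U s - U t`. -/
theorem norm_sub_le_of_weak_deriv (hM : 0 ≤ M) (hD : Dense D) (hV : ∀ t ∈ Icc 0 T, ‖V t‖ ≤ M)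
    (h : ∀ φ ∈ D, ∀ t ∈ Icc 0 T,
      HasDerivWithinAt (fun s => inner ℝ φ (U s)) (inner ℝ φ (V t)) (Icc 0 T) t)
    {s t : ℝ} (hs : s ∈ Icc 0 T) (ht : t ∈ Icc 0 T) : ‖U s - U t‖ ≤ M * |s - t| := by
  have key : ∀ φ : H, ‖inner ℝ φ (U s - U t)‖ ≤ M * |s - t| * ‖φ‖ := fun φ => by
    refine hD.induction (P := fun φ => ‖inner ℝ φ (U s - U t)‖ ≤ M * |s - t| * ‖φ‖)
      (fun φ hφ => ?_) (isClosed_le (by fun_prop) (by fun_prop)) φ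
    have := Convex.norm_image_sub_le_of_norm_hasDerivWithin_le (C := ‖φ‖ * M) (h φ hφ)
      (fun x hx => (norm_inner_le_norm _ _).trans
        (mul_le_mul_of_nonneg_left (hV x hx) (norm_nonneg φ))) (convex_Icc 0 T) ht hs
    rw [← inner_sub_right, Real.norm_eq_abs (s - t)] at this
    linarith
  have h1 := key (U s - U t)
  rw [real_inner_self_eq_norm_sq, norm_pow, norm_norm, sq] at h1
  rcases (norm_nonneg (U s - U t)).eq_or_lt with h0 | h0
  · rw [← h0]; positivity
  · exact le_of_mul_le_mul_right h1 h0

/-- Replacing `φ` by a nearby `ψ ∈ D` costs at most `‖φ - ψ‖ 2M|s - t|`, by the Lipschitz bound for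
`U`; this is a small multiple of `|s - t|`. -/
theorem hasDerivWithinAt_inner_of_dense (hM : 0 ≤ M) (hD : Dense D)
    (hV : ∀ t ∈ Icc 0 T, ‖V t‖ ≤ M)
    (h : ∀ φ ∈ D, ∀ t ∈ Icc 0 T,
      HasDerivWithinAt (fun s => inner ℝ φ (U s)) (inner ℝ φ (V t)) (Icc 0 T) t)
    (φ : H) {t : ℝ} (ht : t ∈ Icc 0 T) :
    HasDerivWithinAt (fun s => inner ℝ φ (U s)) (inner ℝ φ (V t)) (Icc 0 T) t := by
  rw [hasDerivWithinAt_iff_isLittleO, Asymptotics.isLittleO_iff]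
  intro c hc
  obtain ⟨ψ, hψ, hφψ⟩ := Metric.dense_iff.1 hD φ (c / 2 / (2 * M + 1)) (by positivity)
  rw [Metric.mem_ball, dist_comm, dist_eq_norm, lt_div_iff₀ (by positivity)] at hψ
  have h1 := h ψ hφψ t ht
  rw [hasDerivWithinAt_iff_isLittleO, Asymptotics.isLittleO_iff] at h1
  filter_upwards [h1 (half_pos hc), self_mem_nhdsWithin] with s hs1 hs
  have e : ∀ χ : H, inner ℝ χ (U s) - inner ℝ χ (U t) - (s - t) • inner ℝ χ (V t) =
      inner ℝ χ (U s - U t - (s - t) • V t) := fun χ => by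
    rw [inner_sub_right, inner_sub_right, inner_smul_right, smul_eq_mul]
  rw [e] at hs1 ⊢
  have hW : ‖U s - U t - (s - t) • V t‖ ≤ 2 * M * |s - t| := by
    refine (norm_sub_le _ _).trans ?_
    rw [norm_smul, Real.norm_eq_abs]
    have := norm_sub_le_of_weak_deriv hM hD hV h hs ht
    have := mul_le_mul_of_nonneg_left (hV t ht) (abs_nonneg (s - t))
    linarith
  have e2 : inner ℝ φ (U s - U t - (s - t) • V t) =
      inner ℝ ψ (U s - U t - (s - t) • V t) + inner ℝ (φ - ψ) (U s - U t - (s - t) • V t) := by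
    rw [← inner_add_left, add_sub_cancel]
  rw [e2]
  refine (norm_add_le _ _).trans ?_
  have h3 := (norm_inner_le_norm (𝕜 := ℝ) (φ - ψ) (U s - U t - (s - t) • V t)).trans
    (mul_le_mul_of_nonneg_left hW (norm_nonneg _))
  have h4 : ‖φ - ψ‖ * (2 * M * |s - t|) ≤ c / 2 * |s - t| := by
    have : 0 ≤ ‖φ - ψ‖ := norm_nonneg _
    have h5 : ‖φ - ψ‖ * (2 * M) ≤ c / 2 := by nlinarith
    calc ‖φ - ψ‖ * (2 * M * |s - t|) = ‖φ - ψ‖ * (2 * M) * |s - t| := by ring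
      _ ≤ _ := mul_le_mul_of_nonneg_right h5 (abs_nonneg _)
  rw [Real.norm_eq_abs (s - t)] at hs1 ⊢
  linarith

/-- Expand `‖U s‖² = 2⟨U t, U s⟩ + ‖U s - U t‖² - ‖U t‖²`: the first term has a derivative by the
weak equation tested with `U t`, and the second is `O(|s - t|²)`. No strong derivative of `U` is
needed. -/
theorem hasDerivWithinAt_norm_sq_of_weak_deriv (hM : 0 ≤ M) (hD : Dense D)
    (hV : ∀ t ∈ Icc 0 T, ‖V t‖ ≤ M)
    (h : ∀ φ ∈ D, ∀ t ∈ Icc 0 T,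
      HasDerivWithinAt (fun s => inner ℝ φ (U s)) (inner ℝ φ (V t)) (Icc 0 T) t)
    {t : ℝ} (ht : t ∈ Icc 0 T) :
    HasDerivWithinAt (fun s => ‖U s‖ ^ 2) (2 * inner ℝ (U t) (V t)) (Icc 0 T) t := by
  have h1 := hasDerivWithinAt_inner_of_dense hM hD hV h (U t) ht
  have h2 : HasDerivWithinAt (fun s => ‖U s - U t‖ ^ 2) 0 (Icc 0 T) t := by
    rw [hasDerivWithinAt_iff_isLittleO, Asymptotics.isLittleO_iff]
    intro c hc
    filter_upwards [self_mem_nhdsWithin,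
      mem_nhdsWithin_of_mem_nhds (Metric.ball_mem_nhds t
        (by positivity : 0 < c / (M ^ 2 + 1)))] with s hs hb
    rw [Metric.mem_ball, Real.dist_eq, lt_div_iff₀ (by positivity)] at hb
    have h3 := norm_sub_le_of_weak_deriv hM hD hV h hs ht
    have h4 : ‖U s - U t‖ ^ 2 ≤ (M * |s - t|) ^ 2 := pow_le_pow_left₀ (norm_nonneg _) h3 2
    simp only [sub_self, norm_zero, smul_zero, sub_zero, Real.norm_eq_abs]
    norm_num
    have h5 : |s - t| * (M ^ 2) ≤ c := by nlinarith [abs_nonneg (s - t)]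
    calc ‖U s - U t‖ ^ 2 ≤ (|s - t| * M ^ 2) * |s - t| := by linarith
      _ ≤ _ := mul_le_mul_of_nonneg_right h5 (abs_nonneg _)
  have h3 := ((h1.const_mul 2).add h2).sub_const (‖U t‖ ^ 2)
  refine (h3.congr_deriv (by ring)).congr_of_mem (fun s _ => ?_) ht
  have := norm_sub_sq_real (U s) (U t)
  simp only [Pi.add_apply, this, real_inner_comm (U s) (U t)]
  ring

end Hilbert

/-! ### Time derivatives of the Sobolev energies. -/

theorem inner_toLp_eq {N : ℕ} {p q : Space N → ℝ} (hp : MemLp p 2 volume) (hq : MemLp q 2 volume) :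
    inner ℝ (hp.toLp p) (hq.toLp q) = ∫ x, p x * q x := by
  rw [L2.inner_def]
  refine integral_congr_ae ?_
  filter_upwards [hp.coeFn_toLp, hq.coeFn_toLp] with x h1 h2
  rw [h1, h2]
  simp [mul_comm]

theorem hasDerivWithinAt_integral_sq {N : ℕ} {T M : ℝ} (hM : 0 ≤ M) {P Q : ℝ → Space N → ℝ}
    (hP : ∀ t ∈ Icc 0 T, MemLp (P t) 2 volume) (hQ : ∀ t ∈ Icc 0 T, MemLp (Q t) 2 volume)
    (hQM : ∀ t ∈ Icc 0 T, eLpNorm (Q t) 2 volume ≤ ENNReal.ofReal M)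
    (h : ∀ t ∈ Icc 0 T, ∀ φ : Space N → ℝ, IsTest φ →
      HasDerivWithinAt (fun s => ∫ x, φ x * P s x) (∫ x, φ x * Q t x) (Icc 0 T) t)
    {t : ℝ} (ht : t ∈ Icc 0 T) :
    HasDerivWithinAt (fun s => ∫ x, P s x ^ 2) (2 * ∫ x, P t x * Q t x) (Icc 0 T) t := by
  classical
  set U : ℝ → Lp ℝ 2 (volume : Measure (Space N)) := fun t =>
    if h : t ∈ Icc 0 T then (hP t h).toLp (P t) else 0 with hU
  set V : ℝ → Lp ℝ 2 (volume : Measure (Space N)) := fun t =>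
    if h : t ∈ Icc 0 T then (hQ t h).toLp (Q t) else 0 with hV
  have hU' : ∀ t (h : t ∈ Icc 0 T), U t = (hP t h).toLp (P t) := fun t h => dif_pos h
  have hV' : ∀ t (h : t ∈ Icc 0 T), V t = (hQ t h).toLp (Q t) := fun t h => dif_pos h
  have key := hasDerivWithinAt_norm_sq_of_weak_deriv (U := U) (V := V) (T := T) hM
    (Lp.dense_hasCompactSupport_contDiff (F := ℝ) (μ := (volume : Measure (Space N)))
      (p := 2) (by simp)) (fun t ht => ?_) ?_ ht
  · rw [hU' t ht, hV' t ht, inner_toLp_eq] at key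
    refine key.congr_of_mem (fun s hs => ?_) ht
    rw [hU' s hs, ← real_inner_self_eq_norm_sq, inner_toLp_eq]
    simp_rw [sq]
  · rw [hV' t ht, Lp.norm_toLp]
    exact ENNReal.toReal_le_of_le_ofReal hM (hQM t ht)
  · rintro f ⟨φ, hfφ, hφc, hφs⟩ t ht
    have hφ : IsTest φ := ⟨hφs, hφc⟩
    have hf : f = (hφ.memLp 2).toLp φ := by
      refine Lp.ext (hfφ.trans (hφ.memLp 2).coeFn_toLp.symm)
    rw [hf, hV' t ht, inner_toLp_eq]
    refine (h t ht φ hφ).congr_of_mem (fun s hs => ?_) ht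
    rw [hU' s hs, inner_toLp_eq]

/-- Integration by parts in `H¹`. -/
theorem HasSobolevDerivs.integral_mul_eq_neg {N : ℕ} {a b b' : Space N → ℝ}
    {D : (Fin N → ℕ) → Space N → ℝ} (hD : HasSobolevDerivs 1 a D) {i : Fin N}
    (hb : HasRealWeakDeriv (Pi.single i 1) b b') (hbL : MemLp b 2 volume)
    (hbL' : MemLp b' 2 volume) :
    ∫ x, D 0 x * b' x = -∫ x, D (Pi.single i 1) x * b x := by
  obtain ⟨C, hC, h1⟩ := eLpNorm_multiD_regularize_le N 1
  set A := ∑ α ∈ indicesLE N 1, (eLpNorm (D α) 2 volume).toReal with hAdef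
  have hA : 0 ≤ A := Finset.sum_nonneg fun _ _ => ENNReal.toReal_nonneg
  have hAD : ∀ α : Fin N → ℕ, ∑ i, α i ≤ 1 → eLpNorm (D α) 2 volume ≤ ENNReal.ofReal A :=
    fun α hα => by
      rw [ENNReal.le_ofReal_iff_toReal_le (hD α hα).2.eLpNorm_ne_top hA]
      exact Finset.single_le_sum (f := fun α => (eLpNorm (D α) 2 volume).toReal)
        (fun _ _ => ENNReal.toReal_nonneg) (mem_indicesLE.2 hα)
  have h2 := h1 a D hD A hA hAD
  have hreg := fun n => regularize_isTest n hD.locallyIntegrable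
  have hlim : ∀ α : Fin N → ℕ, ∑ i, α i ≤ 1 → ∀ c : Space N → ℝ, MemLp c 2 volume →
      Tendsto (fun n => ∫ x, c x * multiD α (regularize n a) x) atTop (𝓝 (∫ x, c x * D α x)) :=
    fun α hα c hc => tendsto_integral_mul_of_tendsto_ae (mul_nonneg hC hA)
      (fun n => ((hreg n).multiDeriv α).1.continuous.aestronglyMeasurable)
      (fun n => h2 n α hα) (multiD_regularize_tendsto hD hα) hc
  have hsum : ∑ j, (Pi.single i 1 : Fin N → ℕ) j = 1 := by simp
  have l0 := (hlim 0 (by simp) b' hbL').neg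
  have l1 := hlim (Pi.single i 1) hsum.le b hbL
  have e : ∀ n, ∫ x, b x * multiD (Pi.single i 1) (regularize n a) x =
      -∫ x, b' x * multiD 0 (regularize n a) x := fun n => by
    have := hb.2.2 _ (hreg n)
    rw [hsum] at this
    simp only [mul_comm (b _), mul_comm (b' _), multiD_zero]
    rw [this]
    ring
  simp_rw [e] at l1
  have := tendsto_nhds_unique l1 l0
  simp_rw [mul_comm (D _ _)]
  linarith

theorem HasWeakDeriv.add {N : ℕ} {α : Fin N → ℕ} {f g f' g' : Space N → ℂ}
    (h : HasWeakDeriv α f g) (h' : HasWeakDeriv α f' g') :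
    HasWeakDeriv α (fun x => f x + f' x) (fun x => g x + g' x) := by
  refine ⟨h.1.add h'.1, h.2.1.add h'.2.1, fun φ hφ => ?_⟩
  simp only [smul_add]
  rw [integral_add ((hφ.multiDeriv α).integrable_smul h.1)
    ((hφ.multiDeriv α).integrable_smul h'.1), integral_add (hφ.integrable_smul h.2.1)
    (hφ.integrable_smul h'.2.1), h.2.2 φ hφ, h'.2.2 φ hφ, mul_add]

theorem HasWeakDeriv.sum {N : ℕ} {α : Fin N → ℕ} {ι : Type*} (S : Finset ι)
    {f g : ι → Space N → ℂ} (h : ∀ i ∈ S, HasWeakDeriv α (f i) (g i)) :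
    HasWeakDeriv α (fun x => ∑ i ∈ S, f i x) (fun x => ∑ i ∈ S, g i x) := by
  classical
  induction S using Finset.induction with
  | empty =>
    simp only [Finset.sum_empty]
    exact ⟨locallyIntegrable_zero, locallyIntegrable_zero, fun φ _ => by simp⟩
  | insert j S hj ih =>
    simp only [Finset.sum_insert hj]
    exact (h j (Finset.mem_insert_self j S)).add
      (ih fun i hi => h i (Finset.mem_insert_of_mem hi))

theorem sum_add_single_two {N : ℕ} (α : Fin N → ℕ) (i : Fin N) :
    ∑ j, (α + Pi.single i 2 : Fin N → ℕ) j = ∑ j, α j + 2 := by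
  simp [Finset.sum_add_distrib]

theorem MemH.hasWeakDeriv_weakLaplacian {N s : ℕ} {f : Space N → ℂ} (h : MemH (s + 2) f)
    {α : Fin N → ℕ} (hα : ∑ i, α i ≤ s) :
    HasWeakDeriv α (weakLaplacian f) fun x => ∑ i, weakDeriv (α + Pi.single i 2) f x := by
  refine HasWeakDeriv.sum Finset.univ fun i _ => ?_
  exact HasWeakDeriv.of_add (h.hasWeakDeriv (by simp))
    (h.hasWeakDeriv (by rw [sum_add_single_two]; omega))

/-- The weak derivative `∂^α f`, `|α| ≤ k`, of `f ∈ H^{k+l}` lies in `H^l`. -/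
theorem MemH.weakDeriv_add {N k l : ℕ} {f : Space N → ℂ} (h : MemH (k + l) f) {α : Fin N → ℕ}
    (hα : ∑ i, α i ≤ k) {β : Fin N → ℕ} (hβ : ∑ i, β i ≤ l) :
    HasWeakDeriv β (weakDeriv α f) (weakDeriv (β + α) f) ∧
      MemLp (weakDeriv (β + α) f) 2 volume := by
  have hαβ : ∑ i, (β + α) i ≤ k + l := by
    simp only [Pi.add_apply, Finset.sum_add_distrib]; omega
  exact ⟨HasWeakDeriv.of_add (h.hasWeakDeriv (by omega)) (h.hasWeakDeriv hαβ),
    h.memLp_weakDeriv hαβ⟩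

/-- The contribution of the Laplacian to the energy vanishes. -/
theorem MemH.integral_laplacian_eq_zero {N s : ℕ} {f : Space N → ℂ} (h : MemH (s + 2) f)
    {α : Fin N → ℕ} (hα : ∑ i, α i ≤ s) (i : Fin N) :
    ∫ x, (weakDeriv α f x).re * (weakDeriv (α + Pi.single i 2) f x).im =
      ∫ x, (weakDeriv α f x).im * (weakDeriv (α + Pi.single i 2) f x).re := by
  have h1 : MemH (s + 1) f := h.mono (by omega)
  have hr : HasSobolevDerivs 1 (fun x => (weakDeriv α f x).re)
      fun β x => (weakDeriv (β + α) f x).re := fun β hβ =>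
    ⟨(h1.weakDeriv_add hα hβ).1.re, (h1.weakDeriv_add hα hβ).2.re⟩
  have hi : HasSobolevDerivs 1 (fun x => (weakDeriv α f x).im)
      fun β x => (weakDeriv (β + α) f x).im := fun β hβ =>
    ⟨(h1.weakDeriv_add hα hβ).1.im, (h1.weakDeriv_add hα hβ).2.im⟩
  have hs : ∑ j, (Pi.single i 1 : Fin N → ℕ) j = 1 := by simp
  have e : Pi.single i 1 + (Pi.single i 1 + α) = α + Pi.single i 2 := by
    rw [← add_assoc, ← Pi.single_add, add_comm]
  have h2 := MemH.weakDeriv_add (k := s + 1) (l := 1) h (α := Pi.single i 1 + α)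
    (by simp only [Pi.add_apply, Finset.sum_add_distrib, hs]; omega) (β := Pi.single i 1) hs.le
  have h3 := (h1.weakDeriv_add hα hs.le).2
  rw [e] at h2
  -- One integration by parts on each side leads to the same integral `-∫ ∂_i Re · ∂_i Im`.
  have k1 := hr.integral_mul_eq_neg h2.1.im h3.im h2.2.im
  have k2 := hi.integral_mul_eq_neg h2.1.re h3.re h2.2.re
  simp only [zero_add] at k1 k2
  change ∫ x, (weakDeriv α f x).re * (weakDeriv (α + Pi.single i 2) f x).im = _ at k1
  change ∫ x, (weakDeriv α f x).im * (weakDeriv (α + Pi.single i 2) f x).re = _ at k2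
  rw [k1, k2]
  congr 1
  refine integral_congr_ae (.of_forall fun x => mul_comm _ _)

theorem toReal_eLpNorm_sq {N : ℕ} {f : Space N → ℂ} (hf : MemLp f 2 volume) :
    (eLpNorm f 2 volume).toReal ^ 2 = (∫ x, (f x).re ^ 2) + ∫ x, (f x).im ^ 2 := by
  have h1 := hf.re.integrable_sq
  have h2 := hf.im.integrable_sq
  simp only [RCLike.re_to_complex, RCLike.im_to_complex] at h1 h2
  rw [← integral_add h1 h2, ← Lp.norm_toLp f hf, ← inner_self_eq_norm_sq (𝕜 := ℂ), L2.inner_def,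
    ← integral_re (L2.integrable_inner _ _)]
  refine integral_congr_ae ?_
  filter_upwards [hf.coeFn_toLp] with x hx
  rw [hx, inner_self_eq_norm_sq, Complex.sq_norm, Complex.normSq_apply]
  ring

theorem integral_im_mul_re_sub_le {N : ℕ} {f g : Space N → ℂ} (hf : MemLp f 2 volume)
    (hg : MemLp g 2 volume) :
    ∫ x, ((f x).im * (g x).re - (f x).re * (g x).im) ≤
      (eLpNorm f 2 volume).toReal * (eLpNorm g 2 volume).toReal := by
  have h1 : ∫ x, ((f x).im * (g x).re - (f x).re * (g x).im) =
      -(inner ℂ (hf.toLp f) (hg.toLp g)).im := by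
    rw [L2.inner_def, ← RCLike.im_to_complex, ← integral_im (L2.integrable_inner _ _),
      ← integral_neg]
    refine integral_congr_ae ?_
    filter_upwards [hf.coeFn_toLp, hg.coeFn_toLp] with x hx hx'
    rw [hx, hx']
    simp
    ring
  rw [h1, ← Lp.norm_toLp f hf, ← Lp.norm_toLp g hg]
  exact (neg_le_abs _).trans ((Complex.abs_im_le_norm _).trans (norm_inner_le_norm _ _))

/-- Use the equation with the test function `∂^α φ` and move the derivatives back at each time; the
two signs `(-1)^|α|` cancel. -/
theorem hasDerivWithinAt_weakDeriv_pairing {N s : ℕ} {T : ℝ} {u g : ℝ → Space N → ℂ}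
    (hu : ∀ t ∈ Icc 0 T, MemH (s + 2) (u t)) (hg : ∀ t ∈ Icc 0 T, MemH s (g t))
    (hev : ∀ t ∈ Icc 0 T, ∀ φ : Space N → ℝ, IsTest φ →
      HasDerivWithinAt (fun r => ∫ x, φ x • u r x)
        (Complex.I * ∫ x, φ x • (weakLaplacian (u t) x + g t x)) (Icc 0 T) t)
    {α : Fin N → ℕ} (hα : ∑ i, α i ≤ s) {t : ℝ} (ht : t ∈ Icc 0 T) {φ : Space N → ℝ}
    (hφ : IsTest φ) :
    HasDerivWithinAt (fun r => ∫ x, φ x • weakDeriv α (u r) x)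
      (Complex.I * ∫ x, φ x •
        (∑ i, weakDeriv (α + Pi.single i 2) (u t) x + weakDeriv α (g t) x)) (Icc 0 T) t := by
  have hW := ((hu t ht).hasWeakDeriv_weakLaplacian hα).add ((hg t ht).hasWeakDeriv hα)
  have h1 := (hev t ht _ (hφ.multiDeriv α)).const_mul ((-1 : ℂ) ^ (∑ i, α i))
  rw [hW.2.2 φ hφ] at h1
  have hsq : (-1 : ℂ) ^ (∑ i, α i) * (-1 : ℂ) ^ (∑ i, α i) = 1 := by
    rw [← mul_pow]; norm_num
  refine (h1.congr_deriv ?_).congr_of_mem (fun r hr => ?_) ht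
  · linear_combination (Complex.I * ∫ x, φ x •
        (∑ i, weakDeriv (α + Pi.single i 2) (u t) x + weakDeriv α (g t) x)) * hsq
  · rw [((hu r hr).hasWeakDeriv (α := α) (by omega)).2.2 φ hφ, ← mul_assoc, hsq, one_mul]

/-- With `y = ∂^α u` and `∂_t y = iW` weakly, the real and imaginary parts of `y` evolve by `-Im W`
and `Re W`. In the sum of the two energies the Laplacian terms cancel, and Cauchy–Schwarz bounds the
forcing term. -/
theorem hasDerivWithinAt_eLpNorm_weakDeriv_sq {N s : ℕ} {T A : ℝ} (hA : 0 ≤ A)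
    {u g : ℝ → Space N → ℂ}
    (hu : ∀ t ∈ Icc 0 T, MemH (s + 2) (u t)) (hg : ∀ t ∈ Icc 0 T, MemH s (g t))
    (huA : ∀ t ∈ Icc 0 T, hNorm (s + 2) (u t) ≤ A) (hgA : ∀ t ∈ Icc 0 T, hNorm s (g t) ≤ A)
    (hev : ∀ t ∈ Icc 0 T, ∀ φ : Space N → ℝ, IsTest φ →
      HasDerivWithinAt (fun r => ∫ x, φ x • u r x)
        (Complex.I * ∫ x, φ x • (weakLaplacian (u t) x + g t x)) (Icc 0 T) t)
    {α : Fin N → ℕ} (hα : ∑ i, α i ≤ s) {t : ℝ} (ht : t ∈ Icc 0 T) :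
    ∃ d, d ≤ 2 * ((eLpNorm (weakDeriv α (u t)) 2 volume).toReal *
        (eLpNorm (weakDeriv α (g t)) 2 volume).toReal) ∧
      HasDerivWithinAt (fun r => (eLpNorm (weakDeriv α (u r)) 2 volume).toReal ^ 2) d
        (Icc 0 T) t := by
  have hα2 : ∀ i, ∑ j, (α + Pi.single i 2 : Fin N → ℕ) j ≤ s + 2 := fun i => by
    rw [sum_add_single_two]; omega
  have hy : ∀ t ∈ Icc 0 T, MemLp (weakDeriv α (u t)) 2 volume := fun t ht =>
    (hu t ht).memLp_weakDeriv (by omega)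
  have hyi : ∀ t ∈ Icc 0 T, ∀ i, MemLp (weakDeriv (α + Pi.single i 2) (u t)) 2 volume :=
    fun t ht i => (hu t ht).memLp_weakDeriv (hα2 i)
  have hyg : ∀ t ∈ Icc 0 T, MemLp (weakDeriv α (g t)) 2 volume := fun t ht =>
    (hg t ht).memLp_weakDeriv hα
  set W : ℝ → Space N → ℂ := fun t x =>
    ∑ i, weakDeriv (α + Pi.single i 2) (u t) x + weakDeriv α (g t) x with hWdef
  have hWL : ∀ t ∈ Icc 0 T, MemLp (W t) 2 volume := fun t ht =>
    (memLp_finsetSum Finset.univ fun i _ => hyi t ht i).add (hyg t ht)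
  -- This bound, which uses `H^(s+2)`, only serves to justify the differentiation; `A` is absent
  -- from the energy inequality.
  have hWA : ∀ t ∈ Icc 0 T, eLpNorm (W t) 2 volume ≤ ENNReal.ofReal (N * A + A) := fun t ht => by
    have e : W t = (∑ i, weakDeriv (α + Pi.single i 2) (u t)) + weakDeriv α (g t) := by
      funext x; simp [hWdef]
    have m := memLp_finsetSum' Finset.univ fun i _ => hyi t ht i
    rw [e]
    refine (eLpNorm_add_le m.1 (hyg t ht).1 one_le_two).trans ?_
    rw [ENNReal.ofReal_add (by positivity) hA]
    refine add_le_add ?_ (((hg t ht).eLpNorm_weakDeriv_le hα).trans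
      (ENNReal.ofReal_le_ofReal (hgA t ht)))
    refine (eLpNorm_sum_le (fun i _ => (hyi t ht i).1) one_le_two).trans ?_
    refine (Finset.sum_le_sum fun i _ => ((hu t ht).eLpNorm_weakDeriv_le (hα2 i)).trans
      (ENNReal.ofReal_le_ofReal (huA t ht))).trans (le_of_eq ?_)
    rw [Finset.sum_const, Finset.card_univ, Fintype.card_fin, nsmul_eq_mul,
      ENNReal.ofReal_mul (Nat.cast_nonneg N), ENNReal.ofReal_natCast]
  have hpair := fun t (ht : t ∈ Icc 0 T) (φ : Space N → ℝ) (hφ : IsTest φ) =>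
    hasDerivWithinAt_weakDeriv_pairing hu hg hev hα ht hφ
  have hloc : ∀ t ∈ Icc 0 T, LocallyIntegrable (weakDeriv α (u t)) := fun t ht =>
    MemLp.locallyIntegrable_two (hy t ht)
  have hre := hasDerivWithinAt_integral_sq (P := fun t x => (weakDeriv α (u t) x).re)
    (Q := fun t x => -(W t x).im) (T := T) (M := N * A + A) (by positivity)
    (fun t ht => (hy t ht).re) (fun t ht => (hWL t ht).im.neg)
    (fun t ht => (eLpNorm_neg (fun x => (W t x).im) 2 volume).le.trans
      ((eLpNorm_im_le _).trans (hWA t ht))) (fun t ht φ hφ => by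
      have h1 := Complex.reCLM.hasFDerivAt.comp_hasDerivWithinAt t (hpair t ht φ hφ)
      refine (h1.congr_deriv ?_).congr_of_mem (fun r hr => ?_) ht
      · rw [Complex.reCLM_apply, Complex.I_mul_re,
          hφ.im_integral_smul (MemLp.locallyIntegrable_two (hWL t ht))]
        simp_rw [mul_neg]
        rw [integral_neg]
      · simp only [Function.comp, Complex.reCLM_apply]
        rw [hφ.re_integral_smul (hloc r hr)]) ht
  have him := hasDerivWithinAt_integral_sq (P := fun t x => (weakDeriv α (u t) x).im)
    (Q := fun t x => (W t x).re) (T := T) (M := N * A + A) (by positivity)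
    (fun t ht => (hy t ht).im) (fun t ht => (hWL t ht).re)
    (fun t ht => (eLpNorm_re_le _).trans (hWA t ht)) (fun t ht φ hφ => by
      have h1 := Complex.imCLM.hasFDerivAt.comp_hasDerivWithinAt t (hpair t ht φ hφ)
      refine (h1.congr_deriv ?_).congr_of_mem (fun r hr => ?_) ht
      · rw [Complex.imCLM_apply, Complex.I_mul_im,
          hφ.re_integral_smul (MemLp.locallyIntegrable_two (hWL t ht))]
      · simp only [Function.comp, Complex.imCLM_apply]
        rw [hφ.im_integral_smul (hloc r hr)]) ht
  refine ⟨_, ?_, (hre.add him).congr_of_mem (fun r hr => ?_) ht⟩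
  · rw [← mul_add]
    refine mul_le_mul_of_nonneg_left ?_ zero_le_two
    refine le_trans (le_of_eq ?_) (integral_im_mul_re_sub_le (hy t ht) (hyg t ht))
    have i1 : ∀ {a b : Space N → ℂ}, MemLp a 2 volume → MemLp b 2 volume →
        Integrable fun x => (a x).re * (b x).im := fun ha hb => MemLp.integrable_mul ha.re hb.im
    have i2 : ∀ {a b : Space N → ℂ}, MemLp a 2 volume → MemLp b 2 volume →
        Integrable fun x => (a x).im * (b x).re := fun ha hb => MemLp.integrable_mul ha.im hb.re
    have hy' := hy t ht
    have hi' := hyi t ht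
    have hg' := hyg t ht
    have e1 : ∫ x, (weakDeriv α (u t) x).re * (-(W t x).im) =
        -(∑ i, ∫ x, (weakDeriv α (u t) x).re * (weakDeriv (α + Pi.single i 2) (u t) x).im) -
          ∫ x, (weakDeriv α (u t) x).re * (weakDeriv α (g t) x).im := by
      rw [← neg_add', ← integral_finsetSum _ fun i _ => i1 hy' (hi' i),
        ← integral_add (integrable_finsetSum _ fun i _ => i1 hy' (hi' i)) (i1 hy' hg'),
        ← integral_neg]
      refine integral_congr_ae (.of_forall fun x => ?_)
      simp only [hWdef, Complex.add_im, Complex.im_sum, ← Finset.mul_sum]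
      ring
    have e2 : ∫ x, (weakDeriv α (u t) x).im * (W t x).re =
        (∑ i, ∫ x, (weakDeriv α (u t) x).im * (weakDeriv (α + Pi.single i 2) (u t) x).re) +
          ∫ x, (weakDeriv α (u t) x).im * (weakDeriv α (g t) x).re := by
      rw [← integral_finsetSum _ fun i _ => i2 hy' (hi' i),
        ← integral_add (integrable_finsetSum _ fun i _ => i2 hy' (hi' i)) (i2 hy' hg')]
      refine integral_congr_ae (.of_forall fun x => ?_)
      simp only [hWdef, Complex.add_re, Complex.re_sum, ← Finset.mul_sum]
      ring
    rw [integral_sub (i2 hy' hg') (i1 hy' hg'), e1, e2,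
      Finset.sum_congr rfl fun i _ => (hu t ht).integral_laplacian_eq_zero hα i]
    ring
  · exact toReal_eLpNorm_sq (hy r hr)

theorem hasDerivWithinAt_hNorm_sq {N s : ℕ} {T A : ℝ} (hA : 0 ≤ A) {u g : ℝ → Space N → ℂ}
    (hu : ∀ t ∈ Icc 0 T, MemH (s + 2) (u t)) (hg : ∀ t ∈ Icc 0 T, MemH s (g t))
    (huA : ∀ t ∈ Icc 0 T, hNorm (s + 2) (u t) ≤ A) (hgA : ∀ t ∈ Icc 0 T, hNorm s (g t) ≤ A)
    (hev : ∀ t ∈ Icc 0 T, ∀ φ : Space N → ℝ, IsTest φ →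
      HasDerivWithinAt (fun r => ∫ x, φ x • u r x)
        (Complex.I * ∫ x, φ x • (weakLaplacian (u t) x + g t x)) (Icc 0 T) t)
    {t : ℝ} (ht : t ∈ Icc 0 T) :
    ∃ d, d ≤ 2 * (hNorm s (u t) * hNorm s (g t)) ∧
      HasDerivWithinAt (fun r => hNorm s (u r) ^ 2) d (Icc 0 T) t := by
  classical
  choose! d hd1 hd2 using fun α (hα : α ∈ indicesLE N s) =>
    hasDerivWithinAt_eLpNorm_weakDeriv_sq hA hu hg huA hgA hev (mem_indicesLE.1 hα) ht
  refine ⟨∑ α ∈ indicesLE N s, d α, ?_, ?_⟩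
  · refine (Finset.sum_le_sum hd1).trans ?_
    rw [← Finset.mul_sum, hNorm_eq, hNorm_eq]
    exact mul_le_mul_of_nonneg_left (Real.sum_mul_le_sqrt_mul_sqrt _ _ _) zero_le_two
  · refine (HasDerivWithinAt.fun_sum hd2).congr_of_mem (fun r _ => ?_) ht
    rw [hNorm_eq, Real.sq_sqrt (Finset.sum_nonneg fun _ _ => sq_nonneg _)]

/-- The Gronwall lemma for the square of a norm. -/
theorem gronwall_sq {T L D : ℝ} (hL : 0 ≤ L) (hD : 0 ≤ D) {y : ℝ → ℝ}
    (hy : ∀ t ∈ Icc 0 T, 0 ≤ y t)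
    (h : ∀ t ∈ Icc 0 T, ∃ d, d ≤ 2 * (y t * (L * (y t + D))) ∧
      HasDerivWithinAt (fun r => y r ^ 2) d (Icc 0 T) t)
    {t : ℝ} (ht : t ∈ Icc 0 T) : y t ≤ (y 0 + D) * Real.exp (L * t) := by
  have h0 : (0 : ℝ) ∈ Icc 0 T := ⟨le_rfl, ht.1.trans ht.2⟩
  choose! d hd1 hd2 using h
  -- `y` itself may fail to be differentiable where it vanishes, so `√(y² + η²)` is used and `η`
  -- tends to zero at the end.
  have key : ∀ η : ℝ, 0 < η →
      (Real.sqrt (y t ^ 2 + η ^ 2) + D) * Real.exp (-(L * t)) ≤ Real.sqrt (y 0 ^ 2 + η ^ 2) + D := by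
    intro η hη
    have hpos : ∀ r, 0 < y r ^ 2 + η ^ 2 := fun r => by positivity
    have hder : ∀ r ∈ Icc 0 T, HasDerivWithinAt
        (fun r => (Real.sqrt (y r ^ 2 + η ^ 2) + D) * Real.exp (-(L * r)))
        (d r / (2 * Real.sqrt (y r ^ 2 + η ^ 2)) * Real.exp (-(L * r)) +
          (Real.sqrt (y r ^ 2 + η ^ 2) + D) * (Real.exp (-(L * r)) * (-L))) (Icc 0 T) r :=
      fun r hr => by
        have a1 := (((hd2 r hr).add_const (η ^ 2)).sqrt (hpos r).ne').add_const D
        have a2 : HasDerivWithinAt (fun r => Real.exp (-(L * r)))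
            (Real.exp (-(L * r)) * (-L)) (Icc 0 T) r := by
          have := (((hasDerivAt_id r).const_mul L).neg.exp).hasDerivWithinAt (s := Icc 0 T)
          simpa using this
        exact a1.mul a2
    have hanti : AntitoneOn (fun r => (Real.sqrt (y r ^ 2 + η ^ 2) + D) * Real.exp (-(L * r)))
        (Icc 0 T) := by
      refine antitoneOn_of_hasDerivWithinAt_nonpos (convex_Icc 0 T)
        (fun r hr => (hder r hr).continuousWithinAt)
        (fun r hr => (hder r (interior_subset hr)).mono interior_subset) fun r hr => ?_
      have hr' := interior_subset hr
      have hs := Real.sqrt_pos.2 (hpos r)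
      have hys : y r ≤ Real.sqrt (y r ^ 2 + η ^ 2) :=
        Real.le_sqrt_of_sq_le (by nlinarith)
      have : d r / (2 * Real.sqrt (y r ^ 2 + η ^ 2)) ≤ L * (Real.sqrt (y r ^ 2 + η ^ 2) + D) := by
        rw [div_le_iff₀ (by positivity)]
        have h1 : y r * (L * (y r + D)) ≤
            Real.sqrt (y r ^ 2 + η ^ 2) * (L * (Real.sqrt (y r ^ 2 + η ^ 2) + D)) := by
          have := hy r hr'
          gcongr
        linarith [hd1 r hr']
      have := mul_le_mul_of_nonneg_right this (Real.exp_pos (-(L * r))).le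
      linarith
    have := hanti h0 ht ht.1
    simpa using this
  have hlim : ∀ r, Tendsto (fun η : ℝ => Real.sqrt (y r ^ 2 + η ^ 2)) (𝓝[>] 0)
      (𝓝 (Real.sqrt (y r ^ 2))) := fun r => by
    have : Continuous fun η : ℝ => Real.sqrt (y r ^ 2 + η ^ 2) := by fun_prop
    have := this.tendsto 0
    simp only [ne_eq, OfNat.ofNat_ne_zero, not_false_eq_true, zero_pow, add_zero] at this
    exact this.mono_left nhdsWithin_le_nhds
  have h1 := le_of_tendsto_of_tendsto (((hlim t).add_const D).mul_const (Real.exp (-(L * t))))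
    ((hlim 0).add_const D) (by filter_upwards [self_mem_nhdsWithin] with η hη using key η hη)
  rw [Real.sqrt_sq (hy t ht), Real.sqrt_sq (hy 0 h0), Real.exp_neg,
    ← div_eq_mul_inv, div_le_iff₀ (Real.exp_pos _)] at h1
  linarith

/-! ### The comparison of the two equations -/

theorem hNorm_sub_comm {N k : ℕ} {f g : Space N → ℂ} (hf : MemH k f) (hg : MemH k g) :
    hNorm k (f - g) = hNorm k (g - f) := by
  rw [hNorm_eq, hNorm_eq]
  congr 1
  refine Finset.sum_congr rfl fun α hα => ?_
  rw [mem_indicesLE] at hα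
  rw [eLpNorm_congr_ae (hf.weakDeriv_sub_ae_eq hg hα),
    eLpNorm_congr_ae (hg.weakDeriv_sub_ae_eq hf hα), eLpNorm_sub_comm]

/-- Real suprema of unbounded sets are `0`, so boundedness has to be established before `supNorm`
controls anything. It follows from continuity by compactness of the interval. -/
theorem ContinuousInH.exists_hNorm_le {N k : ℕ} {T : ℝ} {Ψ : ℝ → Space N → ℂ}
    (h : ContinuousInH T k Ψ) : ∃ B, ∀ t ∈ Icc 0 T, hNorm k (Ψ t) ≤ B := by
  refine isCompact_Icc.induction_on (p := fun S => ∃ B, ∀ t ∈ S, hNorm k (Ψ t) ≤ B)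
    ⟨0, by simp⟩ (fun S S' hS ⟨B, hB⟩ => ⟨B, fun t ht => hB t (hS ht)⟩)
    (fun S S' ⟨B, hB⟩ ⟨B', hB'⟩ => ⟨max B B', fun t ht => ?_⟩) fun t ht => ?_
  · rcases ht with ht | ht
    · exact (hB t ht).trans (le_max_left _ _)
    · exact (hB' t ht).trans (le_max_right _ _)
  · refine ⟨{r | hNorm k (Ψ r) ≤ hNorm k (Ψ t) + 1}, ?_, _, fun r hr => hr⟩
    filter_upwards [(h.2 t ht).eventually_lt_const one_pos, self_mem_nhdsWithin] with r h1 hr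
    exact (hNorm_le_add_hNorm_sub (h.1 r hr) (h.1 t ht)).trans (by linarith)

theorem supNorm_nonneg {N : ℕ} (T : ℝ) {n : (Space N → ℂ) → ℝ} (hn : ∀ f, 0 ≤ n f)
    (Ψ : ℝ → Space N → ℂ) : 0 ≤ supNorm T n Ψ :=
  Real.sSup_nonneg (by rintro _ ⟨t, _, rfl⟩; exact hn _)

theorem hNorm_le_supNorm {N k l : ℕ} (hkl : k ≤ l) {T : ℝ} {Ψ : ℝ → Space N → ℂ}
    (h : ContinuousInH T l Ψ) {t : ℝ} (ht : t ∈ Icc 0 T) :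
    hNorm k (Ψ t) ≤ supNorm T (hNorm k) Ψ := by
  obtain ⟨B, hB⟩ := h.exists_hNorm_le
  refine le_csSup ⟨B, ?_⟩ ⟨t, ht, rfl⟩
  rintro _ ⟨r, hr, rfl⟩
  exact (hNorm_mono _ hkl).trans (hB r hr)

/-- The other terms are nonnegative, since a real supremum of nonnegative numbers is so even when
the set is unbounded. -/
theorem kappa_bounds {N : ℕ} (ε T : ℝ) (hε : 0 ≤ ε) (k : ℕ) (Ψε Ψ : ℝ → Space N → ℂ) :
    supNorm T (hNorm k) Ψ ≤ kappa ε T k Ψε Ψ ∧ supNorm T (hNorm k) Ψε ≤ kappa ε T k Ψε Ψ := by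
  have h1 := supNorm_nonneg T (hNorm_nonneg k) Ψ
  have h2 := supNorm_nonneg T (hNorm_nonneg k) Ψε
  have h3 := mul_nonneg (Real.sqrt_nonneg ε)
    (supNorm_nonneg T (n := gradHDotNorm k) (fun f => Real.sqrt_nonneg _) Ψε)
  have h4 := mul_nonneg hε
    (supNorm_nonneg T (n := laplacianHDotNorm k) (fun f => Real.sqrt_nonneg _) Ψε)
  unfold kappa
  constructor <;> linarith

theorem kappa_nonneg {N : ℕ} (ε T : ℝ) (hε : 0 ≤ ε) (k : ℕ) (Ψε Ψ : ℝ → Space N → ℂ) :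
    0 ≤ kappa ε T k Ψε Ψ :=
  (supNorm_nonneg T (hNorm_nonneg k) Ψ).trans (kappa_bounds ε T hε k Ψε Ψ).1

theorem ae_mul_norm_sq_le {N : ℕ} {ε σ : ℝ} (hε : 0 ≤ ε) (hσ : 0 ≤ σ) {f : Space N → ℂ}
    (h : ENNReal.ofReal (Real.sqrt ε) * eLpNorm f ⊤ volume ≤ ENNReal.ofReal σ) :
    ∀ᵐ x, ε * ‖f x‖ ^ 2 ≤ σ ^ 2 := by
  rw [eLpNorm_exponent_top] at h
  filter_upwards [enorm_ae_le_eLpNormEssSup f volume] with x hx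
  have h1 := (mul_le_mul_right hx (ENNReal.ofReal (Real.sqrt ε))).trans h
  rw [← ofReal_norm, ← ENNReal.ofReal_mul (Real.sqrt_nonneg ε),
    ENNReal.ofReal_le_ofReal_iff hσ] at h1
  have h2 := pow_le_pow_left₀ (by positivity) h1 2
  rwa [mul_pow, Real.sq_sqrt hε] at h2

theorem SolvesEvolution.hasDerivWithinAt {N : ℕ} {T : ℝ} {F : (Space N → ℂ) → Space N → ℂ}
    {Ψ : ℝ → Space N → ℂ} (h : SolvesEvolution T F Ψ) {t : ℝ} (ht : t ∈ Icc 0 T)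
    {φ : Space N → ℝ} (hφ : IsTest φ) :
    HasDerivWithinAt (fun r => ∫ x, φ x • Ψ r x) (Complex.I * ∫ x, φ x • F (Ψ t) x)
      (Icc 0 T) t := by
  obtain ⟨d, hd, e⟩ := (h t ht).2 φ hφ
  refine hd.congr_deriv ?_
  linear_combination (-Complex.I) * e + d * Complex.I_mul_I

/-- The argument in a fixed dimension: the forcing in the equation for `Ψε - Ψ` is bounded by `C K²
(‖Ψε - Ψ‖ + δ)`, and the Gronwall lemma applies with `δ` as the shift. -/
theorem exists_comparison_bound (s N : ℕ) (hN : 1 ≤ N) (hs : N < 2 * s) {σ : ℝ} (hσ0 : 0 < σ)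
    (hσ1 : σ < 1) :
    ∃ C : ℝ, 0 ≤ C ∧ ∀ (ε T : ℝ) (Ψε Ψ : ℝ → Space N → ℂ), 0 < ε → ε < 1 →
      IsSolutionNLS ε T (s + 2 + 2) Ψε →
      (∀ t ∈ Icc 0 T,
        ENNReal.ofReal (Real.sqrt ε) * eLpNorm (Ψε t) ⊤ volume ≤ ENNReal.ofReal σ) →
      IsSolutionCS T (s + 2) Ψ →
      ∀ t ∈ Icc 0 T, hNorm s (Ψε t - Ψ t) ≤
        (hNorm s (Ψε 0 - Ψ 0) + ε * kappa ε T (s + 2) Ψε Ψ * (1 + kappa ε T (s + 2) Ψε Ψ ^ 3)) *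
          Real.exp (C * kappa ε T (s + 2) Ψε Ψ ^ 2 * t) := by
  obtain ⟨C₁, hC₁, h1⟩ := exists_remainder_bound N s hN hs hσ0 hσ1
  obtain ⟨C₂, hC₂, h2⟩ := exists_cubic_difference_bound N s hs
  refine ⟨2 * C₁ + C₂, by positivity, fun ε T Ψε Ψ hε0 hε1 hΨε hσ hΨ t ht => ?_⟩
  set K := kappa ε T (s + 2) Ψε Ψ with hK
  have hK0 : 0 ≤ K := kappa_nonneg ε T hε0.le (s + 2) Ψε Ψ
  have b1 : ∀ t ∈ Icc 0 T, hNorm (s + 2) (Ψε t) ≤ K := fun t ht =>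
    (hNorm_le_supNorm (by omega) hΨε.1 ht).trans (kappa_bounds ε T hε0.le (s + 2) Ψε Ψ).2
  have b2 : ∀ t ∈ Icc 0 T, hNorm (s + 2) (Ψ t) ≤ K := fun t ht =>
    (hNorm_le_supNorm le_rfl hΨ.1 ht).trans (kappa_bounds ε T hε0.le (s + 2) Ψε Ψ).1
  have m1 : ∀ t ∈ Icc 0 T, MemH (s + 2) (Ψε t) := fun t ht => (hΨε.1.1 t ht).mono (by omega)
  have m2 : ∀ t ∈ Icc 0 T, MemH (s + 2) (Ψ t) := hΨ.1.1
  have m1' : ∀ t ∈ Icc 0 T, MemH s (Ψε t) := fun t ht => (m1 t ht).mono (by omega)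
  have m2' : ∀ t ∈ Icc 0 T, MemH s (Ψ t) := fun t ht => (m2 t ht).mono (by omega)
  have b1' : ∀ t ∈ Icc 0 T, hNorm s (Ψε t) ≤ K := fun t ht =>
    (hNorm_mono _ (by omega)).trans (b1 t ht)
  have b2' : ∀ t ∈ Icc 0 T, hNorm s (Ψ t) ≤ K := fun t ht =>
    (hNorm_mono _ (by omega)).trans (b2 t ht)
  rcases hK0.eq_or_lt with hK1 | hKpos
  -- The nonlinear bounds need a positive size `K`; for `K = 0` both solutions have zero norm.
  · have h3 := hNorm_sub_le (m1' t ht) (m2' t ht)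
    have h4 := b1' t ht
    have h5 := b2' t ht
    have h6 : (0 : ℝ) ≤ (hNorm s (Ψε 0 - Ψ 0) + ε * K * (1 + K ^ 3)) *
        Real.exp ((2 * C₁ + C₂) * K ^ 2 * t) := by
      have := hNorm_nonneg s (Ψε 0 - Ψ 0)
      positivity
    linarith
  set δ := ε * K * (1 + K ^ 3) with hδ
  have hδpos : 0 < δ := by positivity
  set g : ℝ → Space N → ℂ := fun t => (nlsOperator ε (Ψε t) - csOperator (Ψε t)) -
    fun x => ((‖Ψ t x‖ ^ 2 / 2 : ℝ) : ℂ) * Ψ t x - ((‖Ψε t x‖ ^ 2 / 2 : ℝ) : ℂ) * Ψε t x with hg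
  have hr := fun t ht => h1 ε K (Ψε t) hε0 hε1 hKpos (m1 t ht) (b1 t ht)
    (ae_mul_norm_sq_le hε0.le hσ0.le (hσ t ht))
  -- The scale of the difference must be positive even where the solutions coincide; adding `δ` is
  -- harmless, as it appears in the final bound anyway.
  have hc := fun t ht => h2 (Ψ t) (Ψε t) K (hNorm s (Ψε t - Ψ t) + δ) hKpos
    (add_pos_of_nonneg_of_pos (hNorm_nonneg _ _) hδpos) (m2' t ht) (m1' t ht) (b2' t ht)
    (b1' t ht) (by rw [hNorm_sub_comm (m2' t ht) (m1' t ht)]; linarith)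
  have hgm : ∀ t ∈ Icc 0 T, MemH s (g t) := fun t ht => (hr t ht).1.sub (hc t ht).1
  -- This is `(1 + K²)(1 + K) ≤ 2(1 + K³)`, whose difference is `(1 - K)²(1 + K)`.
  have hεK : ε * (K ^ 3 + K ^ 5) * (1 + K) ≤ 2 * K ^ 2 * δ := by
    have : 0 ≤ ε * K ^ 3 * ((1 - K) ^ 2 * (1 + K)) := by positivity
    rw [hδ]
    nlinarith
  have hgb : ∀ t ∈ Icc 0 T,
      hNorm s (g t) ≤ (2 * C₁ + C₂) * K ^ 2 * (hNorm s (Ψε t - Ψ t) + δ) := fun t ht => by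
    refine (hNorm_sub_le (hr t ht).1 (hc t ht).1).trans ?_
    have a1 := (hr t ht).2.trans (mul_le_mul_of_nonneg_left hεK hC₁)
    have a2 := (hc t ht).2
    have a3 : 0 ≤ 2 * C₁ * K ^ 2 * hNorm s (Ψε t - Ψ t) := by
      have := hNorm_nonneg s (Ψε t - Ψ t)
      positivity
    linarith
  have hub : ∀ t ∈ Icc 0 T, hNorm (s + 2) (Ψε t - Ψ t) ≤ 2 * K := fun t ht => by
    have := hNorm_sub_le (m1 t ht) (m2 t ht)
    linarith [b1 t ht, b2 t ht]
  have hev : ∀ t ∈ Icc 0 T, ∀ φ : Space N → ℝ, IsTest φ →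
      HasDerivWithinAt (fun r => ∫ x, φ x • (Ψε r - Ψ r) x)
        (Complex.I * ∫ x, φ x • (weakLaplacian (Ψε t - Ψ t) x + g t x)) (Icc 0 T) t :=
    fun t ht φ hφ => by
      have d1 := (hΨε.2.hasDerivWithinAt ht hφ).sub (hΨ.2.hasDerivWithinAt ht hφ)
      refine (d1.congr_deriv ?_).congr_of_mem (fun r hr => ?_) ht
      · rw [← mul_sub, ← integral_sub (hφ.integrable_smul (hΨε.2 t ht).1)
          (hφ.integrable_smul (hΨ.2 t ht).1)]
        congr 1
        refine integral_congr_ae ?_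
        have hΔ : ∀ᵐ x, ∀ i, weakDeriv (Pi.single i 2) (Ψε t - Ψ t) x =
            (weakDeriv (Pi.single i 2) (Ψε t) - weakDeriv (Pi.single i 2) (Ψ t)) x :=
          ae_all_iff.2 fun i => (m1 t ht).weakDeriv_sub_ae_eq (m2 t ht) (by simp)
        filter_upwards [hΔ] with x hx
        rw [← smul_sub]
        congr 1
        simp only [hg, Pi.sub_apply, csOperator, weakLaplacian, hx, Finset.sum_sub_distrib]
        ring
      · simp only [Pi.sub_apply, smul_sub]
        exact integral_sub (hφ.integrable_smul (m1 r hr).locallyIntegrable)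
          (hφ.integrable_smul (m2 r hr).locallyIntegrable)
  -- A bound uniform in time, required to differentiate the energy but not entering the result.
  have hgb2 : ∀ t ∈ Icc 0 T, hNorm s (g t) ≤ (2 * C₁ + C₂) * K ^ 2 * (2 * K + δ) :=
    fun t ht => by
      have := (hNorm_mono (Ψε t - Ψ t) (by omega : s ≤ s + 2)).trans (hub t ht)
      exact (hgb t ht).trans (by gcongr)
  have hA : 0 ≤ (2 * C₁ + C₂) * K ^ 2 * (2 * K + δ) := by positivity
  refine gronwall_sq (y := fun t => hNorm s (Ψε t - Ψ t)) (by positivity) hδpos.le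
    (fun t _ => hNorm_nonneg _ _) (fun t ht => ?_) ht
  obtain ⟨d, hd1, hd2⟩ := hasDerivWithinAt_hNorm_sq
    (A := 2 * K + (2 * C₁ + C₂) * K ^ 2 * (2 * K + δ)) (by positivity)
    (fun t ht => (m1 t ht).sub (m2 t ht)) hgm
    (fun t ht => (hub t ht).trans (by linarith)) (fun t ht => (hgb2 t ht).trans (by linarith))
    hev ht
  refine ⟨d, hd1.trans ?_, hd2⟩
  have := hgb t ht
  have := hNorm_nonneg s (Ψε t - Ψ t)
  gcongr

end CubicRegime

/-! ### Uniformity of the constant over the admissible dimensions. -/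

theorem mainTheorem7 (k : ℕ) (σ : ℝ) (hσ0 : 0 < σ) (hσ1 : σ < 1) :
    ∃ C : ℝ, 0 < C ∧
      ∀ (N : ℕ), 1 ≤ N → (N : ℝ) / 2 + 2 < (k : ℝ) →
      ∀ (ε : ℝ), 0 < ε → ε < 1 →
      ∀ (T : ℝ), 0 < T →
      ∀ (Ψε0 Ψ0 : CubicRegime.Space N → ℂ) (Ψε Ψ : ℝ → CubicRegime.Space N → ℂ),
        CubicRegime.MemH (k + 3) Ψε0 →
        CubicRegime.IsSolutionNLS ε T (k + 2) Ψε → Ψε 0 =ᵐ[volume] Ψε0 →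
        (∀ t ∈ Set.Icc 0 T,
          ENNReal.ofReal (Real.sqrt ε) * eLpNorm (Ψε t) ⊤ volume ≤ ENNReal.ofReal σ) →
        CubicRegime.MemH k Ψ0 →
        CubicRegime.IsSolutionCS T k Ψ → Ψ 0 =ᵐ[volume] Ψ0 →
        ∀ t ∈ Set.Icc 0 T,
          CubicRegime.hNorm (k - 2) (Ψε t - Ψ t)
            ≤ (CubicRegime.hNorm (k - 2) (Ψε 0 - Ψ 0)
                + ε * CubicRegime.kappa ε T k Ψε Ψ * (1 + CubicRegime.kappa ε T k Ψε Ψ ^ 3))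
              * Real.exp (C * CubicRegime.kappa ε T k Ψε Ψ ^ 2 * t) := by
  have h : ∀ N : ℕ, ∃ C : ℝ, 0 ≤ C ∧ (1 ≤ N → (N : ℝ) / 2 + 2 < k → ∀ (ε T : ℝ)
      (Ψε Ψ : ℝ → CubicRegime.Space N → ℂ), 0 < ε → ε < 1 →
      CubicRegime.IsSolutionNLS ε T (k + 2) Ψε →
      (∀ t ∈ Set.Icc 0 T,
        ENNReal.ofReal (Real.sqrt ε) * eLpNorm (Ψε t) ⊤ volume ≤ ENNReal.ofReal σ) →
      CubicRegime.IsSolutionCS T k Ψ →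
      ∀ t ∈ Set.Icc 0 T, CubicRegime.hNorm (k - 2) (Ψε t - Ψ t) ≤
        (CubicRegime.hNorm (k - 2) (Ψε 0 - Ψ 0) + ε * CubicRegime.kappa ε T k Ψε Ψ *
          (1 + CubicRegime.kappa ε T k Ψε Ψ ^ 3)) *
          Real.exp (C * CubicRegime.kappa ε T k Ψε Ψ ^ 2 * t)) := fun N => by
    -- Inadmissible dimensions receive the constant `0`, so that a constant can be chosen for every
    -- `N`.
    by_cases hN : 1 ≤ N ∧ (N : ℝ) / 2 + 2 < k
    · have hk2 : 2 < k := by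
        have : (2 : ℝ) < k := by
          have := hN.2
          have : (0 : ℝ) ≤ N := Nat.cast_nonneg N
          linarith
        exact_mod_cast this
      obtain ⟨s, rfl⟩ : ∃ s, k = s + 2 := ⟨k - 2, by omega⟩
      have hs : N < 2 * s := by
        have h2 := hN.2
        push_cast at h2
        have : (N : ℝ) < 2 * s := by linarith
        exact_mod_cast this
      obtain ⟨C, hC, h⟩ := CubicRegime.exists_comparison_bound s N hN.1 hs hσ0 hσ1
      exact ⟨C, hC, fun _ _ => h⟩
    · exact ⟨0, le_rfl, fun h1 h2 => absurd ⟨h1, h2⟩ hN⟩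
  choose C hC h using h
  have hsum : 0 ≤ ∑ N ∈ Finset.range (2 * k), C N := Finset.sum_nonneg fun N _ => hC N
  -- The condition `N/2 + 2 < k` forces `N < 2k`, so a finite sum dominates all constants; the added
  -- `1` makes it positive.
  refine ⟨∑ N ∈ Finset.range (2 * k), C N + 1, by positivity, ?_⟩
  intro N hN hNk ε hε0 hε1 T _ Ψε0 Ψ0 Ψε Ψ _ hΨε _ hσ _ hΨ _ t ht
  have hNmem : N ∈ Finset.range (2 * k) := by
    rw [Finset.mem_range]
    have : (N : ℝ) < 2 * k := by linarith
    exact_mod_cast this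
  have hCN : C N ≤ ∑ N ∈ Finset.range (2 * k), C N + 1 :=
    (Finset.single_le_sum (f := C) (fun N _ => hC N) hNmem).trans (by linarith)
  refine (h N hN hNk ε T Ψε Ψ hε0 hε1 hΨε hσ hΨ t ht).trans ?_
  have hK := CubicRegime.kappa_nonneg ε T hε0.le k Ψε Ψ
  have ht0 := ht.1
  refine mul_le_mul_of_nonneg_left (Real.exp_le_exp.2 (by gcongr)) ?_
  have := CubicRegime.hNorm_nonneg (k - 2) (Ψε 0 - Ψ 0)
  positivity
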